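/- Let $(\mathcal X,d)$ be a locally compact separable metric space and $m$ a Radon measure on $\mathcal X$ with full support (atoms allowed). Write $B(x,r)=\{y: d(x,y)<r\}$ and $V(x,r)=m(B(x,r))$. Let $J:\mathcal X\times\mathcal X\to[0,\infty]$ be symmetric and measurable, $J(dx,dy)=J(x,y)\,m(dx)\,m(dy)$, and $$\mathcal F=\Big\{u\in L^2(\mathcal X;m):\int_{\mathcal X\times\mathcal X}(u(x)-u(y))^2J(dx,dy)<\infty\Big\},\qquad \mathcal E(u,v)=\tfrac12\int_{\mathcal X\times\mathcal X}(u(x)-u(y))(v(x)-v(y))\,J(dx,dy),$$ and assume that $(\mathcal E,\mathcal F)$ is a regular Dirichlet form on $L^2(\mathcal X;m)$, i.e. $\mathcal F\cap C_c(\mathcal X)$ is dense in $\mathcal F$ for the norm $(\mathcal E(u,u)+\|u\|_{L^2}^2)^{1/2}$ and dense in $C_c(\mathcal X)$ for the uniform norm. Let $\phi:[0,\infty)\to[0,\infty)$ be strictly increasing with $\phi(0)=0$, $\phi(1)=1$, and suppose there are $c_1,c_2>0$ and $\beta_2\ge\beta_1>0$ with $c_1(R/r)^{\beta_1}\le\phi(R)/\phi(r)\le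 c_2(R/r)^{\beta_2}$ for all $0<r\le R<\infty$. Definitions. (VD): there is $C>1$ with $V(x,2r)\le C\,V(x,r)$ for all $x\in\mathcal X$, $r>0$. $\mathbf J_\phi$: there are $C_1,C_2>0$ with $$\frac{C_1}{V(x,d(x,y))\,\phi(d(x,y))}\le J(x,y)\le\frac{C_2}{V(x,d(x,y))\,\phi(d(x,y))}\qquad\text{for all }x\ne y.$$ A cut-off function for $U\subset V$ is a measurable $\varphi$ with $0\le\varphi\le1$ on $\mathcal X$, $\varphi=1$ on $U$ and $\varphi=0$ on $\mathcal X\setminus V$. $\mathrm{CSJ}(\phi)$: there are $c,C_0\in(0,1]$ and $C_1,C_2>0$ such that for all $0<r\le R<c\,\mathrm{diam}(\mathcal X)$, for $m$-almost every $x_0\in\mathcal X$ and every $f\in\mathcal F$, there is a cut-off function $\varphi\in\mathcal F$ for $B(x_0,R)\subset B(x_0,R+r)$ with $$\int_{B(x_0,R+(1+C_0)r)}f^2\,d\Gamma(\varphi,\varphi)\le C_1\int_{U\times U^*}(f(x)-f(y))^2J(dx,dy)+\frac{C_2}{\phi(r)}\int_{B(x_0,R+(1+C_0)r)}f^2\,dm,$$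 where $U=B(x_0,R+r)\setminus B(x_0,R)$, $U^*=B(x_0,R+(1+C_0)r)\setminus B(x_0,R-C_0r)$ and $\Gamma(\varphi,\varphi)(dx)=\int_{y\in\mathcal X}(\varphi(x)-\varphi(y))^2J(dx,dy)$. A set $D\subset\mathcal X$ is Ahlfors regular if there is $c_D\in(0,1]$ with $m(B(x,r)\cap D)\ge c_D\,m(B(x,r))$ for all $x\in D$ and $0<r<\mathrm{diam}(D)/2$, where $\mathrm{diam}(D)=\sup_{x,y\in D}d(x,y)\in[0,\infty]$. For an open set $D\subset\mathcal X$ let $m_0(A)=m(A\cap D)$ for Borel $A\subset\overline D$, and let $(\bar{\mathcal E},\bar{\mathcal F})$ be the active reflected Dirichlet form on $L^2(\overline D;m_0)$, $$\bar{\mathcal F}=\Big\{u\in L^2(\overline D;m_0):\int_{D\times D}(u(x)-u(y))^2J(dx,dy)<\infty\Big\},\qquad \bar{\mathcal E}(u,v)=\tfrac12\int_{D\times D}(u(x)-u(y))(v(x)-v(y))\,J(dx,dy),$$ whose jump measure is $J(dx,dy)$ restricted to $D\times D$. $\mathrm{CSJ}(\phi)$ for $(\overline D,d,m_0,\bar{\mathcal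 E},\bar{\mathcal F})$ is the condition above with $\mathcal X$, $m$, $\mathcal F$, the jump measure and the balls replaced by those of this space. Theorem. If (VD), $\mathbf J_\phi$ and $\mathrm{CSJ}(\phi)$ hold for $(\mathcal X,d,m,\mathcal E,\mathcal F)$ and $D\subset\mathcal X$ is an Ahlfors regular open set, then $\mathrm{CSJ}(\phi)$ holds for $(\overline D,d,m_0,\bar{\mathcal E},\bar{\mathcal F})$. -/

import Mathlib

open MeasureTheory Set TopologicalSpace
open scoped ENNReal

noncomputable section

namespace MMD

variable {X : Type*} [MetricSpace X] [MeasurableSpace X]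

/-- Volume doubling (VD) for the metric measure space `(X, d, m)`. -/
def VolumeDoubling (m : Measure X) : Prop :=
  ∃ C : ℝ, 1 < C ∧ ∀ (x : X) (r : ℝ), 0 < r →
    m (Metric.ball x (2 * r)) ≤ ENNReal.ofReal C * m (Metric.ball x r)

/-- Ahlfors regularity of a subset `D` of the metric measure space `(X, d, m)`.  The diameter is
extended-valued, so every radius is allowed when `D` is unbounded. -/
def AhlforsRegular (m : Measure X) (D : Set X) : Prop :=
  ∃ c : ℝ, 0 < c ∧ c ≤ 1 ∧ ∀ x ∈ D, ∀ r : ℝ, 0 < r →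
    ENNReal.ofReal r < Metric.ediam D / 2 →
      ENNReal.ofReal c * m (Metric.ball x r) ≤ m (Metric.ball x r ∩ D)

/-- The admissible scale functions `φ : [0, ∞) → [0, ∞)`; the values of `φ` at negative numbers
play no role. -/
structure IsScaleFunction (φ : ℝ → ℝ) : Prop where
  strictMonoOn : StrictMonoOn φ (Ici 0)
  map_zero : φ 0 = 0
  map_one : φ 1 = 1
  growth : ∃ c₁ c₂ β₁ β₂ : ℝ, 0 < c₁ ∧ 0 < c₂ ∧ 0 < β₁ ∧ β₁ ≤ β₂ ∧
    ∀ r R : ℝ, 0 < r → r ≤ R →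
      c₁ * (R / r) ^ β₁ ≤ φ R / φ r ∧ φ R / φ r ≤ c₂ * (R / r) ^ β₂

/-- The jump measure `J(dx, dy) = J(x, y) m(dx) m(dy)` on `X × X`. -/
def jumpMeasure (m : Measure X) (J : X → X → ℝ≥0∞) : Measure (X × X) :=
  (m.prod m).withDensity fun p => J p.1 p.2

/-- The domain `𝓕` of the pure-jump form with jump kernel `J`: square-integrable functions `u`
with `∫∫ (u(x) - u(y))² J(dx, dy) < ∞`.  Elements are functions; being in `𝓕` only depends on the
`m`-a.e. class. -/
def formDomain (m : Measure X) (J : X → X → ℝ≥0∞) : Set (X → ℝ) :=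
  {u | MemLp u 2 m ∧ ∫⁻ p, ENNReal.ofReal ((u p.1 - u p.2) ^ 2) ∂(jumpMeasure m J) < ∞}

/-- The form `𝓔(u, v) = ½ ∫∫ (u(x) - u(y)) (v(x) - v(y)) J(dx, dy)`, for `u, v ∈ 𝓕`. -/
def form (m : Measure X) (J : X → X → ℝ≥0∞) (u v : X → ℝ) : ℝ :=
  1 / 2 * ∫ p, (u p.1 - u p.2) * (v p.1 - v p.2) ∂(jumpMeasure m J)

/-- Regularity of `(𝓔, 𝓕)` on `L²(X; m)`: `𝓕 ∩ C_c(X)` is dense in `𝓕` for the norm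
`𝓔(u, u) + ‖u‖²_{L²}`, and dense in `C_c(X)` for the uniform norm. -/
def IsRegularForm (m : Measure X) (J : X → X → ℝ≥0∞) : Prop :=
  (∀ u ∈ formDomain m J, ∀ ε : ℝ, 0 < ε →
    ∃ v ∈ formDomain m J, Continuous v ∧ HasCompactSupport v ∧
      form m J (u - v) (u - v) + ∫ x, (u x - v x) ^ 2 ∂m < ε) ∧
  (∀ u : X → ℝ, Continuous u → HasCompactSupport u → ∀ ε : ℝ, 0 < ε →
    ∃ v ∈ formDomain m J, Continuous v ∧ HasCompactSupport v ∧ ∀ x, |u x - v x| < ε)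

/-- The two-sided jump kernel bounds `J_φ`. -/
def JumpKernelBounds (m : Measure X) (J : X → X → ℝ≥0∞) (φ : ℝ → ℝ) : Prop :=
  ∃ C₁ C₂ : ℝ, 0 < C₁ ∧ 0 < C₂ ∧ ∀ x y : X, x ≠ y →
    ENNReal.ofReal C₁ / (m (Metric.ball x (dist x y)) * ENNReal.ofReal (φ (dist x y))) ≤ J x y ∧
    J x y ≤ ENNReal.ofReal C₂ / (m (Metric.ball x (dist x y)) * ENNReal.ofReal (φ (dist x y)))

/-- `ϕ` is a cut-off function for `U ⊆ V`. -/
structure IsCutoff (ϕ : X → ℝ) (U V : Set X) : Prop where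
  measurable : Measurable ϕ
  nonneg : ∀ x, 0 ≤ ϕ x
  le_one : ∀ x, ϕ x ≤ 1
  eq_one : ∀ x ∈ U, ϕ x = 1
  eq_zero : ∀ x ∉ V, ϕ x = 0

/-- The energy measure `Γ(u, u)(dx) = ∫_{y ∈ X} (u(x) - u(y))² J(dx, dy)`. -/
def energyMeasure (m : Measure X) (J : X → X → ℝ≥0∞) (u : X → ℝ) : Measure X :=
  m.withDensity fun x => ∫⁻ y, ENNReal.ofReal ((u x - u y) ^ 2) * J x y ∂m

/-- The cut-off Sobolev inequality `CSJ(φ)` for the pure-jump form with jump kernel `J` on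
`L²(X; m)`.  All integrals are of nonnegative functions and take values in `[0, ∞]`. -/
def CSJ (m : Measure X) (J : X → X → ℝ≥0∞) (φ : ℝ → ℝ) : Prop :=
  ∃ c C₀ C₁ C₂ : ℝ, 0 < c ∧ c ≤ 1 ∧ 0 < C₀ ∧ C₀ ≤ 1 ∧ 0 < C₁ ∧ 0 < C₂ ∧
    ∀ r R : ℝ, 0 < r → r ≤ R →
      ENNReal.ofReal R < ENNReal.ofReal c * Metric.ediam (univ : Set X) →
    ∀ᵐ x₀ ∂m, ∀ f ∈ formDomain m J, ∃ ϕ ∈ formDomain m J,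
      IsCutoff ϕ (Metric.ball x₀ R) (Metric.ball x₀ (R + r)) ∧
      ∫⁻ x in Metric.ball x₀ (R + (1 + C₀) * r),
          ENNReal.ofReal (f x ^ 2) ∂(energyMeasure m J ϕ) ≤
        ENNReal.ofReal C₁ *
          ∫⁻ p in (Metric.ball x₀ (R + r) \ Metric.ball x₀ R) ×ˢ
              (Metric.ball x₀ (R + (1 + C₀) * r) \ Metric.ball x₀ (R - C₀ * r)),
            ENNReal.ofReal ((f p.1 - f p.2) ^ 2) ∂(jumpMeasure m J) +
        ENNReal.ofReal (C₂ / φ r) *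
          ∫⁻ x in Metric.ball x₀ (R + (1 + C₀) * r), ENNReal.ofReal (f x ^ 2) ∂m

/-- The measure `m₀(A) = m(A ∩ D)` on the closure of `D`. -/
def reflectedMeasure (m : Measure X) (D : Set X) : Measure (closure D) :=
  (m.restrict D).comap Subtype.val

/-- The jump kernel of the active reflected form: `J` restricted to the closure of `D`.  Together
with `m₀` it gives the jump measure `1_{D × D} J(dx, dy)`, so that `formDomain` and `form` for
`(m₀, J̄)` are the domain and the form of the active reflected Dirichlet form. -/
def reflectedKernel (J : X → X → ℝ≥0∞) (D : Set X) : closure D → closure D → ℝ≥0∞ :=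
  fun x y => J x y

theorem reflectedMeasure_apply [BorelSpace X] (m : Measure X) (D : Set X)
    {A : Set (closure D)} (hA : MeasurableSet A) :
    reflectedMeasure m D A = m (Subtype.val '' A ∩ D) := by
  have hc : MeasurableSet (closure D) := isClosed_closure.measurableSet
  rw [reflectedMeasure, (MeasurableEmbedding.subtype_coe hc).comap_apply,
    Measure.restrict_apply ((MeasurableEmbedding.subtype_coe hc).measurableSet_image.2 hA)]

theorem map_reflectedMeasure [BorelSpace X] (m : Measure X) (D : Set X) :
    (reflectedMeasure m D).map Subtype.val = m.restrict D := by
  have hc : MeasurableSet (closure D) := isClosed_closure.measurableSet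
  rw [reflectedMeasure, (MeasurableEmbedding.subtype_coe hc).map_comap, Subtype.range_coe,
    Measure.restrict_restrict hc, inter_eq_right.2 subset_closure]

/-- The jump measure of the reflected form is `J(dx, dy)` restricted to `D × D`. -/
theorem map_jumpMeasure_reflected [BorelSpace X] (m : Measure X) [SigmaFinite m]
    (J : X → X → ℝ≥0∞) (hJ : Measurable fun p : X × X => J p.1 p.2)
    (D : Set X) (hD : MeasurableSet D) :
    (jumpMeasure (reflectedMeasure m D) (reflectedKernel J D)).map
        (Prod.map Subtype.val Subtype.val) =
      (jumpMeasure m J).restrict (D ×ˢ D) := by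
  have hc : MeasurableSet (closure D) := isClosed_closure.measurableSet
  have he := MeasurableEmbedding.subtype_coe hc
  have : SigmaFinite (reflectedMeasure m D) :=
    SigmaFinite.of_map _ he.measurable.aemeasurable
      (by rw [map_reflectedMeasure]; infer_instance)
  have hp : Measurable (Prod.map (Subtype.val : closure D → X) (Subtype.val : closure D → X)) :=
    he.measurable.prodMap he.measurable
  have hmap : ((reflectedMeasure m D).prod (reflectedMeasure m D)).map
      (Prod.map Subtype.val Subtype.val) = (m.prod m).restrict (D ×ˢ D) := by
    rw [← Measure.prod_restrict, ← map_reflectedMeasure,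
      Measure.map_prod_map _ _ he.measurable he.measurable]
  ext s hs
  rw [Measure.map_apply hp hs, Measure.restrict_apply hs, jumpMeasure, jumpMeasure,
    withDensity_apply _ (hp hs), withDensity_apply _ (hs.inter (hD.prod hD)),
    ← Measure.restrict_restrict hs, ← hmap, setLIntegral_map hs hJ hp]
  rfl

end MMD

end

/-!
The inequality `CSJ(φ)` for `D` is obtained by applying the one for `X` to an extension of `f` and
restricting the cut-off function to `D`.  For this the extension `g` of `f : D → ℝ` must satisfy,
*locally*, `∫ g² ≤ C ∫ f²` and `𝓔(g) ≤ C (𝓔_D(f) + φ(r)⁻¹ ∫ f²)`, where the sets of integration grow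
by a small multiple of `r` only when one passes from `g` to `f`.

The extension is of Whitney type, at scale `s = r / 6400`.  The complement of `D` near `D` is
covered by balls of radius comparable with the distance to `D`.  As `D` is Ahlfors regular, each of
them can be reflected to a set `E i ⊆ D` of comparable measure, at a distance of the order of the
radius, in such a way that the reflected sets have bounded overlap
(`VolumeDoubling.exists_reflected_sets`); the value attached to the ball is the average of `f` over
`E i`.  These values are blended by a partition of unity.  Lipschitz functions need not have finite
energy here; the partition is built from cut-off functions of energy at most `C V(x, t) / φ(t)` for
balls of radius `t`,
which `CSJ(φ)` on `X` itself supplies (`CSJ.exists_cutoff_energy_le`).  The boundary of `D` is a null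
set (`AhlforsRegular.measure_closure_diff`), so that almost every point off `D` is covered
(`AhlforsRegular.exists_whitneySystem`).

The energy of `g` splits into three parts.  For a pair `x, y` whose distance is small compared with
the distance to `D`, the increment of `g` comes from the partition of unity; the energies of the
cut-off functions and the differences of the averages at neighbouring balls give the energy of `f`
(`WhitneySystem.tsum_linkedOsc_le`).  For longer jumps, a point off `D` may be replaced by points of
a reflected set, since this changes `J` by a bounded factor only
(`WhitneySystem.lintegral_ext_sub_sq_mul_le`); together these are `exists_energy_ext_le`.  Jumps of
length of order at least `r` are controlled by the `L²` norm, through the tail of the jump kernel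
(`lintegral_energy_le_short_add_long`).

To make room for the enlargements, `CSJ(φ)` on `X` is used for the annulus of inner radius
`R + r / 4` and width `r / 2` inside that of inner radius `R` and width `r`
(`CSJ.exists_cutoff_restrict`).  What the cut-off function contributes to the energy measure
outside of the ball in that inequality is again a tail of the jump kernel.
-/

namespace MMD

open Metric Filter
open scoped NNReal Topology

/-! ### Volume doubling, scale functions and jump kernel bounds -/

section

variable {X : Type*} [MetricSpace X] [MeasurableSpace X]

theorem ennreal_inv_le_of_le_mul {a b : ℝ≥0∞} {C : ℝ≥0} (ha : a ≠ 0) (h : a ≤ C * b) :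
    b⁻¹ ≤ C * a⁻¹ := by
  rcases eq_or_ne b ∞ with rfl | hb
  · simp
  have hb0 : b ≠ 0 := by rintro rfl; simp at h; exact ha h
  have ha' : a ≠ ∞ := ne_top_of_le_ne_top (by finiteness) h
  calc b⁻¹ = b⁻¹ * (a * a⁻¹) := by rw [ENNReal.mul_inv_cancel ha ha', mul_one]
    _ ≤ b⁻¹ * (C * b * a⁻¹) := by gcongr
    _ = (b * b⁻¹) * (C * a⁻¹) := by ring
    _ = _ := by rw [ENNReal.mul_inv_cancel hb0 hb, one_mul]

theorem ball_two_pow_le {m : Measure X} {C : ℝ}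
    (hC : ∀ (x : X) (r : ℝ), 0 < r → m (ball x (2 * r)) ≤ ENNReal.ofReal C * m (ball x r))
    (x : X) {r : ℝ} (hr : 0 < r) (n : ℕ) :
    m (ball x (2 ^ n * r)) ≤ ENNReal.ofReal C ^ n * m (ball x r) := by
  induction n with
  | zero => simp
  | succ n ih =>
    calc m (ball x (2 ^ (n + 1) * r)) = m (ball x (2 * (2 ^ n * r))) := by ring_nf
      _ ≤ ENNReal.ofReal C * m (ball x (2 ^ n * r)) := hC _ _ (by positivity)
      _ ≤ ENNReal.ofReal C * (ENNReal.ofReal C ^ n * m (ball x r)) := by gcongr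
      _ = _ := by ring

/-- Balls have finite measure: small balls lie in compact sets, and doubling reaches all radii. -/
theorem VolumeDoubling.measure_ball_lt_top [LocallyCompactSpace X] {m : Measure X}
    [IsFiniteMeasureOnCompacts m] (h : VolumeDoubling m) (x : X) (r : ℝ) :
    m (ball x r) < ∞ := by
  obtain ⟨C, -, hC⟩ := h
  obtain ⟨K, hK, hxK⟩ := exists_compact_mem_nhds x
  obtain ⟨ε, hε, hεK⟩ := Metric.mem_nhds_iff.1 hxK
  obtain ⟨n, hn⟩ := pow_unbounded_of_one_lt (r / ε) (one_lt_two : (1 : ℝ) < 2)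
  have h1 : r ≤ 2 ^ n * ε := by rw [div_lt_iff₀ hε] at hn; exact hn.le
  refine ((measure_mono (ball_subset_ball h1)).trans (ball_two_pow_le hC x hε n)).trans_lt ?_
  exact ENNReal.mul_lt_top (ENNReal.pow_lt_top ENNReal.ofReal_lt_top)
    ((measure_mono hεK).trans_lt hK.measure_lt_top)

/-- Doubling compares the volumes of any two balls of comparable radii whose centres are at a
distance of the order of the radii. -/
theorem VolumeDoubling.exists_ball_le {m : Measure X} (h : VolumeDoubling m) (K : ℝ) :
    ∃ C : ℝ≥0, ∀ (x y : X) (r R : ℝ), 0 < r → dist x y ≤ K * r → R ≤ K * r →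
      m (ball x R) ≤ C * m (ball y r) := by
  obtain ⟨C, -, hC⟩ := h
  obtain ⟨n, hn⟩ := pow_unbounded_of_one_lt (2 * K) (one_lt_two : (1 : ℝ) < 2)
  refine ⟨C.toNNReal ^ n, fun x y r R hr hxy hR => ?_⟩
  have h1 : ball x R ⊆ ball y (2 ^ n * r) := by
    apply ball_subset_ball'
    nlinarith
  refine ((measure_mono h1).trans (ball_two_pow_le hC y hr n)).trans_eq ?_
  simp [ENNReal.ofReal]

theorem IsScaleFunction.pos {φ : ℝ → ℝ} (h : IsScaleFunction φ) {r : ℝ} (hr : 0 < r) :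
    0 < φ r := by
  have := h.strictMonoOn (mem_Ici.2 le_rfl) (mem_Ici.2 hr.le) hr
  rwa [h.map_zero] at this

theorem IsScaleFunction.exists_le {φ : ℝ → ℝ} (h : IsScaleFunction φ) (K : ℝ) :
    ∃ C : ℝ≥0, ∀ t r : ℝ, 0 < r → 0 ≤ t → t ≤ K * r →
      ENNReal.ofReal (φ t) ≤ C * ENNReal.ofReal (φ r) := by
  obtain ⟨c₁, c₂, β₁, β₂, hc₁, hc₂, hβ₁, hβ, hg⟩ := h.growth
  refine ⟨(max 1 (c₂ * (max K 0) ^ β₂)).toNNReal, fun t r hr ht htK => ?_⟩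
  rw [← ENNReal.ofReal, ← ENNReal.ofReal_mul (by positivity)]
  apply ENNReal.ofReal_le_ofReal
  have hφ := h.pos hr
  rcases le_total t r with htr | htr
  · have h1 : φ t ≤ φ r := h.strictMonoOn.monotoneOn (mem_Ici.2 ht) (mem_Ici.2 hr.le) htr
    have := le_max_left 1 (c₂ * (max K 0) ^ β₂)
    nlinarith
  · have h1 := (hg r t hr htr).2
    rw [div_le_iff₀ hφ] at h1
    refine h1.trans (mul_le_mul_of_nonneg_right ((mul_le_mul_of_nonneg_left ?_ hc₂.le).trans
      (le_max_right _ _)) hφ.le)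
    apply Real.rpow_le_rpow (by positivity) _ (by linarith)
    rw [div_le_iff₀ hr]
    exact htK.trans (mul_le_mul_of_nonneg_right (le_max_left _ _) hr.le)

theorem IsScaleFunction.exists_inv_le {φ : ℝ → ℝ} (h : IsScaleFunction φ) (K : ℝ) :
    ∃ C : ℝ≥0, ∀ t r : ℝ, 0 < r → 0 < t → t ≤ K * r →
      (ENNReal.ofReal (φ r))⁻¹ ≤ C * (ENNReal.ofReal (φ t))⁻¹ := by
  obtain ⟨C, hC⟩ := h.exists_le K
  exact ⟨C, fun t r hr ht htr => ennreal_inv_le_of_le_mul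
    (ENNReal.ofReal_pos.2 (h.pos ht)).ne' (hC t r hr ht.le htr)⟩

theorem measure_ball_mul_ne_zero {m : Measure X} [m.IsOpenPosMeasure]
    {φ : ℝ → ℝ} (hφ : IsScaleFunction φ) (x : X) {r : ℝ} (hr : 0 < r) :
    m (ball x r) * ENNReal.ofReal (φ r) ≠ 0 :=
  mul_ne_zero (measure_ball_pos m x hr).ne' (ENNReal.ofReal_pos.2 (hφ.pos hr)).ne'

/-- The jump kernel is bounded below by `1 / (V(x, r) φ(r))` at all pairs of points that lie at
distance of order at most `r` from each other and from `x`. -/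
theorem JumpKernelBounds.exists_inv_le {m : Measure X} [m.IsOpenPosMeasure] {J : X → X → ℝ≥0∞}
    {φ : ℝ → ℝ} (hJ : JumpKernelBounds m J φ) (hφ : IsScaleFunction φ) (h : VolumeDoubling m)
    (K : ℝ) :
    ∃ C : ℝ≥0, ∀ (x z w : X) (r : ℝ), 0 < r → z ≠ w → dist z w ≤ K * r → dist z x ≤ K * r →
      (m (ball x r) * ENNReal.ofReal (φ r))⁻¹ ≤ C * J z w := by
  obtain ⟨C₁, C₂, hC₁, hC₂, hb⟩ := hJ
  obtain ⟨Cv, hCv⟩ := h.exists_ball_le K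
  obtain ⟨Cφ, hCφ⟩ := hφ.exists_le K
  refine ⟨(C₁⁻¹).toNNReal * (Cv * Cφ), fun x z w r hr hzw hd hx => ?_⟩
  have h1 := (hb z w hzw).1
  have hd0 : 0 < dist z w := dist_pos.2 hzw
  have h2 : m (ball z (dist z w)) * ENNReal.ofReal (φ (dist z w)) ≤
      (Cv * Cφ) * (m (ball x r) * ENNReal.ofReal (φ r)) := by
    calc _ ≤ (Cv * m (ball x r)) * (Cφ * ENNReal.ofReal (φ r)) :=
          mul_le_mul' (hCv _ _ _ _ hr hx hd) (hCφ _ _ hr hd0.le hd)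
      _ = _ := by ring
  set a := m (ball x r) * ENNReal.ofReal (φ r) with ha
  set b := m (ball z (dist z w)) * ENNReal.ofReal (φ (dist z w)) with hb'
  have hb0 : b ≠ 0 := measure_ball_mul_ne_zero hφ z hd0
  have h3 : a⁻¹ ≤ (Cv * Cφ) * b⁻¹ := by
    simpa using ennreal_inv_le_of_le_mul (C := Cv * Cφ) hb0 (by simpa using h2)
  calc a⁻¹ ≤ (Cv * Cφ) * b⁻¹ := h3
    _ = (ENNReal.ofReal C₁⁻¹ * (Cv * Cφ)) * (ENNReal.ofReal C₁ / b) := by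
        rw [div_eq_mul_inv]
        have : ENNReal.ofReal C₁⁻¹ * ENNReal.ofReal C₁ = 1 := by
          rw [← ENNReal.ofReal_mul (by positivity), inv_mul_cancel₀ hC₁.ne', ENNReal.ofReal_one]
        calc _ = (ENNReal.ofReal C₁⁻¹ * ENNReal.ofReal C₁) * ((Cv * Cφ) * b⁻¹) := by
              rw [this, one_mul]
          _ = _ := by ring
    _ ≤ (ENNReal.ofReal C₁⁻¹ * (Cv * Cφ)) * J z w := by gcongr
    _ = _ := by push_cast; rfl

/-- Comparability of the jump kernel at two pairs of points, the second one being at a distance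
from the first, and of a diameter, of order at most the diameter of the first. -/
theorem JumpKernelBounds.exists_le {m : Measure X} [m.IsOpenPosMeasure] {J : X → X → ℝ≥0∞}
    {φ : ℝ → ℝ} (hJ : JumpKernelBounds m J φ) (hφ : IsScaleFunction φ) (h : VolumeDoubling m)
    (K : ℝ) :
    ∃ C : ℝ≥0, ∀ x y z w : X, x ≠ y → z ≠ w → dist z w ≤ K * dist x y →
      dist z x ≤ K * dist x y → J x y ≤ C * J z w := by
  obtain ⟨C, hC⟩ := hJ.exists_inv_le hφ h K
  obtain ⟨C₁, C₂, hC₁, hC₂, hb⟩ := hJ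
  refine ⟨C₂.toNNReal * C, fun x y z w hxy hzw hd hx => ?_⟩
  calc J x y ≤ _ := (hb x y hxy).2
    _ = ENNReal.ofReal C₂ * (m (ball x (dist x y)) * ENNReal.ofReal (φ (dist x y)))⁻¹ :=
        div_eq_mul_inv _ _
    _ ≤ ENNReal.ofReal C₂ * (C * J z w) := by
        gcongr; exact hC x z w _ (dist_pos.2 hxy) hzw hd hx
    _ = _ := by push_cast; rw [mul_assoc]; rfl

/-- The tail of the jump kernel: jumps of size at least `r` happen at rate at most of order
`1 / φ(r)`. -/
theorem JumpKernelBounds.exists_tail_le [BorelSpace X] [LocallyCompactSpace X]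
    {m : Measure X} [m.IsOpenPosMeasure] [IsFiniteMeasureOnCompacts m] {J : X → X → ℝ≥0∞}
    {φ : ℝ → ℝ} (hJ : JumpKernelBounds m J φ) (hφ : IsScaleFunction φ) (h : VolumeDoubling m) :
    ∃ C : ℝ≥0, ∀ (x : X) (r : ℝ), 0 < r →
      ∫⁻ y in {y | r ≤ dist x y}, J x y ∂m ≤ C * (ENNReal.ofReal (φ r))⁻¹ := by
  obtain ⟨C₁, C₂, hC₁, hC₂, hb⟩ := hJ
  obtain ⟨Cv, hCv⟩ := h.exists_ball_le 2
  obtain ⟨c₁, c₂, β₁, β₂, hc₁, hc₂, hβ₁, hβ, hg⟩ := hφ.growth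
  set q : ℝ := (2 : ℝ) ^ β₁ with hq
  have hq1 : 1 < q := Real.one_lt_rpow one_lt_two hβ₁
  set Q : ℝ≥0∞ := ENNReal.ofReal q⁻¹ with hQ
  have hQ1 : Q < 1 := by
    rw [hQ, ENNReal.ofReal_lt_one]; exact inv_lt_one_of_one_lt₀ hq1
  have hS : (1 - Q)⁻¹ ≠ ∞ := by
    rw [ENNReal.inv_ne_top]; exact (tsub_pos_of_lt hQ1).ne'
  refine ⟨C₂.toNNReal * Cv * (c₁⁻¹).toNNReal * ((1 - Q)⁻¹).toNNReal, fun x r hr => ?_⟩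
  -- On the dyadic annulus `A k` the tail is of order `1 / φ(2 ^ k r)`, which decays geometrically.
  set A : ℕ → Set X := fun k => {y | 2 ^ k * r ≤ dist x y ∧ dist x y < 2 * (2 ^ k * r)} with hA
  have hdm : Measurable fun y => dist x y := by fun_prop
  have hAm : ∀ k, MeasurableSet (A k) := fun k =>
    (measurableSet_le measurable_const hdm).inter (measurableSet_lt hdm measurable_const)
  have hsub : {y | r ≤ dist x y} ⊆ ⋃ k, A k := by
    intro y hy
    have hy' : 1 ≤ dist x y / r := by rw [le_div_iff₀ hr]; simpa using hy
    obtain ⟨k, hk1, hk2⟩ := exists_nat_pow_near hy' one_lt_two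
    refine mem_iUnion.2 ⟨k, ?_, ?_⟩
    · rwa [le_div_iff₀ hr] at hk1
    · rw [div_lt_iff₀ hr] at hk2; rw [pow_succ] at hk2; linarith
  have hterm : ∀ k, ∫⁻ y in A k, J x y ∂m ≤
      (ENNReal.ofReal C₂ * Cv * ENNReal.ofReal c₁⁻¹ * (ENNReal.ofReal (φ r))⁻¹) * Q ^ k := by
    intro k
    set t : ℝ := 2 ^ k * r with ht
    have ht0 : 0 < t := by positivity
    have hφt := hφ.pos ht0
    have hV0 : m (ball x t) ≠ 0 := (measure_ball_pos m x ht0).ne'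
    have hVt : m (ball x t) ≠ ∞ := (h.measure_ball_lt_top x t).ne
    calc ∫⁻ y in A k, J x y ∂m
        ≤ ∫⁻ y in A k, ENNReal.ofReal C₂ / (m (ball x t) * ENNReal.ofReal (φ t)) ∂m := by
          refine setLIntegral_mono' (hAm k) fun y hy => ?_
          have hxy : x ≠ y := dist_pos.1 (ht0.trans_le hy.1)
          refine (hb x y hxy).2.trans ?_
          gcongr
          · exact hy.1
          · exact hφ.strictMonoOn.monotoneOn (mem_Ici.2 ht0.le) (mem_Ici.2 (ht0.le.trans hy.1)) hy.1
      _ = ENNReal.ofReal C₂ / (m (ball x t) * ENNReal.ofReal (φ t)) * m (A k) := by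
          rw [setLIntegral_const]
      _ ≤ ENNReal.ofReal C₂ / (m (ball x t) * ENNReal.ofReal (φ t)) * (Cv * m (ball x t)) := by
          gcongr
          refine le_trans (measure_mono fun y hy => ?_)
            (hCv x x t (2 * t) ht0 (by simp; positivity) le_rfl)
          rw [mem_ball, dist_comm]; exact hy.2
      _ = ENNReal.ofReal C₂ * Cv * (ENNReal.ofReal (φ t))⁻¹ := by
          rw [div_eq_mul_inv, ENNReal.mul_inv (Or.inl hV0) (Or.inl hVt)]
          calc _ = (m (ball x t) * (m (ball x t))⁻¹) *
                (ENNReal.ofReal C₂ * Cv * (ENNReal.ofReal (φ t))⁻¹) := by ring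
            _ = _ := by rw [ENNReal.mul_inv_cancel hV0 hVt, one_mul]
      _ ≤ ENNReal.ofReal C₂ * Cv * (ENNReal.ofReal c₁⁻¹ * (ENNReal.ofReal (φ r))⁻¹ * Q ^ k) := by
          gcongr
          have h1 := (hg r t hr (by rw [ht]; nlinarith [one_le_pow₀ (M₀ := ℝ) one_le_two (n := k)])).1
          have h2 : t / r = 2 ^ k := by rw [ht]; field_simp
          have h3 : ((2 : ℝ) ^ k) ^ β₁ = q ^ k := by
            rw [hq, ← Real.rpow_natCast, ← Real.rpow_mul (by norm_num), mul_comm,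
              Real.rpow_mul (by norm_num), Real.rpow_natCast]
          rw [h2, h3, le_div_iff₀ (hφ.pos hr)] at h1
          have hφr := hφ.pos hr
          rw [hQ, ← ENNReal.ofReal_inv_of_pos hφt, ← ENNReal.ofReal_inv_of_pos hφr,
            ← ENNReal.ofReal_pow (by positivity), ← ENNReal.ofReal_mul (by positivity),
            ← ENNReal.ofReal_mul (by positivity)]
          apply ENNReal.ofReal_le_ofReal
          rw [inv_pow, ← mul_inv, ← mul_inv]
          apply inv_anti₀ (by positivity)
          nlinarith
      _ = _ := by ring
  calc ∫⁻ y in {y | r ≤ dist x y}, J x y ∂m ≤ ∫⁻ y in ⋃ k, A k, J x y ∂m :=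
        lintegral_mono_set hsub
    _ ≤ ∑' k, ∫⁻ y in A k, J x y ∂m := lintegral_iUnion_le _ _
    _ ≤ ∑' k, (ENNReal.ofReal C₂ * Cv * ENNReal.ofReal c₁⁻¹ * (ENNReal.ofReal (φ r))⁻¹) * Q ^ k :=
        ENNReal.tsum_le_tsum hterm
    _ = (ENNReal.ofReal C₂ * Cv * ENNReal.ofReal c₁⁻¹ * (ENNReal.ofReal (φ r))⁻¹) * (1 - Q)⁻¹ := by
        rw [ENNReal.tsum_mul_left, ENNReal.tsum_geometric]
    _ = _ := by
        push_cast
        rw [ENNReal.coe_toNNReal hS, ENNReal.ofReal, ENNReal.ofReal]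
        ring

end

/-! ### Integrals against the jump and energy measures -/

section

section Integrals

variable {X : Type*} [MeasurableSpace X]

theorem setLIntegral_jumpMeasure {m : Measure X} [SFinite m] {J : X → X → ℝ≥0∞}
    (hJ : Measurable fun p : X × X => J p.1 p.2) {g : X × X → ℝ≥0∞} (hg : Measurable g)
    {A B : Set X} (hA : MeasurableSet A) (hB : MeasurableSet B) :
    ∫⁻ p in A ×ˢ B, g p ∂(jumpMeasure m J) =
      ∫⁻ x in A, ∫⁻ y in B, g (x, y) * J x y ∂m ∂m := by
  rw [jumpMeasure, setLIntegral_withDensity_eq_setLIntegral_mul _ hJ hg (hA.prod hB),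
    ← Measure.prod_restrict, lintegral_prod _ (hJ.mul hg).aemeasurable]
  simp [mul_comm]

theorem lintegral_jumpMeasure {m : Measure X} [SFinite m] {J : X → X → ℝ≥0∞}
    (hJ : Measurable fun p : X × X => J p.1 p.2) {g : X × X → ℝ≥0∞} (hg : Measurable g) :
    ∫⁻ p, g p ∂(jumpMeasure m J) = ∫⁻ x, ∫⁻ y, g (x, y) * J x y ∂m ∂m := by
  simpa using setLIntegral_jumpMeasure (m := m) hJ hg MeasurableSet.univ MeasurableSet.univ

/-- The energy of a function, as an iterated integral with values in `[0, ∞]`. -/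
theorem lintegral_sq_sub_jumpMeasure {m : Measure X} [SFinite m] {J : X → X → ℝ≥0∞}
    (hJ : Measurable fun p : X × X => J p.1 p.2) {u : X → ℝ} (hu : Measurable u) :
    ∫⁻ p, ENNReal.ofReal ((u p.1 - u p.2) ^ 2) ∂(jumpMeasure m J) =
      ∫⁻ x, ∫⁻ y, ENNReal.ofReal ((u x - u y) ^ 2) * J x y ∂m ∂m :=
  lintegral_jumpMeasure hJ (by fun_prop)

theorem measurable_carreDuChamp {m : Measure X} [SFinite m] {J : X → X → ℝ≥0∞}
    (hJ : Measurable fun p : X × X => J p.1 p.2) {u : X → ℝ} (hu : Measurable u) :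
    Measurable fun x => ∫⁻ y, ENNReal.ofReal ((u x - u y) ^ 2) * J x y ∂m := by
  apply Measurable.lintegral_prod_right' (f := fun p : X × X =>
    ENNReal.ofReal ((u p.1 - u p.2) ^ 2) * J p.1 p.2)
  exact Measurable.mul (by fun_prop) hJ

theorem setLIntegral_energyMeasure {m : Measure X} [SFinite m] {J : X → X → ℝ≥0∞}
    (hJ : Measurable fun p : X × X => J p.1 p.2) {u : X → ℝ} (hu : Measurable u)
    {g : X → ℝ≥0∞} (hg : Measurable g) {A : Set X} (hA : MeasurableSet A) :
    ∫⁻ x in A, g x ∂(energyMeasure m J u) =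
      ∫⁻ x in A, g x * ∫⁻ y, ENNReal.ofReal ((u x - u y) ^ 2) * J x y ∂m ∂m := by
  rw [energyMeasure, setLIntegral_withDensity_eq_setLIntegral_mul _
    (measurable_carreDuChamp hJ hu) hg hA]
  simp [mul_comm]

end Integrals

variable {X : Type*} [MetricSpace X] [MeasurableSpace X]

theorem isCutoff_eq_zero_of_le_dist {ϕ : X → ℝ} {x y : X} {r R : ℝ}
    (h : IsCutoff ϕ (ball x r) (ball x R)) (hy : R ≤ dist y x) : ϕ y = 0 :=
  h.eq_zero y (by simpa using hy)

/-- Under `CSJ(φ)`, concentric balls of radii `s` and `2 s` have cut-off functions of energy at most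
of order `V(x, s) / φ(s)`.  The cut-off function for a larger ball, which exists by `CSJ(φ)` for the
zero function, is equal to one near these balls and serves as the test function `f`. -/
theorem CSJ.exists_cutoff_energy_le [BorelSpace X] [LocallyCompactSpace X]
    [SecondCountableTopology X]
    {m : Measure X} [m.IsOpenPosMeasure] [IsFiniteMeasureOnCompacts m] [SFinite m]
    {J : X → X → ℝ≥0∞} (hJm : Measurable fun p : X × X => J p.1 p.2)
    (hJs : ∀ x y, J x y = J y x)
    {φ : ℝ → ℝ} (hc : CSJ m J φ) (hφ : IsScaleFunction φ) (h : VolumeDoubling m)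
    (hJ : JumpKernelBounds m J φ) :
    ∃ c : ℝ, 0 < c ∧ ∃ C : ℝ≥0, ∀ s : ℝ, 0 < s →
      ENNReal.ofReal s < ENNReal.ofReal c * ediam (univ : Set X) →
      ∀ᵐ x ∂m, ∃ ϕ : X → ℝ, IsCutoff ϕ (ball x s) (ball x (2 * s)) ∧
        ∫⁻ y, ∫⁻ z, ENNReal.ofReal ((ϕ y - ϕ z) ^ 2) * J y z ∂m ∂m ≤
          C * (m (ball x s) * (ENNReal.ofReal (φ s))⁻¹) := by
  obtain ⟨Ct, hCt⟩ := hJ.exists_tail_le hφ h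
  obtain ⟨Cv, hCv⟩ := h.exists_ball_le 3
  obtain ⟨c, C₀, C₁, C₂, hc0, hc1, hC₀, hC₀1, hC₁, hC₂, hcsj⟩ := hc
  obtain ⟨Cφ, hCφ⟩ := hφ.exists_inv_le C₀⁻¹
  refine ⟨c / 4, by positivity, C₂.toNNReal * Cv + Cv * (Ct * Cφ), fun s hs hsd => ?_⟩
  have h4 : ENNReal.ofReal (4 * s) < ENNReal.ofReal c * ediam (univ : Set X) := by
    have e1 : ENNReal.ofReal (4 * s) = 4 * ENNReal.ofReal s := by
      rw [ENNReal.ofReal_mul (by norm_num)]; simp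
    have e2 : ENNReal.ofReal c = 4 * ENNReal.ofReal (c / 4) := by
      rw [← ENNReal.ofReal_ofNat 4, ← ENNReal.ofReal_mul (by norm_num)]; congr 1; ring
    rw [e1, e2, mul_assoc]
    exact ENNReal.mul_lt_mul_right (by norm_num) (by norm_num) hsd
  have h1 : ENNReal.ofReal s < ENNReal.ofReal c * ediam (univ : Set X) :=
    (ENNReal.ofReal_le_ofReal (by linarith)).trans_lt h4
  -- The ball of radius `4 s` contains the ball of radius `s + (1 + C₀) s`, as `C₀ ≤ 1`.
  filter_upwards [hcsj (4 * s) (4 * s) (by positivity) le_rfl h4, hcsj s s hs le_rfl h1]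
    with x hx4 hx1
  obtain ⟨ϕ₀, hϕ₀F, hϕ₀, -⟩ := hx4 (fun _ => 0) ⟨MemLp.zero', by simp⟩
  obtain ⟨ϕ, hϕF, hϕ, hineq⟩ := hx1 ϕ₀ hϕ₀F
  rw [← two_mul] at hϕ
  refine ⟨ϕ, hϕ, ?_⟩
  set B := ball x (s + (1 + C₀) * s) with hB
  have hone : ∀ y ∈ B, ϕ₀ y = 1 := by
    intro y hy
    apply hϕ₀.eq_one
    have : dist y x < s + (1 + C₀) * s := hy
    rw [mem_ball]
    nlinarith
  have hin : ∫⁻ y in B, ∫⁻ z, ENNReal.ofReal ((ϕ y - ϕ z) ^ 2) * J y z ∂m ∂m ≤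
      ENNReal.ofReal C₂ * Cv * (m (ball x s) * (ENNReal.ofReal (φ s))⁻¹) := by
    have e1 := setLIntegral_energyMeasure (m := m) hJm hϕ.measurable
      (g := fun x => ENNReal.ofReal (ϕ₀ x ^ 2)) (by have := hϕ₀.measurable; fun_prop)
      (A := B) measurableSet_ball
    rw [e1] at hineq
    have e2 : ∫⁻ y in B, ENNReal.ofReal (ϕ₀ y ^ 2) *
        ∫⁻ z, ENNReal.ofReal ((ϕ y - ϕ z) ^ 2) * J y z ∂m ∂m =
        ∫⁻ y in B, ∫⁻ z, ENNReal.ofReal ((ϕ y - ϕ z) ^ 2) * J y z ∂m ∂m :=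
      setLIntegral_congr_fun measurableSet_ball fun y hy => by simp [hone y hy]
    have e3 : ∫⁻ y in B, ENNReal.ofReal (ϕ₀ y ^ 2) ∂m = m B := by
      rw [setLIntegral_congr_fun (g := fun _ => 1) measurableSet_ball fun y hy => by
        simp [hone y hy]]
      rw [setLIntegral_const, one_mul]
    have e4 : ∫⁻ p in (ball x (s + s) \ ball x s) ×ˢ (B \ ball x (s - C₀ * s)),
            ENNReal.ofReal ((ϕ₀ p.1 - ϕ₀ p.2) ^ 2) ∂(jumpMeasure m J) = 0 := by
      rw [setLIntegral_congr_fun (g := fun _ => 0)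
        ((measurableSet_ball.diff measurableSet_ball).prod
          (measurableSet_ball.diff measurableSet_ball)) fun p hp => ?_]
      · simp
      · have h1 : p.1 ∈ B := by
          have : dist p.1 x < s + s := hp.1.1
          rw [hB, mem_ball]; nlinarith
        simp [hone _ h1, hone _ hp.2.1]
    rw [e2, e3, e4, mul_zero, zero_add] at hineq
    refine hineq.trans ?_
    have e5 : m B ≤ Cv * m (ball x s) := hCv x x s _ hs (by simp; positivity) (by nlinarith)
    calc _ ≤ ENNReal.ofReal (C₂ / φ s) * (Cv * m (ball x s)) := by gcongr
      _ = _ := by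
        rw [ENNReal.ofReal_div_of_pos (hφ.pos hs), div_eq_mul_inv]; ring
  -- Off `B` the cut-off function vanishes, and so only jumps of length at least `C₀ s` count.
  have hout : ∫⁻ y in Bᶜ, ∫⁻ z, ENNReal.ofReal ((ϕ y - ϕ z) ^ 2) * J y z ∂m ∂m ≤
      Cv * (Ct * Cφ) * (m (ball x s) * (ENNReal.ofReal (φ s))⁻¹) := by
    have hSm : MeasurableSet {p : X × X | C₀ * s ≤ dist p.2 p.1} :=
      measurableSet_le measurable_const (by fun_prop)
    set F : X → X → ℝ≥0∞ := fun z y => (ball x (2 * s)).indicator 1 z *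
      {p : X × X | C₀ * s ≤ dist p.2 p.1}.indicator (fun p => J p.2 p.1) (y, z) with hF
    have hFm : Measurable fun p : X × X => F p.2 p.1 := by
      refine Measurable.mul ?_ ?_
      · exact (measurable_one.indicator measurableSet_ball).comp measurable_snd
      · exact (hJm.comp measurable_swap).indicator hSm
    calc _ ≤ ∫⁻ y in Bᶜ, ∫⁻ z, F z y ∂m ∂m := by
          refine setLIntegral_mono' measurableSet_ball.compl fun y hy => lintegral_mono fun z => ?_
          have hy' : s + (1 + C₀) * s ≤ dist y x := by simpa [hB] using hy
          have hϕy : ϕ y = 0 := isCutoff_eq_zero_of_le_dist hϕ (by nlinarith)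
          by_cases hz : z ∈ ball x (2 * s)
          · have hz' : dist z x < 2 * s := hz
            have hd : (y, z) ∈ {p : X × X | C₀ * s ≤ dist p.2 p.1} := by
              have := dist_triangle y z x
              rw [mem_ofPred_eq, dist_comm]; nlinarith
            simp only [hF, indicator_of_mem hz, indicator_of_mem hd, hϕy, Pi.one_apply, hJs y z]
            gcongr
            rw [ENNReal.ofReal_le_one]
            have h0 := hϕ.nonneg z
            have h1 := hϕ.le_one z
            nlinarith
          · simp [hϕy, hϕ.eq_zero z hz]
      _ ≤ ∫⁻ y, ∫⁻ z, F z y ∂m ∂m := setLIntegral_le_lintegral _ _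
      _ = ∫⁻ z, ∫⁻ y, F z y ∂m ∂m := lintegral_lintegral_swap hFm.aemeasurable
      _ ≤ ∫⁻ z, (ball x (2 * s)).indicator (fun _ => Ct * (ENNReal.ofReal (φ (C₀ * s)))⁻¹) z ∂m := by
          refine lintegral_mono fun z => ?_
          by_cases hz : z ∈ ball x (2 * s)
          · simp only [hF, indicator_of_mem hz, Pi.one_apply, one_mul]
            refine le_trans (le_of_eq ?_) (hCt z (C₀ * s) (by positivity))
            have hdm : Measurable fun y => dist z y := by fun_prop
            rw [← lintegral_indicator (measurableSet_le measurable_const hdm)]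
            rfl
          · simp [hF, hz]
      _ = (Ct * (ENNReal.ofReal (φ (C₀ * s)))⁻¹) * m (ball x (2 * s)) := by
          rw [lintegral_indicator measurableSet_ball, setLIntegral_const]
      _ ≤ (Ct * (Cφ * (ENNReal.ofReal (φ s))⁻¹)) * (Cv * m (ball x s)) := by
          gcongr
          · refine hCφ s (C₀ * s) (by positivity) hs ?_
            rw [← mul_assoc, inv_mul_cancel₀ hC₀.ne', one_mul]
          · exact hCv x x s _ hs (by simp; positivity) (by linarith)
      _ = _ := by ring
  rw [← lintegral_add_compl _ (measurableSet_ball (x := x) (ε := s + (1 + C₀) * s))]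
  refine (add_le_add hin hout).trans_eq ?_
  rw [← add_mul]
  push_cast
  rfl

end

/-! ### Ahlfors regular sets and reflected sets -/

section

variable {X : Type*} [MetricSpace X] [MeasurableSpace X]

/-- Ahlfors regularity in the form in which it is used: a ball near a point `z` of `D` is comparable
in measure with the part of a ball about `z` that lies in `D`. -/
theorem AhlforsRegular.exists_measure_ball_le {m : Measure X} (h : VolumeDoubling m) {D : Set X}
    (hD : AhlforsRegular m D) (K : ℝ) :
    ∃ C : ℝ≥0, ∀ (x z : X) (r R : ℝ), z ∈ D → 0 < r → ENNReal.ofReal r < ediam D / 2 →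
      dist x z ≤ K * r → R ≤ K * r → m (ball x R) ≤ C * m (ball z r ∩ D) := by
  obtain ⟨c, hc, -, hcD⟩ := hD
  obtain ⟨C, hC⟩ := h.exists_ball_le K
  refine ⟨C * (c⁻¹).toNNReal, fun x z r R hz hr hrD hxz hR => ?_⟩
  calc m (ball x R) ≤ C * m (ball z r) := hC _ _ _ _ hr hxz hR
    _ = C * (ENNReal.ofReal c⁻¹ * (ENNReal.ofReal c * m (ball z r))) := by
      rw [← mul_assoc (ENNReal.ofReal _), ← ENNReal.ofReal_mul (by positivity),
        inv_mul_cancel₀ hc.ne']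
      simp
    _ ≤ C * (ENNReal.ofReal c⁻¹ * m (ball z r ∩ D)) := by gcongr; exact hcD z hz r hr hrD
    _ = _ := by push_cast; rw [mul_assoc]; rfl

/-- By Lebesgue's density theorem, the boundary points of an open Ahlfors regular set that do not
belong to the set form a null set: none of them is a density point of the boundary. -/
theorem AhlforsRegular.measure_closure_diff [BorelSpace X] [SecondCountableTopology X]
    [LocallyCompactSpace X] {m : Measure X} [m.IsOpenPosMeasure] [IsFiniteMeasureOnCompacts m]
    (h : VolumeDoubling m) {D : Set X} (hD : AhlforsRegular m D) (hDo : IsOpen D) :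
    m (closure D \ D) = 0 := by
  obtain ⟨Cv, hCv⟩ := h.exists_ball_le 4
  have : IsUnifLocDoublingMeasure m := by
    refine ⟨⟨Cv, ?_⟩⟩
    filter_upwards [self_mem_nhdsWithin] with ε hε x
    have hε : 0 < ε := hε
    calc m (closedBall x (2 * ε)) ≤ m (ball x (4 * ε)) :=
          measure_mono (closedBall_subset_ball (by linarith))
      _ ≤ Cv * m (ball x ε) := hCv _ _ _ _ hε (by simp; positivity) le_rfl
      _ ≤ _ := by gcongr; exact ball_subset_closedBall
  set S := closure D \ D with hS
  have hSm : MeasurableSet S := isClosed_closure.measurableSet.diff hDo.measurableSet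
  rcases D.subsingleton_or_nontrivial with hsub | hnt
  · have : S = ∅ := by rw [hS, hsub.isClosed.closure_eq, sdiff_self]
    simp [this]
  have hdiam : 0 < ediam D / 2 := by
    have : ediam D ≠ 0 := fun h0 => hnt.not_subsingleton (ediam_eq_zero_iff.1 h0)
    exact ENNReal.div_pos this (by norm_num)
  obtain ⟨C, hC⟩ := hD.exists_measure_ball_le h 8
  have hae : ∀ᵐ x ∂(m.restrict S), False := by
    filter_upwards [IsUnifLocDoublingMeasure.ae_tendsto_measure_inter_div m S 1,
      ae_restrict_mem hSm] with x hx hxS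
    have ht := hx (l := 𝓝[>] (0 : ℝ)) (fun _ => x) id tendsto_id (by
      filter_upwards [self_mem_nhdsWithin] with r hr
      have hr : 0 < r := hr
      simp [hr.le])
    have hsmall : ∀ᶠ r in 𝓝[>] (0 : ℝ), ENNReal.ofReal r < ediam D / 2 := by
      have : Tendsto (fun r : ℝ => ENNReal.ofReal r) (𝓝[>] 0) (𝓝 0) := by
        have := (ENNReal.continuous_ofReal.tendsto (0 : ℝ)).mono_left
          (nhdsWithin_le_nhds (s := Ioi (0 : ℝ)))
        simpa using this
      exact this.eventually_lt_const hdiam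
    -- A fixed proportion of each small ball about `x` lies in `D`, hence not in `S`.
    have hle : (1 : ℝ≥0∞) ≤ 1 - (C : ℝ≥0∞)⁻¹ := by
      refine le_of_tendsto ht ?_
      filter_upwards [self_mem_nhdsWithin, hsmall] with r hr hrD
      have hr : 0 < r := hr
      obtain ⟨z, hzD, hxz⟩ := Metric.mem_closure_iff.1 hxS.1 (r / 2) (by positivity)
      set B := closedBall x r with hB
      have hB0 : m B ≠ 0 :=
        ((measure_ball_pos m x hr).trans_le (measure_mono ball_subset_closedBall)).ne'
      have hBt : m B ≠ ∞ := ((measure_mono (closedBall_subset_ball (by linarith : r < 2 * r))).trans_lt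
        (h.measure_ball_lt_top x (2 * r))).ne
      have hsubB : ball z (r / 2) ∩ D ⊆ B := fun y hy => by
        have h1 : dist y z < r / 2 := hy.1
        have := dist_triangle_right y x z
        rw [hB, mem_closedBall]; linarith
      have h1 : m B ≤ C * m (ball z (r / 2) ∩ D) := by
        refine (measure_mono (closedBall_subset_ball (by linarith : r < 2 * r))).trans
          (hC x z (r / 2) (2 * r) hzD (by positivity) ?_ (by linarith) (by linarith))
        exact (ENNReal.ofReal_le_ofReal (by linarith)).trans_lt hrD
      have h2 : m (S ∩ B) + m (ball z (r / 2) ∩ D) ≤ m B := by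
        rw [← measure_union _ (measurableSet_ball.inter hDo.measurableSet)]
        · exact measure_mono (union_subset inter_subset_right hsubB)
        · exact disjoint_left.2 fun y hy hy' => hy.1.2 hy'.2
      have hC0 : (C : ℝ≥0∞) ≠ 0 := by rintro h0; rw [h0, zero_mul] at h1; exact hB0 (by simpa using h1)
      have h3 : (C : ℝ≥0∞)⁻¹ * m B ≤ m (ball z (r / 2) ∩ D) := by
        rw [mul_comm, ← div_eq_mul_inv]
        exact ENNReal.div_le_of_le_mul (by rwa [mul_comm])
      change m (S ∩ B) / m B ≤ _
      rw [ENNReal.div_le_iff hB0 hBt, ENNReal.sub_mul (by simp [hBt]), one_mul]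
      refine ENNReal.le_sub_of_add_le_right (by finiteness) ?_
      exact le_trans (by gcongr) h2
    have : (1 : ℝ≥0∞) - (C : ℝ≥0∞)⁻¹ < 1 :=
      ENNReal.sub_lt_self (by simp) (by simp) (by simp)
    exact absurd hle (not_le.2 this)
  have : m.restrict S univ = 0 := by simpa [ae_iff] using hae
  simpa using this

/-- A family of disjoint balls of radius comparable with `t` and centres at distance of order `t`
from `x` has boundedly many members. -/
theorem VolumeDoubling.exists_card_le [OpensMeasurableSpace X] [LocallyCompactSpace X]
    {m : Measure X} [m.IsOpenPosMeasure] [IsFiniteMeasureOnCompacts m]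
    (h : VolumeDoubling m) (K : ℝ) :
    ∃ C : ℝ≥0, ∀ (I : Set X) (τ : X → ℝ), I.PairwiseDisjoint (fun i => ball i (τ i)) →
      ∀ (x : X) (t : ℝ), 0 < t → ∀ T : Finset X, (∀ i ∈ T, i ∈ I ∧ 0 < τ i ∧
        dist x i ≤ K * t ∧ τ i ≤ K * t ∧ t ≤ K * τ i) → (T.card : ℝ≥0∞) ≤ C := by
  obtain ⟨C, hC⟩ := h.exists_ball_le (2 * |K| * |K| + |K|)
  refine ⟨C, fun I τ hdis x t ht T hT => ?_⟩
  rcases T.eq_empty_or_nonempty with rfl | ⟨i₀, hi₀⟩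
  · simp
  have hK : 0 < K := by
    obtain ⟨-, h1, -, h2, -⟩ := hT i₀ hi₀
    by_contra! hK
    nlinarith
  rw [abs_of_pos hK] at hC
  set V := m (ball x (2 * K * t)) with hV
  have hV0 : V ≠ 0 := (measure_ball_pos m x (by positivity)).ne'
  have hVt : V ≠ ∞ := (h.measure_ball_lt_top _ _).ne
  have hsum : ∑ i ∈ T, m (ball i (τ i)) ≤ V := by
    rw [← measure_biUnion_finset (fun i hi j hj hij => hdis (hT i hi).1 (hT j hj).1 hij)
      (fun _ _ => measurableSet_ball)]
    refine measure_mono (iUnion₂_subset fun i hi => ?_)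
    obtain ⟨-, -, h2, h3, -⟩ := hT i hi
    apply ball_subset_ball'
    rw [dist_comm]; linarith
  have hle : ∀ i ∈ T, V ≤ C * m (ball i (τ i)) := by
    intro i hi
    obtain ⟨-, h1, h2, h3, h4⟩ := hT i hi
    refine hC _ _ _ _ h1 ?_ ?_
    · nlinarith [mul_pos hK hK, mul_pos (mul_pos hK hK) h1, mul_pos hK h1]
    · nlinarith [mul_pos hK hK, mul_pos (mul_pos hK hK) h1, mul_pos hK h1]
  have h5 : (T.card : ℝ≥0∞) * V ≤ C * V := by
    calc (T.card : ℝ≥0∞) * V = ∑ i ∈ T, V := by simp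
      _ ≤ ∑ i ∈ T, C * m (ball i (τ i)) := Finset.sum_le_sum hle
      _ = C * ∑ i ∈ T, m (ball i (τ i)) := by rw [Finset.mul_sum]
      _ ≤ _ := by gcongr
  exact (ENNReal.mul_le_mul_iff_left hV0 hVt).1 h5

/-- The number of balls `ball k (49 τ k)` with `τ k ≤ t` that contain `z`. -/
noncomputable def smallBallCount (I : Set X) (τ : X → ℝ) (t : ℝ) (z : X) : ℝ≥0∞ :=
  ∑' k : I, {y : X | τ k ≤ t ∧ y ∈ ball (k : X) (49 * τ k)}.indicator 1 z

theorem measurableSet_smallBall [OpensMeasurableSpace X] (τ : X → ℝ) (t : ℝ) (k : X) :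
    MeasurableSet {y : X | τ k ≤ t ∧ y ∈ ball (k : X) (49 * τ k)} :=
  (MeasurableSet.const _).inter measurableSet_ball

theorem measurable_smallBallCount [OpensMeasurableSpace X] {I : Set X} (hI : I.Countable)
    (τ : X → ℝ) (t : ℝ) : Measurable (smallBallCount I τ t) := by
  have := hI.to_subtype
  exact Measurable.tsum fun k => measurable_one.indicator (measurableSet_smallBall τ t k)

/-- Reflected Whitney sets.  Let `ball i (τ i)`, `i ∈ I`, be disjoint balls such that a fixed
proportion of `ball i (49 τ i)` lies in `D`.  The points of `D ∩ ball i (49 τ i)` that lie in few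
of the balls `ball k (49 τ k)` which are not larger form a set that still contains a fixed
proportion of `ball i (49 τ i)`, and these sets overlap boundedly: among the sets that contain a
given point, one with the largest radius bounds the number of the others. -/
theorem VolumeDoubling.exists_reflected_sets [OpensMeasurableSpace X] [LocallyCompactSpace X]
    {m : Measure X} [m.IsOpenPosMeasure] [IsFiniteMeasureOnCompacts m]
    (h : VolumeDoubling m) {D : Set X} (hDm : MeasurableSet D) (C₁ : ℝ≥0) :
    ∃ M : ℝ≥0, ∀ (I : Set X) (τ : X → ℝ), I.Countable → (∀ i ∈ I, 0 < τ i) →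
      I.PairwiseDisjoint (fun i => ball i (τ i)) →
      (∀ i ∈ I, m (ball i (τ i)) ≤ C₁ * m (D ∩ ball i (49 * τ i))) →
      ∃ E : X → Set X, (∀ i, MeasurableSet (E i)) ∧ (∀ i, E i ⊆ D ∩ ball i (49 * τ i)) ∧
        (∀ i ∈ I, m (ball i (τ i)) ≤ M * m (E i)) ∧
        ∀ z, ∑' i : I, (E i).indicator 1 z ≤ (M : ℝ≥0∞) := by
  obtain ⟨Cv, hCv⟩ := h.exists_ball_le 100
  -- By Chebyshev's inequality, `N` is so large that the points of `ball i (49 τ i)` that lie in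
  -- more than `N` balls fill at most half of the proportion that belongs to `D`.
  set N : ℝ≥0 := 2 * (C₁ + 1) * (Cv * Cv + 1) with hN
  refine ⟨N, fun I τ hI hτ hdis hD => ?_⟩
  have := hI.to_subtype
  have hnm := measurable_smallBallCount hI τ
  refine ⟨fun i => (D ∩ ball i (49 * τ i)) ∩ {z | smallBallCount I τ (τ i) z ≤ N},
    fun i => (hDm.inter measurableSet_ball).inter (measurableSet_le (hnm _) measurable_const),
    fun i => inter_subset_left, fun i hi => ?_, fun z => ?_⟩
  · set B := ball i (49 * τ i) with hB
    set V := m (ball i (τ i)) with hV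
    have hτi := hτ i hi
    have hVt : V ≠ ∞ := (h.measure_ball_lt_top _ _).ne
    set n := smallBallCount I τ (τ i) with hn
    have hint : ∫⁻ z in B, n z ∂m ≤ Cv * Cv * V := by
      have h1 : ∀ k : I, ∫⁻ z in B, {y : X | τ k ≤ τ i ∧ y ∈ ball (k : X) (49 * τ k)}.indicator
          1 z ∂m ≤ Cv * m {y | (τ k ≤ τ i ∧ dist (k : X) i ≤ 98 * τ i) ∧ y ∈ ball (k : X) (τ k)} := by
        intro k
        rw [lintegral_indicator_one (measurableSet_smallBall τ _ _),
          Measure.restrict_apply (measurableSet_smallBall τ _ _)]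
        rcases ({y : X | τ k ≤ τ i ∧ y ∈ ball (k : X) (49 * τ k)} ∩ B).eq_empty_or_nonempty with
          h0 | ⟨y, ⟨hki, hyk⟩, hyi⟩
        · rw [h0]; simp
        · have hk := hτ k k.2
          have hd : dist (k : X) i ≤ 98 * τ i := by
            have e1 : dist y k < 49 * τ k := hyk
            have e2 : dist y i < 49 * τ i := hyi
            have := dist_triangle_left (k : X) i y
            linarith
          simp only [hki, hd, true_and]
          refine (measure_mono inter_subset_left).trans ?_
          exact hCv _ _ _ _ hk (by simp; positivity) (by linarith)
      have h2 : ∑' k : I, m {y | (τ k ≤ τ i ∧ dist (k : X) i ≤ 98 * τ i) ∧ y ∈ ball (k : X) (τ k)} ≤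
          m (ball i (99 * τ i)) := by
        rw [← measure_iUnion]
        · refine measure_mono (iUnion_subset fun k y hy => ?_)
          have e1 : dist y k < τ k := hy.2
          have := dist_triangle y k i
          rw [mem_ball]; linarith [hy.1.1, hy.1.2]
        · intro k l hkl
          exact (hdis k.2 l.2 (fun h => hkl (Subtype.ext h))).mono
            (fun y hy => hy.2) (fun y hy => hy.2)
        · exact fun k => (MeasurableSet.const _).inter measurableSet_ball
      calc ∫⁻ z in B, n z ∂m = ∑' k : I, ∫⁻ z in B,
            {y : X | τ k ≤ τ i ∧ y ∈ ball (k : X) (49 * τ k)}.indicator 1 z ∂m := by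
            rw [← lintegral_tsum fun k =>
              (measurable_one.indicator (measurableSet_smallBall τ _ _)).aemeasurable]
            rfl
        _ ≤ Cv * m (ball i (99 * τ i)) := by
            refine (ENNReal.tsum_le_tsum h1).trans ?_
            rw [ENNReal.tsum_mul_left]
            gcongr
        _ ≤ Cv * (Cv * V) := by
            gcongr; exact hCv _ _ _ _ hτi (by simp; positivity) (by linarith)
        _ = _ := by ring
    set bad := B ∩ {z | (N : ℝ≥0∞) ≤ n z} with hbad
    have hcheb : (N : ℝ≥0∞) * m bad ≤ Cv * Cv * V := by
      refine le_trans ?_ hint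
      have := mul_meas_ge_le_lintegral (μ := m.restrict B) (hnm (τ i)) (N : ℝ≥0∞)
      rwa [Measure.restrict_apply (measurableSet_le measurable_const (hnm _)), inter_comm] at this
    have hcheb' : 2 * (C₁ + 1 : ℝ≥0∞) * m bad ≤ V := by
      have hpos : ((Cv * Cv + 1 : ℝ≥0) : ℝ≥0∞) ≠ 0 := by
        norm_cast; positivity
      refine (ENNReal.mul_le_mul_iff_right hpos ENNReal.coe_ne_top).1 ?_
      calc _ = (N : ℝ≥0∞) * m bad := by rw [hN]; push_cast; ring
        _ ≤ Cv * Cv * V := hcheb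
        _ ≤ _ := by gcongr; push_cast; exact le_self_add
    set E := (D ∩ B) ∩ {z | n z ≤ N}
    have hsplit : m (D ∩ B) ≤ m E + m bad := by
      refine (measure_mono fun z hz => ?_).trans (measure_union_le _ _)
      rcases le_total (n z) N with hle | hle
      · exact Or.inl ⟨hz, hle⟩
      · exact Or.inr ⟨hz.2, hle⟩
    have h3 : V + V ≤ 2 * (C₁ + 1) * m E + V := by
      calc V + V = 2 * V := by ring
        _ ≤ 2 * (C₁ * m (D ∩ B)) := by gcongr; exact hD i hi
        _ ≤ 2 * ((C₁ + 1) * (m E + m bad)) := by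
            gcongr; exact le_self_add
        _ = 2 * (C₁ + 1) * m E + 2 * (C₁ + 1) * m bad := by ring
        _ ≤ _ := by gcongr
    refine (ENNReal.le_of_add_le_add_right hVt h3).trans ?_
    gcongr
    rw [hN]
    push_cast
    calc (2 * (C₁ + 1) : ℝ≥0∞) = 2 * (C₁ + 1) * 1 := by ring
      _ ≤ _ := by gcongr; exact le_add_self
  · rw [ENNReal.tsum_eq_iSup_sum]
    refine iSup_le fun T => ?_
    classical
    set E : X → Set X := fun i => (D ∩ ball i (49 * τ i)) ∩ {z | smallBallCount I τ (τ i) z ≤ N}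
    set T' := T.filter fun i : I => z ∈ E i with hT'
    have h1 : ∑ i ∈ T, (E i).indicator 1 z = ∑ i ∈ T', (1 : ℝ≥0∞) := by
      rw [hT', Finset.sum_filter]
      exact Finset.sum_congr rfl fun i _ => by simp [indicator_apply]
    rw [h1]
    rcases T'.eq_empty_or_nonempty with h0 | hne
    · simp [h0]
    -- All the sets `E i` through `z` are counted by `smallBallCount` at the largest radius.
    obtain ⟨i₀, hi₀, hmax⟩ := T'.exists_max_image (fun i : I => τ i) hne
    have hz0 : z ∈ E i₀ := (Finset.mem_filter.1 hi₀).2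
    calc ∑ i ∈ T', (1 : ℝ≥0∞) ≤ ∑ i ∈ T',
          {y : X | τ i ≤ τ i₀ ∧ y ∈ ball (i : X) (49 * τ i)}.indicator 1 z := by
          refine Finset.sum_le_sum fun i hi => ?_
          have hzi : z ∈ E i := (Finset.mem_filter.1 hi).2
          rw [indicator_of_mem]
          · simp
          · exact ⟨hmax i hi, hzi.1.2⟩
      _ ≤ smallBallCount I τ (τ i₀) z := ENNReal.sum_le_tsum _
      _ ≤ N := hz0.2

end

/-! ### Whitney systems -/

section

variable {X : Type*} [MetricSpace X] [MeasurableSpace X]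

/-- A Whitney covering, up to scale `s`, of the complement of `D`.  It consists of centres
`i ∈ I` and radii `τ i` comparable with the distance of `i` to `D`, of cut-off functions `ϕ i` for
the balls `ball i (6 * τ i)`, which cover almost every point off the closure of `D` at distance
less than `48 * s` from `D`, and of boundedly overlapping reflected sets `E i ⊆ D` of volume
comparable with that of `ball i (τ i)`.  All constants are at most `M`.

The cut-off functions vanish outside `ball i (12 * τ i)`, whose points have distance at least
`12 * τ i` to `D`; the radius `49 * τ i` exceeds the distance of `i` to `D`, so that `ball i (49 * τ i)`
contains a ball of radius of order `τ i` about a point of `D`. -/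
structure WhitneySystem (m : Measure X) (J : X → X → ℝ≥0∞) (φ : ℝ → ℝ) (D : Set X) (s : ℝ)
    (M : ℝ≥0) where
  I : Set X
  τ : X → ℝ
  ϕ : X → X → ℝ
  E : X → Set X
  countable : I.Countable
  τ_pos : ∀ i ∈ I, 0 < τ i
  lt_infDist : ∀ i ∈ I, 24 * τ i < infDist i D
  infDist_le : ∀ i ∈ I, infDist i D ≤ 48 * τ i
  exists_mem : ∀ᵐ x ∂m, 0 < infDist x D → infDist x D < 48 * s → ∃ i ∈ I, x ∈ ball i (6 * τ i)
  cutoff : ∀ i ∈ I, IsCutoff (ϕ i) (ball i (6 * τ i)) (ball i (12 * τ i))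
  energy_le : ∀ i ∈ I, ∫⁻ x, ∫⁻ y, ENNReal.ofReal ((ϕ i x - ϕ i y) ^ 2) * J x y ∂m ∂m ≤
    M * (m (ball i (τ i)) * (ENNReal.ofReal (φ (τ i)))⁻¹)
  card_le : ∀ (x : X) (t : ℝ), 0 < t → ∀ T : Finset X, (∀ i ∈ T, i ∈ I ∧
    dist x i ≤ 400 * t ∧ τ i ≤ 400 * t ∧ t ≤ 400 * τ i) → (T.card : ℝ≥0∞) ≤ M
  measurableSet_E : ∀ i, MeasurableSet (E i)
  E_subset : ∀ i, E i ⊆ D ∩ ball i (49 * τ i)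
  measure_ball_le : ∀ i ∈ I, m (ball i (τ i)) ≤ M * m (E i)
  overlap_le : ∀ z, ∑' i : I, (E i).indicator 1 z ≤ (M : ℝ≥0∞)

theorem exists_dyadic_near {s t : ℝ} (ht : 0 < t) (hts : t < 48 * s) :
    ∃ k : ℕ, 24 * (s / 2 ^ k) < t ∧ t ≤ 48 * (s / 2 ^ k) := by
  obtain ⟨k, h1, h2⟩ := exists_nat_pow_near (x := 48 * s / t) (y := (2 : ℝ))
    (by rw [le_div_iff₀ ht]; linarith) one_lt_two
  have hp : (0 : ℝ) < 2 ^ k := by positivity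
  refine ⟨k, ?_, ?_⟩
  · rw [div_lt_iff₀ ht, pow_succ] at h2
    rw [← mul_div_assoc, div_lt_iff₀ hp]; linarith
  · rw [le_div_iff₀ ht] at h1
    rw [← mul_div_assoc, le_div_iff₀ hp]; linarith

/-- Whitney systems exist at all scales that are small compared with the diameter of `D`. -/
theorem AhlforsRegular.exists_whitneySystem [BorelSpace X] [LocallyCompactSpace X]
    [SecondCountableTopology X]
    {m : Measure X} [m.IsOpenPosMeasure] [IsFiniteMeasureOnCompacts m] [SFinite m]
    {J : X → X → ℝ≥0∞} (hJm : Measurable fun p : X × X => J p.1 p.2)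
    (hJs : ∀ x y, J x y = J y x)
    {φ : ℝ → ℝ} (hc : CSJ m J φ) (hφ : IsScaleFunction φ) (h : VolumeDoubling m)
    (hJ : JumpKernelBounds m J φ) {D : Set X} (hD : AhlforsRegular m D) (hDo : IsOpen D) :
    ∃ c : ℝ, 0 < c ∧ ∃ M : ℝ≥0, ∀ s : ℝ, 0 < s →
      ENNReal.ofReal s < ENNReal.ofReal c * ediam D → Nonempty (WhitneySystem m J φ D s M) := by
  obtain ⟨c, hc0, Cc, hcut⟩ := hc.exists_cutoff_energy_le hJm hJs hφ h hJ
  obtain ⟨C₁, hC₁⟩ := hD.exists_measure_ball_le h 200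
  obtain ⟨Mr, hMr⟩ := h.exists_reflected_sets hDo.measurableSet C₁
  obtain ⟨Mc, hMc⟩ := h.exists_card_le 400
  obtain ⟨Cv, hCv⟩ := h.exists_ball_le 6
  refine ⟨min (c / 6) (1 / 2), by positivity, Mr + Mc + Cc * Cv, fun s hs hsD => ?_⟩
  have hs2 : ENNReal.ofReal s < ediam D / 2 := by
    refine hsD.trans_le ?_
    rw [ENNReal.div_eq_inv_mul]
    gcongr
    calc ENNReal.ofReal (min (c / 6) (1 / 2)) ≤ ENNReal.ofReal (1 / 2) :=
          ENNReal.ofReal_le_ofReal (min_le_right _ _)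
      _ = 2⁻¹ := by rw [one_div, ENNReal.ofReal_inv_of_pos (by norm_num)]; simp
  have hs6 : ENNReal.ofReal (6 * s) < ENNReal.ofReal c * ediam (univ : Set X) := by
    have e2 : ENNReal.ofReal c = 6 * ENNReal.ofReal (c / 6) := by
      rw [← ENNReal.ofReal_ofNat 6, ← ENNReal.ofReal_mul (by norm_num)]; congr 1; ring
    rw [ENNReal.ofReal_mul (by norm_num), ENNReal.ofReal_ofNat, e2, mul_assoc]
    refine ENNReal.mul_lt_mul_right (by norm_num) (by norm_num) (hsD.trans_le ?_)
    gcongr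
    · exact min_le_left _ _
    · exact subset_univ _
  have hsk : ∀ k : ℕ, s / 2 ^ k ≤ s := fun k =>
    div_le_self hs.le (one_le_pow₀ one_le_two)
  have hgood : ∀ᵐ x ∂m, ∀ k : ℕ, ∃ ϕ : X → ℝ,
      IsCutoff ϕ (ball x (6 * (s / 2 ^ k))) (ball x (2 * (6 * (s / 2 ^ k)))) ∧
        ∫⁻ y, ∫⁻ z, ENNReal.ofReal ((ϕ y - ϕ z) ^ 2) * J y z ∂m ∂m ≤
          Cc * (m (ball x (6 * (s / 2 ^ k))) * (ENNReal.ofReal (φ (6 * (s / 2 ^ k))))⁻¹) := by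
    rw [ae_all_iff]
    intro k
    refine hcut _ (by positivity) (lt_of_le_of_lt (ENNReal.ofReal_le_ofReal ?_) hs6)
    linarith [hsk k]
  have hk : ∀ x : X, ∃ k : ℕ, 0 < infDist x D → infDist x D < 48 * s →
      24 * (s / 2 ^ k) < infDist x D ∧ infDist x D ≤ 48 * (s / 2 ^ k) := by
    intro x
    by_cases hx : 0 < infDist x D ∧ infDist x D < 48 * s
    · obtain ⟨k, hk⟩ := exists_dyadic_near hx.1 hx.2
      exact ⟨k, fun _ _ => hk⟩
    · exact ⟨0, fun h1 h2 => absurd ⟨h1, h2⟩ hx⟩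
  choose k hk using hk
  set τ : X → ℝ := fun x => s / 2 ^ k x with hτ
  have hτpos : ∀ x, 0 < τ x := fun x => by positivity
  set t : Set X := {x | (∀ k : ℕ, ∃ ϕ : X → ℝ,
      IsCutoff ϕ (ball x (6 * (s / 2 ^ k))) (ball x (2 * (6 * (s / 2 ^ k)))) ∧
        ∫⁻ y, ∫⁻ z, ENNReal.ofReal ((ϕ y - ϕ z) ^ 2) * J y z ∂m ∂m ≤
          Cc * (m (ball x (6 * (s / 2 ^ k))) * (ENNReal.ofReal (φ (6 * (s / 2 ^ k))))⁻¹)) ∧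
      0 < infDist x D ∧ infDist x D < 48 * s} with ht
  -- The centres come from Vitali's covering lemma, applied to those points for which the cut-off
  -- functions exist at all dyadic scales: `CSJ(φ)` gives them for almost every centre only.
  obtain ⟨I, hIt, hdis, hcov⟩ := Vitali.exists_disjoint_subfamily_covering_enlargement_ball t id τ s
    (fun a _ => hsk _) 5 (by norm_num)
  have hcount : I.Countable :=
    PairwiseDisjoint.countable_of_isOpen hdis (fun i _ => isOpen_ball)
      (fun i _ => nonempty_ball.2 (hτpos i))
  have hcutI : ∀ x : X, ∃ ϕ : X → ℝ, x ∈ I →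
      IsCutoff ϕ (ball x (6 * τ x)) (ball x (2 * (6 * τ x))) ∧
        ∫⁻ y, ∫⁻ z, ENNReal.ofReal ((ϕ y - ϕ z) ^ 2) * J y z ∂m ∂m ≤
          Cc * (m (ball x (6 * τ x)) * (ENNReal.ofReal (φ (6 * τ x)))⁻¹) := by
    intro x
    by_cases hx : x ∈ I
    · obtain ⟨ϕ, hϕ⟩ := (hIt hx).1 (k x)
      exact ⟨ϕ, fun _ => hϕ⟩
    · exact ⟨0, fun h => absurd h hx⟩
  choose ϕ hϕ using hcutI
  have hdist : ∀ i ∈ I, 24 * τ i < infDist i D ∧ infDist i D ≤ 48 * τ i := fun i hi =>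
    hk i (hIt hi).2.1 (hIt hi).2.2
  have hDne : D.Nonempty := by
    rw [nonempty_iff_ne_empty]
    rintro rfl
    simp at hsD
  obtain ⟨E, hEm, hEs, hEV, hEo⟩ := hMr I τ hcount (fun i _ => hτpos i) hdis (fun i hi => by
    have hτi := hτpos i
    obtain ⟨z, hzD, hz⟩ := (infDist_lt_iff hDne (r := (48 + 1 / 2) * τ i)).1
      ((hdist i hi).2.trans_lt (by linarith))
    refine (hC₁ i z (τ i / 2) (τ i) hzD (by positivity) ?_ (by linarith) (by linarith)).trans ?_
    · refine (ENNReal.ofReal_le_ofReal ?_).trans_lt hs2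
      linarith [hsk (k i)]
    · refine mul_le_mul_right (measure_mono fun y hy => ?_) _
      refine ⟨hy.2, ?_⟩
      have e1 : dist y z < τ i / 2 := hy.1
      have := dist_triangle_right y i z
      rw [mem_ball]; linarith)
  exact ⟨{
    I := I
    τ := τ
    ϕ := ϕ
    E := E
    countable := hcount
    τ_pos := fun i _ => hτpos i
    lt_infDist := fun i hi => (hdist i hi).1
    infDist_le := fun i hi => (hdist i hi).2
    exists_mem := by
      filter_upwards [hgood] with x hx h0 h1
      obtain ⟨i, hi, hsub⟩ := hcov x ⟨hx, h0, h1⟩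
      refine ⟨i, hi, ?_⟩
      have hxi : x ∈ ball i (5 * τ i) := hsub (mem_ball_self (hτpos x))
      exact ball_subset_ball (by linarith [hτpos i]) hxi
    cutoff := fun i hi => by
      have := (hϕ i hi).1
      rwa [← mul_assoc, show (2 : ℝ) * 6 = 12 by norm_num] at this
    energy_le := fun i hi => by
      have hτi := hτpos i
      refine (hϕ i hi).2.trans ?_
      have e1 : m (ball i (6 * τ i)) ≤ Cv * m (ball i (τ i)) :=
        hCv _ _ _ _ hτi (by simp; positivity) le_rfl
      have e2 : φ (τ i) ≤ φ (6 * τ i) :=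
        hφ.strictMonoOn.monotoneOn (mem_Ici.2 hτi.le) (mem_Ici.2 (by positivity)) (by linarith)
      calc _ ≤ Cc * ((Cv * m (ball i (τ i))) * (ENNReal.ofReal (φ (τ i)))⁻¹) := by gcongr
        _ = (Cc * Cv) * (m (ball i (τ i)) * (ENNReal.ofReal (φ (τ i)))⁻¹) := by ring
        _ ≤ _ := by gcongr; push_cast; exact le_add_self
    card_le := fun x r hr T hT => by
      refine (hMc I τ hdis x r hr T fun i hi => ⟨(hT i hi).1, hτpos i, (hT i hi).2⟩).trans ?_
      push_cast
      rw [add_comm (Mr : ℝ≥0∞), add_assoc]; exact le_self_add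
    measurableSet_E := hEm
    E_subset := hEs
    measure_ball_le := fun i hi => (hEV i hi).trans (by
      gcongr; rw [add_assoc]; exact le_self_add)
    overlap_le := fun z => (hEo z).trans (by
      push_cast; rw [add_assoc]; exact le_self_add) }⟩

end

/-! ### The Whitney extension -/

section

theorem tsum_subtype_eq_sum {α : Type*} {I : Set α} {F : α → ℝ} {T : Finset α}
    (hTI : ∀ i ∈ T, i ∈ I) (hF : ∀ i ∈ I, F i ≠ 0 → i ∈ T) :
    ∑' i : I, F i = ∑ i ∈ T, F i := by
  rw [tsum_subtype I F, tsum_eq_sum (s := T)]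
  · exact Finset.sum_congr rfl fun i hi => indicator_of_mem (hTI i hi) _
  · intro i hi
    by_cases hiI : i ∈ I
    · rw [indicator_of_mem hiI]
      by_contra h0
      exact hi (hF i hiI h0)
    · exact indicator_of_notMem hiI _

theorem sum_le_tsum_subtype {α : Type*} {I : Set α} {F : α → ℝ≥0∞} {T : Finset α}
    (hTI : ∀ i ∈ T, i ∈ I) : ∑ i ∈ T, F i ≤ ∑' i : I, F i := by
  rw [tsum_subtype I F]
  calc ∑ i ∈ T, F i = ∑ i ∈ T, I.indicator F i :=
        Finset.sum_congr rfl fun i hi => (indicator_of_mem (hTI i hi) _).symm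
    _ ≤ _ := ENNReal.sum_le_tsum _

/-- Jensen's inequality for the square of the deviation of a weighted mean from `t`. -/
theorem sq_weighted_mean_sub_le {α : Type*} {T : Finset α} {w a : α → ℝ} (hw : ∀ i ∈ T, 0 ≤ w i)
    (hS : 0 < ∑ i ∈ T, w i) (t : ℝ) :
    ((∑ i ∈ T, w i * a i) / (∑ i ∈ T, w i) - t) ^ 2 ≤
      ∑ i ∈ T, (w i / ∑ i ∈ T, w i) * (a i - t) ^ 2 := by
  set S := ∑ i ∈ T, w i with hS'
  have h1 : ∑ i ∈ T, w i / S = 1 := by rw [← Finset.sum_div, ← hS', div_self hS.ne']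
  have h2 := (Even.convexOn_pow (𝕜 := ℝ) (n := 2) even_two).map_sum_le (t := T)
    (w := fun i => w i / S) (p := fun i => a i - t)
    (fun i hi => div_nonneg (hw i hi) hS.le) h1 (fun _ _ => mem_univ _)
  simp only [smul_eq_mul] at h2
  have h3 : ∑ i ∈ T, w i / S * (a i - t) = (∑ i ∈ T, w i * a i) / S - t := by
    simp_rw [mul_sub, Finset.sum_sub_distrib, ← Finset.sum_mul, h1, one_mul, Finset.sum_div]
    congr 1
    exact Finset.sum_congr rfl fun i _ => by ring
  rwa [h3] at h2

theorem sq_weighted_mean_sub_le_sum {α : Type*} {T : Finset α} {w a : α → ℝ}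
    (hw : ∀ i ∈ T, 0 ≤ w i) (hS : 0 < ∑ i ∈ T, w i) (t : ℝ) :
    ((∑ i ∈ T, w i * a i) / (∑ i ∈ T, w i) - t) ^ 2 ≤ ∑ i ∈ T, (a i - t) ^ 2 := by
  refine (sq_weighted_mean_sub_le hw hS t).trans (Finset.sum_le_sum fun i hi => ?_)
  refine mul_le_of_le_one_left (sq_nonneg _) ?_
  rw [div_le_one hS]
  exact Finset.single_le_sum hw hi

/-- Jensen's inequality for the square of the deviation of an average from `t`, with values in
`[0, ∞]`. -/
theorem ofReal_sq_setAverage_sub_mul_le {α : Type*} [MeasurableSpace α] {m : Measure α}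
    {E : Set α} (hE0 : m E ≠ 0) (hEt : m E ≠ ∞) {f : α → ℝ} (hf : Measurable f)
    (hf2 : ∫⁻ z in E, ENNReal.ofReal (f z ^ 2) ∂m < ∞) (t : ℝ) :
    ENNReal.ofReal ((⨍ z in E, f z ∂m - t) ^ 2) * m E ≤
      ∫⁻ z in E, ENNReal.ofReal ((f z - t) ^ 2) ∂m := by
  have : IsFiniteMeasure (m.restrict E) := ⟨by simpa using hEt.lt_top⟩
  have : NeZero (m.restrict E) := ⟨by simpa using hE0⟩
  have hL2 : MemLp f 2 (m.restrict E) := by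
    refine (memLp_two_iff_integrable_sq hf.aestronglyMeasurable).2
      ⟨(hf.pow_const 2).aestronglyMeasurable, ?_⟩
    rw [hasFiniteIntegral_iff_ofReal (ae_of_all _ fun _ => sq_nonneg _)]
    exact hf2
  have hfi : Integrable f (m.restrict E) := hL2.integrable one_le_two
  have hgi : Integrable (fun z => (f z - t) ^ 2) (m.restrict E) :=
    (hL2.sub (memLp_const t)).integrable_sq
  have hconv : ConvexOn ℝ univ fun x : ℝ => (x - t) ^ 2 := by
    have := (Even.convexOn_pow (𝕜 := ℝ) (n := 2) even_two).translate_left (-t)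
    simpa [Function.comp_def, sub_eq_add_neg] using this
  have h1 := hconv.map_average_le (μ := m.restrict E) (f := f) (by fun_prop) isClosed_univ
    (ae_of_all _ fun _ => mem_univ _) hfi hgi
  rw [← ofReal_integral_eq_lintegral_ofReal hgi (ae_of_all _ fun _ => sq_nonneg _)]
  rw [setAverage_eq m (fun z => (f z - t) ^ 2), smul_eq_mul] at h1
  have hpos : 0 < m.real E := ENNReal.toReal_pos hE0 hEt
  rw [← ENNReal.ofReal_toReal hEt, ← ENNReal.ofReal_mul (sq_nonneg _)]
  apply ENNReal.ofReal_le_ofReal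
  have h2 := mul_le_mul_of_nonneg_right h1 hpos.le
  rwa [mul_comm (m.real E)⁻¹, mul_assoc, inv_mul_cancel₀ hpos.ne', mul_one] at h2

variable {X : Type*} [MetricSpace X] [MeasurableSpace X]

namespace WhitneySystem

variable {m : Measure X} {J : X → X → ℝ≥0∞} {φ : ℝ → ℝ} {D : Set X} {s : ℝ} {M : ℝ≥0}

section Pointwise

variable (W : WhitneySystem m J φ D s M)

/-- Only finitely many Whitney centres have a radius and a distance to `x` comparable with the
distance of `x` to `D`. -/
theorem nbrSet_finite (x : X) : {i ∈ W.I | infDist x D ≤ 80 * W.τ i ∧ 9 * W.τ i ≤ infDist x D ∧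
    dist x i ≤ 2 * infDist x D}.Finite := by
  by_contra hinf
  obtain ⟨n, hn⟩ := exists_nat_gt M
  obtain ⟨T, hTs, hTn⟩ := Set.Infinite.exists_subset_card_eq hinf n
  have hle : (T.card : ℝ≥0∞) ≤ M := by
    rcases T.eq_empty_or_nonempty with rfl | ⟨i, hi⟩
    · simp
    have hpos : 0 < infDist x D := by
      have h1 := hTs hi
      have := W.τ_pos i h1.1
      linarith [h1.2.2.1]
    refine W.card_le x _ hpos T fun i hi => ?_
    obtain ⟨h1, h2, h3, h4⟩ := hTs hi
    have := W.τ_pos i h1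
    exact ⟨h1, by linarith, by linarith, by linarith⟩
  rw [hTn] at hle
  exact absurd hle (not_le.2 (by exact_mod_cast hn))

/-- The Whitney centres near `x`: their radii are comparable with the distance of `x` to `D`. -/
noncomputable def nbr (x : X) : Finset X := (W.nbrSet_finite x).toFinset

theorem mem_nbr {x i : X} : i ∈ W.nbr x ↔ i ∈ W.I ∧ infDist x D ≤ 80 * W.τ i ∧
    9 * W.τ i ≤ infDist x D ∧ dist x i ≤ 2 * infDist x D := by
  rw [nbr, Set.Finite.mem_toFinset]; rfl

theorem mem_I_of_mem_nbr {x i : X} (h : i ∈ W.nbr x) : i ∈ W.I := (W.mem_nbr.1 h).1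

theorem card_nbr_le (x : X) : ((W.nbr x).card : ℝ≥0∞) ≤ M := by
  rcases (W.nbr x).eq_empty_or_nonempty with h | ⟨i, hi⟩
  · simp [h]
  have hpos : 0 < infDist x D := by
    obtain ⟨h1, -, h2, -⟩ := W.mem_nbr.1 hi
    have := W.τ_pos i h1
    linarith
  refine W.card_le x _ hpos _ fun i hi => ?_
  obtain ⟨h1, h2, h3, h4⟩ := W.mem_nbr.1 hi
  have := W.τ_pos i h1
  exact ⟨h1, by linarith, by linarith, by linarith⟩

theorem dist_lt_of_ne_zero {x i : X} (hi : i ∈ W.I) (h : W.ϕ i x ≠ 0) : dist x i < 12 * W.τ i := by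
  by_contra hx
  exact h (isCutoff_eq_zero_of_le_dist (W.cutoff i hi) (not_lt.1 hx))

theorem lt_infDist_of_dist_lt {x i : X} (hi : i ∈ W.I) (h1 : dist x i < 12 * W.τ i) :
    12 * W.τ i < infDist x D := by
  have h2 := infDist_le_infDist_add_dist (s := D) (x := i) (y := x)
  rw [dist_comm] at h2
  linarith [W.lt_infDist i hi]

theorem lt_infDist_of_ne_zero {x i : X} (hi : i ∈ W.I) (h : W.ϕ i x ≠ 0) :
    12 * W.τ i < infDist x D :=
  W.lt_infDist_of_dist_lt hi (W.dist_lt_of_ne_zero hi h)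

theorem infDist_lt_of_ne_zero {x i : X} (hi : i ∈ W.I) (h : W.ϕ i x ≠ 0) :
    infDist x D < 60 * W.τ i := by
  have h1 := W.dist_lt_of_ne_zero hi h
  have h2 := infDist_le_infDist_add_dist (s := D) (x := x) (y := i)
  linarith [W.infDist_le i hi]

theorem mem_nbr_of_near {x y i : X} (hxy : 4 * dist x y ≤ infDist x D) (hi : i ∈ W.I)
    (h : W.ϕ i y ≠ 0) : i ∈ W.nbr x := by
  have h1 := W.dist_lt_of_ne_zero hi h
  have h2 := W.lt_infDist_of_ne_zero hi h
  have h3 := W.infDist_lt_of_ne_zero hi h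
  have h4 := infDist_le_infDist_add_dist (s := D) (x := x) (y := y)
  have h5 := infDist_le_infDist_add_dist (s := D) (x := y) (y := x)
  rw [dist_comm] at h5
  have h6 := dist_triangle x y i
  exact W.mem_nbr.2 ⟨hi, by linarith, by linarith, by linarith⟩

theorem mem_nbr_of_ne_zero {x i : X} (hi : i ∈ W.I) (h : W.ϕ i x ≠ 0) : i ∈ W.nbr x :=
  W.mem_nbr_of_near (by simpa using infDist_nonneg) hi h

/-- The value attached to a Whitney centre: the average of `f` over the reflected set at small
scales, and zero at the scales comparable with `s`, so that the extension of `f` vanishes away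
from `D`. -/
noncomputable def avg (f : X → ℝ) (i : X) : ℝ :=
  if W.τ i ≤ s / 8 then ⨍ z in W.E i, f z ∂m else 0

/-- The Whitney extension of `f` from `D` to the whole space: off `D` the values `avg f i` are
blended by the partition of unity obtained from the cut-off functions.  The cut-off functions vanish
on `D`, so that only `f` contributes there. -/
noncomputable def ext (f : X → ℝ) (x : X) : ℝ :=
  D.indicator f x + (∑' i : W.I, W.ϕ i x * W.avg f i) / ∑' i : W.I, W.ϕ i x

theorem measurable_ext (hD : MeasurableSet D) {f : X → ℝ} (hf : Measurable f) :
    Measurable (W.ext f) := by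
  have := W.countable.to_subtype
  have h1 : ∀ i : W.I, Measurable (W.ϕ i) := fun i => (W.cutoff i i.2).measurable
  exact (hf.indicator hD).add
    ((Measurable.tsum fun i => (h1 i).mul_const _).div (Measurable.tsum h1))

theorem ext_of_mem {f : X → ℝ} {x : X} (hx : x ∈ D) : W.ext f x = f x := by
  have h0 : ∀ i : W.I, W.ϕ i x = 0 := by
    intro i
    by_contra h
    have h1 := W.lt_infDist_of_ne_zero i.2 h
    rw [infDist_zero_of_mem hx] at h1
    linarith [W.τ_pos i i.2]
  simp [ext, h0, hx]

theorem ext_of_notMem {f : X → ℝ} {x : X} (hx : x ∉ D) {T : Finset X}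
    (hTI : ∀ i ∈ T, i ∈ W.I) (hT : ∀ i ∈ W.I, W.ϕ i x ≠ 0 → i ∈ T) :
    W.ext f x = (∑ i ∈ T, W.ϕ i x * W.avg f i) / ∑ i ∈ T, W.ϕ i x := by
  rw [ext, indicator_of_notMem hx, zero_add,
    tsum_subtype_eq_sum (F := fun i => W.ϕ i x * W.avg f i) hTI
      (fun i hi h => hT i hi (left_ne_zero_of_mul h)),
    tsum_subtype_eq_sum (F := fun i => W.ϕ i x) hTI hT]

theorem ext_eq_zero {f : X → ℝ} {x : X} (hx : 8 * s ≤ infDist x D) (hs : 0 < s) :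
    W.ext f x = 0 := by
  have hxD : x ∉ D := fun h => by rw [infDist_zero_of_mem h] at hx; linarith
  rw [W.ext_of_notMem hxD (fun _ => W.mem_I_of_mem_nbr) (fun _ => W.mem_nbr_of_ne_zero),
    Finset.sum_eq_zero, zero_div]
  intro i hi
  rcases eq_or_ne (W.ϕ i x) 0 with h | h
  · rw [h, zero_mul]
  have := W.infDist_lt_of_ne_zero (W.mem_I_of_mem_nbr hi) h
  rw [avg, if_neg (by linarith), mul_zero]

theorem ϕ_nonneg {x i : X} (hi : i ∈ W.nbr x) (y : X) : 0 ≤ W.ϕ i y :=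
  (W.cutoff i (W.mem_I_of_mem_nbr hi)).nonneg y

theorem one_le_sum {x i : X} (hi : i ∈ W.I) (hx : x ∈ ball i (6 * W.τ i)) {T : Finset X}
    (hTI : ∀ i ∈ T, i ∈ W.I) (hT : ∀ i ∈ W.I, W.ϕ i x ≠ 0 → i ∈ T) :
    1 ≤ ∑ i ∈ T, W.ϕ i x := by
  have h1 : W.ϕ i x = 1 := (W.cutoff i hi).eq_one x hx
  rw [← h1]
  exact Finset.single_le_sum (fun j hj => (W.cutoff j (hTI j hj)).nonneg x)
    (hT i hi (by rw [h1]; exact one_ne_zero))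

/-- The deviation of the extension from `t` is controlled by that of the neighbouring values.  The
weights of the blending must not all vanish unless `t = 0`. -/
theorem ext_sub_sq_le {f : X → ℝ} {x : X} (hx : x ∉ D) {t : ℝ}
    (ht : t = 0 ∨ ∃ i ∈ W.I, x ∈ ball i (6 * W.τ i)) :
    ENNReal.ofReal ((W.ext f x - t) ^ 2) ≤
      ∑ i ∈ W.nbr x, (ball i (12 * W.τ i)).indicator
        (fun _ => ENNReal.ofReal ((W.avg f i - t) ^ 2)) x := by
  set T := W.nbr x with hT
  have hTI : ∀ i ∈ T, i ∈ W.I := fun _ => W.mem_I_of_mem_nbr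
  have hw : ∀ i ∈ T, 0 ≤ W.ϕ i x := fun i hi => W.ϕ_nonneg hi x
  rw [W.ext_of_notMem hx hTI (fun _ => W.mem_nbr_of_ne_zero)]
  rcases (Finset.sum_nonneg hw).eq_or_lt with h0 | hS
  · have ht0 : t = 0 := by
      rcases ht with ht | ⟨i, hi, hxi⟩
      · exact ht
      · have := W.one_le_sum hi hxi hTI (fun _ => W.mem_nbr_of_ne_zero)
        linarith
    simp [← h0, ht0]
  · refine (ENNReal.ofReal_le_ofReal (sq_weighted_mean_sub_le hw hS t)).trans ?_
    rw [ENNReal.ofReal_sum_of_nonneg fun i hi =>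
      mul_nonneg (div_nonneg (hw i hi) hS.le) (sq_nonneg _)]
    refine Finset.sum_le_sum fun i hi => ?_
    rcases eq_or_ne (W.ϕ i x) 0 with h | h
    · simp [h]
    · rw [indicator_of_mem (by exact W.dist_lt_of_ne_zero (hTI i hi) h)]
      apply ENNReal.ofReal_le_ofReal
      refine mul_le_of_le_one_left (sq_nonneg _) ?_
      rw [div_le_one hS]
      exact Finset.single_le_sum hw hi

/-- The increments of the extension between two nearby points.  Subtracting the weighted mean of
the values at `x` makes the increments of the normalizing sum irrelevant. -/
theorem ext_sub_ext_sq_le {f : X → ℝ} {x y : X} (hx : x ∉ D) (hy : y ∉ D)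
    (hxy : 4 * dist x y ≤ infDist x D)
    (hxc : ∃ i ∈ W.I, x ∈ ball i (6 * W.τ i)) (hyc : ∃ i ∈ W.I, y ∈ ball i (6 * W.τ i)) :
    (W.ext f x - W.ext f y) ^ 2 ≤ (W.nbr x).card * ∑ i ∈ W.nbr x, ∑ j ∈ W.nbr x,
      (W.avg f i - W.avg f j) ^ 2 * (W.ϕ i x - W.ϕ i y) ^ 2 := by
  set T := W.nbr x with hT
  have hTI : ∀ i ∈ T, i ∈ W.I := fun _ => W.mem_I_of_mem_nbr
  have hTx : ∀ i ∈ W.I, W.ϕ i x ≠ 0 → i ∈ T := fun _ => W.mem_nbr_of_ne_zero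
  have hTy : ∀ i ∈ W.I, W.ϕ i y ≠ 0 → i ∈ T := fun _ => W.mem_nbr_of_near hxy
  obtain ⟨ix, hix, hix'⟩ := hxc
  obtain ⟨iy, hiy, hiy'⟩ := hyc
  have hSx := W.one_le_sum hix hix' hTI hTx
  have hSy := W.one_le_sum hiy hiy' hTI hTy
  have hex := W.ext_of_notMem (f := f) hx hTI hTx
  have hey := W.ext_of_notMem (f := f) hy hTI hTy
  set a := W.avg f
  set e := W.ext f x with he
  set Sx := ∑ i ∈ T, W.ϕ i x with hSx'
  set Sy := ∑ i ∈ T, W.ϕ i y with hSy'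
  -- `e` is the weighted mean of the `a i` with the weights `W.ϕ i x`.
  have h1 : ∑ i ∈ T, (a i - e) * W.ϕ i x = 0 := by
    have : ∑ i ∈ T, (a i - e) * W.ϕ i x = (∑ i ∈ T, W.ϕ i x * a i) - e * Sx := by
      rw [hSx', Finset.mul_sum, ← Finset.sum_sub_distrib]
      exact Finset.sum_congr rfl fun i _ => by ring
    rw [this, hex, div_mul_cancel₀ _ (by linarith), sub_self]
  have h2 : (e - W.ext f y) * Sy = ∑ i ∈ T, (a i - e) * (W.ϕ i x - W.ϕ i y) := by
    have : ∑ i ∈ T, (a i - e) * (W.ϕ i x - W.ϕ i y) =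
        (∑ i ∈ T, (a i - e) * W.ϕ i x) - ((∑ i ∈ T, W.ϕ i y * a i) - e * Sy) := by
      rw [hSy', Finset.mul_sum, ← Finset.sum_sub_distrib, ← Finset.sum_sub_distrib]
      exact Finset.sum_congr rfl fun i _ => by ring
    rw [this, h1, hey, sub_mul, div_mul_cancel₀ _ (by linarith)]
    ring
  have h3 : (e - W.ext f y) ^ 2 ≤ ((e - W.ext f y) * Sy) ^ 2 := by
    rw [mul_pow]
    exact le_mul_of_one_le_right (sq_nonneg _) (one_le_pow₀ hSy)
  refine h3.trans ?_
  rw [h2]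
  refine sq_sum_le_card_mul_sum_sq.trans ?_
  gcongr with i hi
  rw [mul_pow, ← Finset.sum_mul]
  gcongr
  have h4 := sq_weighted_mean_sub_le_sum (T := T) (w := fun i => W.ϕ i x) (a := a)
    (fun i hi => W.ϕ_nonneg hi x) (by linarith) (a i)
  rw [← hSx', ← hex] at h4
  calc (a i - e) ^ 2 = (e - a i) ^ 2 := by ring
    _ ≤ _ := h4
    _ = _ := Finset.sum_congr rfl fun j _ => by ring

end Pointwise

end WhitneySystem

end

/-! ### Energy of the extension at short range: linked cells -/

section

variable {X : Type*} [MetricSpace X] [MeasurableSpace X]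

namespace WhitneySystem

variable {m : Measure X} {J : X → X → ℝ≥0∞} {φ : ℝ → ℝ} {D : Set X} {s : ℝ} {M : ℝ≥0}
  (W : WhitneySystem m J φ D s M)

theorem measure_E_ne_zero [OpensMeasurableSpace X] [m.IsOpenPosMeasure] {i : X} (hi : i ∈ W.I) :
    m (W.E i) ≠ 0 := by
  intro h0
  have h1 := W.measure_ball_le i hi
  rw [h0, mul_zero] at h1
  exact absurd h1 (not_le.2 (measure_ball_pos m i (W.τ_pos i hi)))

theorem measure_E_ne_top [LocallyCompactSpace X] [IsFiniteMeasureOnCompacts m]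
    (h : VolumeDoubling m) (i : X) : m (W.E i) ≠ ∞ :=
  ((measure_mono ((W.E_subset i).trans inter_subset_right)).trans_lt
    (h.measure_ball_lt_top _ _)).ne

/-- Bounded overlap of the reflected sets, for integrals. -/
theorem tsum_setLIntegral_E_le {V : Set X} {g : X → ℝ≥0∞} (hg : Measurable g) :
    ∑' i : W.I, ∫⁻ z in W.E i ∩ V, g z ∂m ≤ M * ∫⁻ z in V, g z ∂m := by
  have := W.countable.to_subtype
  have h1 : ∀ i : W.I, ∫⁻ z in W.E i ∩ V, g z ∂m =
      ∫⁻ z in V, (W.E i).indicator 1 z * g z ∂m := by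
    intro i
    rw [← Measure.restrict_restrict (W.measurableSet_E i),
      ← lintegral_indicator (W.measurableSet_E i)]
    refine lintegral_congr fun z => ?_
    by_cases hz : z ∈ W.E i <;> simp [hz]
  simp_rw [h1]
  rw [← lintegral_tsum (f := fun (i : W.I) z => (W.E i).indicator 1 z * g z) fun i =>
    ((measurable_one.indicator (W.measurableSet_E i)).mul hg).aemeasurable,
    ← lintegral_const_mul _ hg]
  refine lintegral_mono fun z => ?_
  rw [ENNReal.tsum_mul_right]
  gcongr
  exact W.overlap_le z

theorem avg_sub_sq_mul_le [OpensMeasurableSpace X] [LocallyCompactSpace X] [m.IsOpenPosMeasure]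
    [IsFiniteMeasureOnCompacts m] (h : VolumeDoubling m) {f : X → ℝ} (hf : Measurable f)
    (hf2 : ∫⁻ z in D, ENNReal.ofReal (f z ^ 2) ∂m < ∞) {i : X} (hi : i ∈ W.I)
    (hτ : W.τ i ≤ s / 8) (t : ℝ) :
    ENNReal.ofReal ((W.avg f i - t) ^ 2) * m (W.E i) ≤
      ∫⁻ z in W.E i, ENNReal.ofReal ((f z - t) ^ 2) ∂m := by
  rw [avg, if_pos hτ]
  exact ofReal_sq_setAverage_sub_mul_le (W.measure_E_ne_zero hi) (W.measure_E_ne_top h i) hf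
    ((lintegral_mono_set ((W.E_subset i).trans inter_subset_left)).trans_lt hf2) t

/-- Weighted `L²` bound for the deviation of the extension from a constant `t`, for weights `k`
that are almost decreasing under the reflection from the Whitney balls to `D`.  With `k = 1` this
is the `L²` bound for the extension; with a kernel `k = J(·, p)` it bounds the part of the energy
that comes from jumps which are not short compared with the distance to `D`. -/
theorem lintegral_ext_sub_sq_mul_le [BorelSpace X] [LocallyCompactSpace X] [m.IsOpenPosMeasure]
    [IsFiniteMeasureOnCompacts m] (h : VolumeDoubling m) (hs : 0 < s) (hDo : IsOpen D)
    (hDne : D.Nonempty) (hnull : m (closure D \ D) = 0) {Cv : ℝ≥0}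
    (hCv : ∀ (x : X) (r : ℝ), 0 < r → m (ball x (12 * r)) ≤ Cv * m (ball x r))
    {f : X → ℝ} (hf : Measurable f) (hf2 : ∫⁻ z in D, ENNReal.ofReal (f z ^ 2) ∂m < ∞)
    {A V : Set X} (hA : MeasurableSet A) {t : ℝ} {k : X → ℝ≥0∞} (hk : Measurable k) {K : ℝ≥0}
    (hAt : ∀ x ∈ A, t = 0 ∨ infDist x D < 3 / 2 * s)
    (hAV : ∀ x ∈ A, ∀ z ∈ D, dist x z ≤ 400 * s → z ∈ V)
    (hkK : ∀ x ∈ A, ∀ z ∈ D, dist x z ≤ 7 * infDist x D →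
      ENNReal.ofReal ((f z - t) ^ 2) * k x ≤ K * (ENNReal.ofReal ((f z - t) ^ 2) * k z)) :
    ∫⁻ x in A, ENNReal.ofReal ((W.ext f x - t) ^ 2) * k x ∂m ≤
      (1 + K * Cv * M * M) * ∫⁻ z in V, ENNReal.ofReal ((f z - t) ^ 2) * k z ∂m := by
  have := W.countable.to_subtype
  set g : X → ℝ≥0∞ := fun z => ENNReal.ofReal ((f z - t) ^ 2) * k z with hg
  have hgm : Measurable g := Measurable.mul (by fun_prop) hk
  have hin : ∫⁻ x in A ∩ D, ENNReal.ofReal ((W.ext f x - t) ^ 2) * k x ∂m ≤ ∫⁻ z in V, g z ∂m := by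
    rw [setLIntegral_congr_fun (g := g) (hA.inter hDo.measurableSet) fun x hx => by
      simp only [hg, W.ext_of_mem hx.2]]
    exact lintegral_mono_set fun x hx => hAV x hx.1 x hx.2 (by simp; positivity)
  set d : X → ℝ≥0∞ := fun i => K * ((m (W.E i))⁻¹ * ∫⁻ z in W.E i ∩ V, g z ∂m) with hd
  have hcl : ∀ᵐ x ∂m, x ∉ closure D \ D := measure_eq_zero_iff_ae_notMem.1 hnull
  have hpt : ∀ᵐ x ∂m, x ∈ A \ D → ENNReal.ofReal ((W.ext f x - t) ^ 2) * k x ≤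
      ∑' i : W.I, (ball (i : X) (12 * W.τ i)).indicator (fun _ => d i) x := by
    filter_upwards [W.exists_mem, hcl] with x hx hxcl hxA
    have hpos : 0 < infDist x D :=
      (infDist_pos_iff_notMem_closure hDne).1 fun h => hxcl ⟨h, hxA.2⟩
    have ht : t = 0 ∨ ∃ i ∈ W.I, x ∈ ball i (6 * W.τ i) :=
      (hAt x hxA.1).imp id fun h => hx hpos (by linarith)
    calc ENNReal.ofReal ((W.ext f x - t) ^ 2) * k x
        ≤ (∑ i ∈ W.nbr x, (ball i (12 * W.τ i)).indicator
            (fun _ => ENNReal.ofReal ((W.avg f i - t) ^ 2)) x) * k x := by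
          gcongr; exact W.ext_sub_sq_le hxA.2 ht
      _ = ∑ i ∈ W.nbr x, (ball i (12 * W.τ i)).indicator
            (fun _ => ENNReal.ofReal ((W.avg f i - t) ^ 2)) x * k x := by rw [Finset.sum_mul]
      _ ≤ ∑ i ∈ W.nbr x, (ball i (12 * W.τ i)).indicator (fun _ => d i) x := by
          refine Finset.sum_le_sum fun i hi => ?_
          by_cases hxi : x ∈ ball i (12 * W.τ i)
          swap
          · simp [indicator_of_notMem hxi]
          rw [indicator_of_mem hxi, indicator_of_mem hxi]
          have hiI := W.mem_I_of_mem_nbr hi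
          have hxi' : dist x i < 12 * W.τ i := hxi
          have hlt := W.lt_infDist_of_dist_lt hiI hxi'
          rcases le_or_gt (W.τ i) (s / 8) with hτ | hτ
          swap
          -- If `τ i` is larger, then `W.avg f i = 0`, and `x` is too far from `D` for `t ≠ 0`.
          · have ht0 : t = 0 := (hAt x hxA.1).resolve_right (by linarith)
            simp [avg, not_le.2 hτ, ht0]
          have hE : ∀ z ∈ W.E i, z ∈ D ∧ dist x z < 61 * W.τ i := fun z hz => by
            have h1 := W.E_subset i hz
            have h2 : dist z i < 49 * W.τ i := h1.2
            exact ⟨h1.1, by linarith [dist_triangle_right x z i]⟩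
          have hEV : W.E i ∩ V = W.E i := inter_eq_left.2 fun z hz =>
            hAV x hxA.1 z (hE z hz).1 (by linarith [(hE z hz).2])
          have h0 := W.measure_E_ne_zero hiI
          have htop := W.measure_E_ne_top h i
          have h1 : ENNReal.ofReal ((W.avg f i - t) ^ 2) ≤
              (m (W.E i))⁻¹ * ∫⁻ z in W.E i, ENNReal.ofReal ((f z - t) ^ 2) ∂m := by
            rw [mul_comm, ← div_eq_mul_inv, ENNReal.le_div_iff_mul_le (Or.inl h0) (Or.inl htop)]
            exact W.avg_sub_sq_mul_le h hf hf2 hiI hτ t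
          calc _ ≤ ((m (W.E i))⁻¹ * ∫⁻ z in W.E i, ENNReal.ofReal ((f z - t) ^ 2) ∂m) * k x := by
                gcongr
            _ = (m (W.E i))⁻¹ * ∫⁻ z in W.E i, ENNReal.ofReal ((f z - t) ^ 2) * k x ∂m := by
                rw [lintegral_mul_const _ (by fun_prop), mul_assoc]
            _ ≤ (m (W.E i))⁻¹ * ∫⁻ z in W.E i, K * g z ∂m := by
                refine mul_le_mul_right (setLIntegral_mono' (W.measurableSet_E i) fun z hz => ?_) _
                exact hkK x hxA.1 z (hE z hz).1 (by linarith [(hE z hz).2])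
            _ = d i := by
                rw [lintegral_const_mul _ hgm, hd]
                simp only [hEV]
                ring
      _ ≤ _ := sum_le_tsum_subtype (I := W.I)
          (F := fun i => (ball i (12 * W.τ i)).indicator (fun _ => d i) x)
          (fun _ => W.mem_I_of_mem_nbr)
  have hout : ∫⁻ x in A \ D, ENNReal.ofReal ((W.ext f x - t) ^ 2) * k x ∂m ≤
      (K * Cv * M * M) * ∫⁻ z in V, g z ∂m := by
    calc _ ≤ ∫⁻ x in A \ D, ∑' i : W.I, (ball (i : X) (12 * W.τ i)).indicator (fun _ => d i) x ∂m := by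
          refine lintegral_mono_ae ?_
          exact (ae_restrict_iff' (hA.diff hDo.measurableSet)).2 hpt
      _ ≤ ∫⁻ x, ∑' i : W.I, (ball (i : X) (12 * W.τ i)).indicator (fun _ => d i) x ∂m :=
          setLIntegral_le_lintegral _ _
      _ = ∑' i : W.I, d i * m (ball (i : X) (12 * W.τ i)) := by
          rw [lintegral_tsum fun i =>
            (measurable_const.indicator measurableSet_ball).aemeasurable]
          congr 1; ext i
          rw [lintegral_indicator measurableSet_ball, setLIntegral_const]
      _ ≤ ∑' i : W.I, (K * Cv * M) * ∫⁻ z in W.E i ∩ V, g z ∂m := by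
          refine ENNReal.tsum_le_tsum fun i => ?_
          have h0 := W.measure_E_ne_zero i.2
          have htop := W.measure_E_ne_top h i
          calc d i * m (ball (i : X) (12 * W.τ i)) ≤ d i * (Cv * (M * m (W.E i))) := by
                gcongr
                exact (hCv _ _ (W.τ_pos i i.2)).trans (by gcongr; exact W.measure_ball_le i i.2)
            _ = (m (W.E i) * (m (W.E i))⁻¹) * ((K * Cv * M) * ∫⁻ z in W.E i ∩ V, g z ∂m) := by
                rw [hd]; ring
            _ = _ := by rw [ENNReal.mul_inv_cancel h0 htop, one_mul]
      _ ≤ (K * Cv * M) * (M * ∫⁻ z in V, g z ∂m) := by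
          rw [ENNReal.tsum_mul_left]
          gcongr
          exact W.tsum_setLIntegral_E_le hgm
      _ = _ := by ring
  rw [← lintegral_inter_add_sdiff _ A hDo.measurableSet, add_mul, one_mul]
  exact add_le_add hin hout

/-- Two Whitney centres are linked, relative to `A`, if they are neighbours of a common point of
`A` which is not far from `D`. -/
def Linked (A : Set X) (i j : X) : Prop :=
  ∃ x ∈ A, infDist x D < 48 * s ∧ i ∈ W.nbr x ∧ j ∈ W.nbr x

variable {W} in
theorem Linked.symm {A : Set X} {i j : X} (h : W.Linked A i j) : W.Linked A j i := by
  obtain ⟨x, h1, h2, h3, h4⟩ := h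
  exact ⟨x, h1, h2, h4, h3⟩

variable {W} in
theorem Linked.dist_le {A : Set X} {i j : X} (h : W.Linked A i j) :
    dist i j ≤ 320 * W.τ i ∧ W.τ j ≤ 9 * W.τ i := by
  obtain ⟨x, h1, h2, h3, h4⟩ := h
  obtain ⟨hi1, hi2, hi3, hi4⟩ := W.mem_nbr.1 h3
  obtain ⟨hj1, hj2, hj3, hj4⟩ := W.mem_nbr.1 h4
  have := W.τ_pos i hi1
  exact ⟨by linarith [dist_triangle_left i j x], by linarith⟩

variable {W} in
theorem Linked.E_inter_eq {A V : Set X} (hAV : ∀ x ∈ A, ∀ z ∈ D, dist x z ≤ 400 * s → z ∈ V)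
    {i j : X} (h : W.Linked A i j) : W.E i ∩ V = W.E i := by
  obtain ⟨x, h1, h2, h3, -⟩ := h
  obtain ⟨hi1, hi2, hi3, hi4⟩ := W.mem_nbr.1 h3
  refine inter_eq_left.2 fun z hz => hAV x h1 z (W.E_subset i hz).1 ?_
  have h5 : dist z i < 49 * W.τ i := (W.E_subset i hz).2
  linarith [dist_triangle_right x z i]

open Classical in
/-- A Whitney centre is linked to at most `M` others. -/
theorem tsum_linked_le (A : Set X) {i : X} (hi : i ∈ W.I) :
    ∑' j : W.I, (if W.Linked A i j then 1 else 0 : ℝ≥0∞) ≤ M := by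
  rw [ENNReal.tsum_eq_iSup_sum]
  refine iSup_le fun T => ?_
  rw [← Finset.sum_filter, Finset.sum_const, nsmul_eq_mul, mul_one,
    ← Finset.card_map (Function.Embedding.subtype _)]
  refine W.card_le i (W.τ i) (W.τ_pos i hi) _ fun j hj => ?_
  simp only [Finset.mem_map, Finset.mem_filter, Function.Embedding.subtype_apply] at hj
  obtain ⟨j', ⟨-, hl⟩, rfl⟩ := hj
  have h1 := hl.dist_le
  have h2 := hl.symm.dist_le
  have := W.τ_pos i hi
  have := W.τ_pos j' j'.2
  exact ⟨j'.2, by linarith, by linarith, by linarith⟩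

open Classical in
/-- The total weight by which the increments of the cut-off function `ϕ i` enter the energy of the
extension. -/
noncomputable def linkedOsc (A : Set X) (f : X → ℝ) (i : X) : ℝ≥0∞ :=
  ∑' j : W.I, if W.Linked A i j then ENNReal.ofReal ((W.avg f i - W.avg f j) ^ 2) else 0

/-- The increments of the extension over jumps that are short compared with the distance to `D`.
Far from `D`, where the Whitney balls do not cover, the extension vanishes at both points. -/
theorem ext_sub_ext_sq_le_linkedOsc (hs : 0 < s) {A : Set X} (f : X → ℝ) {x y : X} (hxA : x ∈ A)
    (hxy : 4 * dist x y < infDist x D)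
    (hx : 0 < infDist x D → infDist x D < 48 * s → ∃ i ∈ W.I, x ∈ ball i (6 * W.τ i))
    (hy : 0 < infDist y D → infDist y D < 48 * s → ∃ i ∈ W.I, y ∈ ball i (6 * W.τ i)) :
    ENNReal.ofReal ((W.ext f x - W.ext f y) ^ 2) ≤
      M * ∑' i : W.I, W.linkedOsc A f i * ENNReal.ofReal ((W.ϕ i x - W.ϕ i y) ^ 2) := by
  classical
  have h1 := infDist_le_infDist_add_dist (s := D) (x := x) (y := y)
  have h2 := infDist_le_infDist_add_dist (s := D) (x := y) (y := x)
  rw [dist_comm] at h2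
  have hd := dist_nonneg (x := x) (y := y)
  have hxp : 0 < infDist x D := by linarith
  have hyp : 0 < infDist y D := by linarith
  have hxD : x ∉ D := fun h => hxp.ne' (infDist_zero_of_mem h)
  have hyD : y ∉ D := fun h => hyp.ne' (infDist_zero_of_mem h)
  by_cases hfar : infDist x D < 48 * s ∧ infDist y D < 48 * s
  swap
  · have h3 : 8 * s ≤ infDist x D ∧ 8 * s ≤ infDist y D := by
      rw [not_and_or, not_lt, not_lt] at hfar
      rcases hfar with h | h <;> constructor <;> linarith
    simp [W.ext_eq_zero h3.1 hs, W.ext_eq_zero h3.2 hs]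
  have key := W.ext_sub_ext_sq_le (f := f) hxD hyD hxy.le (hx hxp hfar.1) (hy hyp hfar.2)
  have hnn : ∀ i j, 0 ≤ (W.avg f i - W.avg f j) ^ 2 * (W.ϕ i x - W.ϕ i y) ^ 2 := fun i j =>
    mul_nonneg (sq_nonneg _) (sq_nonneg _)
  calc _ ≤ ENNReal.ofReal ((W.nbr x).card * ∑ i ∈ W.nbr x, ∑ j ∈ W.nbr x,
      (W.avg f i - W.avg f j) ^ 2 * (W.ϕ i x - W.ϕ i y) ^ 2) := ENNReal.ofReal_le_ofReal key
    _ = (W.nbr x).card * ∑ i ∈ W.nbr x, (∑ j ∈ W.nbr x,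
        ENNReal.ofReal ((W.avg f i - W.avg f j) ^ 2)) * ENNReal.ofReal ((W.ϕ i x - W.ϕ i y) ^ 2) := by
        rw [ENNReal.ofReal_mul (by positivity), ENNReal.ofReal_natCast,
          ENNReal.ofReal_sum_of_nonneg fun i _ => Finset.sum_nonneg fun j _ => hnn i j]
        congr 1
        refine Finset.sum_congr rfl fun i _ => ?_
        rw [ENNReal.ofReal_sum_of_nonneg fun j _ => hnn i j, Finset.sum_mul]
        exact Finset.sum_congr rfl fun j _ => ENNReal.ofReal_mul (sq_nonneg _)
    _ ≤ M * ∑ i ∈ W.nbr x, W.linkedOsc A f i * ENNReal.ofReal ((W.ϕ i x - W.ϕ i y) ^ 2) := by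
        gcongr with i hi
        · exact W.card_nbr_le x
        · refine le_trans (Finset.sum_le_sum fun j hj => ?_) (sum_le_tsum_subtype (I := W.I)
            (F := fun j => if W.Linked A i j then ENNReal.ofReal ((W.avg f i - W.avg f j) ^ 2) else 0)
            (fun _ => W.mem_I_of_mem_nbr))
          rw [if_pos ⟨x, hxA, hfar.1, hi, hj⟩]
    _ ≤ _ := by
        gcongr
        exact sum_le_tsum_subtype (I := W.I)
          (F := fun i => W.linkedOsc A f i * ENNReal.ofReal ((W.ϕ i x - W.ϕ i y) ^ 2))
          (fun _ => W.mem_I_of_mem_nbr)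

end WhitneySystem

end

/-! ### Summation over linked cells -/

section

variable {X : Type*} [MetricSpace X] [MeasurableSpace X]

namespace WhitneySystem

variable {m : Measure X} {J : X → X → ℝ≥0∞} {φ : ℝ → ℝ} {D : Set X} {s : ℝ} {M : ℝ≥0}
  (W : WhitneySystem m J φ D s M)

/-- The difference of the values at two linked Whitney centres is controlled by the energy of `f`
between the reflected sets, and by its `L²` norm at scales comparable with `s`. -/
theorem Linked.avg_sub_avg_sq_le {W : WhitneySystem m J φ D s M} [BorelSpace X]
    [LocallyCompactSpace X] [m.IsOpenPosMeasure] [IsFiniteMeasureOnCompacts m]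
    (h : VolumeDoubling m) (hφ : IsScaleFunction φ) (hs : 0 < s) {Cv Cφ CJ : ℝ≥0}
    (hCv : ∀ (x y : X) (r R : ℝ), 0 < r → dist x y ≤ 1000 * r → R ≤ 1000 * r →
      m (ball x R) ≤ Cv * m (ball y r))
    (hCφ : ∀ t r : ℝ, 0 < r → 0 < t → t ≤ 1000 * r →
      (ENNReal.ofReal (φ r))⁻¹ ≤ Cφ * (ENNReal.ofReal (φ t))⁻¹)
    (hCJ : ∀ (x z w : X) (r : ℝ), 0 < r → z ≠ w → dist z w ≤ 1000 * r → dist z x ≤ 1000 * r →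
      (m (ball x r) * ENNReal.ofReal (φ r))⁻¹ ≤ CJ * J z w)
    {f : X → ℝ} (hf : Measurable f) (hf2 : ∫⁻ z in D, ENNReal.ofReal (f z ^ 2) ∂m < ∞)
    {A : Set X} {i j : X} (hl : W.Linked A i j) :
    ENNReal.ofReal ((W.avg f i - W.avg f j) ^ 2) *
        (m (ball i (W.τ i)) * (ENNReal.ofReal (φ (W.τ i)))⁻¹) ≤
      (Cv * M * M * CJ) * (∫⁻ z in W.E i, ∫⁻ w in W.E j,
          ENNReal.ofReal ((f z - f w) ^ 2) * J z w ∂m ∂m) +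
        (Cv * M * Cφ + M * Cφ) * (ENNReal.ofReal (φ s))⁻¹ *
          (∫⁻ z in W.E i, ENNReal.ofReal (f z ^ 2) ∂m +
            ∫⁻ z in W.E j, ENNReal.ofReal (f z ^ 2) ∂m) := by
  obtain ⟨hd1, hd2⟩ := hl.dist_le
  obtain ⟨hd3, hd4⟩ := hl.symm.dist_le
  have hiI : i ∈ W.I := by obtain ⟨x, -, -, h1, -⟩ := hl; exact W.mem_I_of_mem_nbr h1
  have hjI : j ∈ W.I := by obtain ⟨x, -, -, -, h1⟩ := hl; exact W.mem_I_of_mem_nbr h1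
  have hτi := W.τ_pos i hiI
  have hτj := W.τ_pos j hjI
  set V := m (ball i (W.τ i)) with hV
  set Φ := ENNReal.ofReal (φ (W.τ i)) with hΦ
  have hV0 : V ≠ 0 := (measure_ball_pos m i hτi).ne'
  have hVt : V ≠ ∞ := (h.measure_ball_lt_top _ _).ne
  have hΦ0 : Φ ≠ 0 := (ENNReal.ofReal_pos.2 (hφ.pos hτi)).ne'
  have hVi : V ≤ M * m (W.E i) := W.measure_ball_le i hiI
  have hVj : V ≤ Cv * (M * m (W.E j)) := by
    refine (hCv i j (W.τ j) (W.τ i) hτj ?_ (by linarith)).trans ?_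
    · rw [dist_comm]; linarith
    · gcongr; exact W.measure_ball_le j hjI
  rcases le_or_gt (W.τ i) (s / 8) with hi | hi <;> rcases le_or_gt (W.τ j) (s / 8) with hj | hj
  · refine le_trans ?_ le_self_add
    set Y := ENNReal.ofReal ((W.avg f i - W.avg f j) ^ 2) with hY
    have h1 : Y * m (W.E i) * m (W.E j) ≤
        ∫⁻ z in W.E i, ∫⁻ w in W.E j, ENNReal.ofReal ((f z - f w) ^ 2) ∂m ∂m := by
      calc _ ≤ (∫⁻ z in W.E i, ENNReal.ofReal ((f z - W.avg f j) ^ 2) ∂m) * m (W.E j) := by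
            gcongr; exact W.avg_sub_sq_mul_le h hf hf2 hiI hi _
        _ = ∫⁻ z in W.E i, ENNReal.ofReal ((f z - W.avg f j) ^ 2) * m (W.E j) ∂m := by
            rw [lintegral_mul_const _ (by fun_prop)]
        _ ≤ _ := by
            refine lintegral_mono fun z => ?_
            have h2 := W.avg_sub_sq_mul_le h hf hf2 hjI hj (f z)
            simp_rw [← neg_sub (W.avg f j) (f z), neg_sq]
            refine h2.trans_eq (lintegral_congr fun w => ?_)
            rw [← neg_sub, neg_sq]
    -- `V` is at most of the order of `m (W.E i)` and of `m (W.E j)`, and `(V * Φ)⁻¹` is at most of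
    -- the order of `J` between these sets.
    have hc : (V * Φ)⁻¹ ≠ ∞ := ENNReal.inv_ne_top.2 (mul_ne_zero hV0 hΦ0)
    calc Y * (V * Φ⁻¹) = Y * (V * V) * (V * Φ)⁻¹ := by
          rw [ENNReal.mul_inv (Or.inl hV0) (Or.inl hVt)]
          calc Y * (V * Φ⁻¹) = Y * (V * Φ⁻¹) * (V * V⁻¹) := by
                rw [ENNReal.mul_inv_cancel hV0 hVt, mul_one]
            _ = _ := by ring
      _ ≤ Y * ((M * m (W.E i)) * (Cv * (M * m (W.E j)))) * (V * Φ)⁻¹ := by gcongr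
      _ = (Cv * M * M) * (Y * m (W.E i) * m (W.E j) * (V * Φ)⁻¹) := by ring
      _ ≤ (Cv * M * M) * ((∫⁻ z in W.E i, ∫⁻ w in W.E j,
            ENNReal.ofReal ((f z - f w) ^ 2) ∂m ∂m) * (V * Φ)⁻¹) := by gcongr
      _ = (Cv * M * M) * ∫⁻ z in W.E i, ∫⁻ w in W.E j,
            ENNReal.ofReal ((f z - f w) ^ 2) * (V * Φ)⁻¹ ∂m ∂m := by
          rw [← lintegral_mul_const' _ _ hc]
          simp_rw [← lintegral_mul_const' _ _ hc]
      _ ≤ (Cv * M * M) * ∫⁻ z in W.E i, CJ * ∫⁻ w in W.E j,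
            ENNReal.ofReal ((f z - f w) ^ 2) * J z w ∂m ∂m := by
          refine mul_le_mul_right (setLIntegral_mono' (W.measurableSet_E i) fun z hz => ?_) _
          rw [← lintegral_const_mul' _ _ ENNReal.coe_ne_top]
          refine setLIntegral_mono' (W.measurableSet_E j) fun w hw => ?_
          rcases eq_or_ne z w with rfl | hzw
          · simp
          have hz' : dist z i < 49 * W.τ i := (W.E_subset i hz).2
          have hw' : dist w j < 49 * W.τ j := (W.E_subset j hw).2
          have h2 := dist_triangle4_right z w i j
          calc _ ≤ ENNReal.ofReal ((f z - f w) ^ 2) * (CJ * J z w) := by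
                gcongr
                exact hCJ i z w _ hτi hzw (by linarith) (by linarith)
            _ = _ := by ring
      _ = _ := by
          rw [lintegral_const_mul' _ _ ENNReal.coe_ne_top]
          ring
  -- If one of the radii exceeds `s / 8`, the value attached to it is zero, and the other radius is
  -- of order `s`.
  · refine le_trans ?_ le_add_self
    have haj : W.avg f j = 0 := by rw [avg, if_neg (not_le.2 hj)]
    have h1 := W.avg_sub_sq_mul_le h hf hf2 hiI hi 0
    simp only [sub_zero] at h1
    have h2 := hCφ s (W.τ i) hτi hs (by linarith)
    rw [haj, sub_zero]
    calc _ ≤ ENNReal.ofReal (W.avg f i ^ 2) *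
          (M * m (W.E i) * (Cφ * (ENNReal.ofReal (φ s))⁻¹)) := by gcongr
      _ = (M * Cφ) * (ENNReal.ofReal (φ s))⁻¹ *
          (ENNReal.ofReal (W.avg f i ^ 2) * m (W.E i)) := by ring
      _ ≤ _ := by
          gcongr
          · exact le_add_self
          · exact h1.trans le_self_add
  · refine le_trans ?_ le_add_self
    have hai : W.avg f i = 0 := by rw [avg, if_neg (not_le.2 hi)]
    have h1 := W.avg_sub_sq_mul_le h hf hf2 hjI hj 0
    simp only [sub_zero] at h1
    have h2 := hCφ s (W.τ i) hτi hs (by linarith)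
    rw [hai, zero_sub, neg_sq]
    calc _ ≤ ENNReal.ofReal (W.avg f j ^ 2) *
          (Cv * (M * m (W.E j)) * (Cφ * (ENNReal.ofReal (φ s))⁻¹)) := by gcongr
      _ = (Cv * M * Cφ) * (ENNReal.ofReal (φ s))⁻¹ *
          (ENNReal.ofReal (W.avg f j ^ 2) * m (W.E j)) := by ring
      _ ≤ _ := by
          gcongr
          · exact le_self_add
          · exact h1.trans le_add_self
  · have hai : W.avg f i = 0 := by rw [avg, if_neg (not_le.2 hi)]
    have haj : W.avg f j = 0 := by rw [avg, if_neg (not_le.2 hj)]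
    simp [hai, haj]

/-- Summation of the differences of the values at linked Whitney centres. -/
theorem tsum_linkedOsc_le [BorelSpace X] [SecondCountableTopology X]
    [LocallyCompactSpace X] [m.IsOpenPosMeasure] [IsFiniteMeasureOnCompacts m] [SFinite m]
    (hJm : Measurable fun p : X × X => J p.1 p.2)
    (h : VolumeDoubling m) (hφ : IsScaleFunction φ) (hs : 0 < s) {Cv Cφ CJ : ℝ≥0}
    (hCv : ∀ (x y : X) (r R : ℝ), 0 < r → dist x y ≤ 1000 * r → R ≤ 1000 * r →
      m (ball x R) ≤ Cv * m (ball y r))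
    (hCφ : ∀ t r : ℝ, 0 < r → 0 < t → t ≤ 1000 * r →
      (ENNReal.ofReal (φ r))⁻¹ ≤ Cφ * (ENNReal.ofReal (φ t))⁻¹)
    (hCJ : ∀ (x z w : X) (r : ℝ), 0 < r → z ≠ w → dist z w ≤ 1000 * r → dist z x ≤ 1000 * r →
      (m (ball x r) * ENNReal.ofReal (φ r))⁻¹ ≤ CJ * J z w)
    {f : X → ℝ} (hf : Measurable f) (hf2 : ∫⁻ z in D, ENNReal.ofReal (f z ^ 2) ∂m < ∞)
    {A V : Set X} (hAV : ∀ x ∈ A, ∀ z ∈ D, dist x z ≤ 400 * s → z ∈ V) :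
    ∑' i : W.I, W.linkedOsc A f i *
        (m (ball (i : X) (W.τ i)) * (ENNReal.ofReal (φ (W.τ i)))⁻¹) ≤
      (Cv * M * M * CJ) * (M * M) * (∫⁻ z in V, ∫⁻ w in V,
          ENNReal.ofReal ((f z - f w) ^ 2) * J z w ∂m ∂m) +
        (Cv * M * Cφ + M * Cφ) * (ENNReal.ofReal (φ s))⁻¹ *
          (2 * M * M * ∫⁻ z in V, ENNReal.ofReal (f z ^ 2) ∂m) := by
  classical
  have := W.countable.to_subtype
  set F : X → X → ℝ≥0∞ := fun z w => ENNReal.ofReal ((f z - f w) ^ 2) * J z w with hF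
  have hFm : Measurable fun p : X × X => F p.1 p.2 := Measurable.mul (by fun_prop) hJm
  set P : X → ℝ≥0∞ := fun i => ∫⁻ z in W.E i ∩ V, ENNReal.ofReal (f z ^ 2) ∂m with hP
  set c₁ : ℝ≥0∞ := Cv * M * M * CJ with hc₁
  set c₂ : ℝ≥0∞ := (Cv * M * Cφ + M * Cφ) * (ENNReal.ofReal (φ s))⁻¹ with hc₂
  set L : X → X → ℝ≥0∞ := fun i j => if W.Linked A i j then 1 else 0 with hL
  have hPsum : ∑' i : W.I, P i ≤ M * ∫⁻ z in V, ENNReal.ofReal (f z ^ 2) ∂m :=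
    W.tsum_setLIntegral_E_le (by fun_prop)
  have hterm : ∀ i j : W.I, (if W.Linked A i j then
      ENNReal.ofReal ((W.avg f i - W.avg f j) ^ 2) else 0) *
        (m (ball (i : X) (W.τ i)) * (ENNReal.ofReal (φ (W.τ i)))⁻¹) ≤
      c₁ * (∫⁻ z in W.E i ∩ V, ∫⁻ w in W.E j ∩ V, F z w ∂m ∂m) +
        c₂ * (L i j * P i + L i j * P j) := by
    intro i j
    by_cases hl : W.Linked A i j
    · rw [if_pos hl]
      simp only [hL, if_pos hl, one_mul, hP, hl.E_inter_eq hAV, hl.symm.E_inter_eq hAV]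
      exact hl.avg_sub_avg_sq_le h hφ hs hCv hCφ hCJ hf hf2
    · simp [hl]
  have h1 : ∑' i : W.I, ∑' j : W.I, ∫⁻ z in W.E i ∩ V, ∫⁻ w in W.E j ∩ V, F z w ∂m ∂m ≤
      M * M * ∫⁻ z in V, ∫⁻ w in V, F z w ∂m ∂m := by
    have hm1 : ∀ B : Set X, Measurable fun z => ∫⁻ w in B, F z w ∂m := fun B =>
      hFm.lintegral_prod_right' (ν := m.restrict B)
    calc _ ≤ ∑' i : W.I, ∫⁻ z in W.E i ∩ V, M * ∫⁻ w in V, F z w ∂m ∂m := by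
          refine ENNReal.tsum_le_tsum fun i => ?_
          rw [← lintegral_tsum fun j : W.I => (hm1 (W.E j ∩ V)).aemeasurable]
          refine lintegral_mono fun z => ?_
          have hz : Measurable (F z) := hFm.of_uncurry_left
          exact W.tsum_setLIntegral_E_le hz
      _ ≤ M * ∫⁻ z in V, M * ∫⁻ w in V, F z w ∂m ∂m :=
          W.tsum_setLIntegral_E_le (g := fun z => M * ∫⁻ w in V, F z w ∂m) ((hm1 V).const_mul _)
      _ = _ := by rw [lintegral_const_mul _ (hm1 _), mul_assoc]
  have h2 : ∑' i : W.I, ∑' j : W.I, L i j * P i ≤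
      M * M * ∫⁻ z in V, ENNReal.ofReal (f z ^ 2) ∂m := by
    calc _ ≤ ∑' i : W.I, M * P i := by
          refine ENNReal.tsum_le_tsum fun i => ?_
          rw [ENNReal.tsum_mul_right]
          gcongr
          exact W.tsum_linked_le A i.2
      _ ≤ M * (M * ∫⁻ z in V, ENNReal.ofReal (f z ^ 2) ∂m) := by
          rw [ENNReal.tsum_mul_left]; gcongr
      _ = _ := by ring
  have h3 : ∑' i : W.I, ∑' j : W.I, L i j * P j ≤
      M * M * ∫⁻ z in V, ENNReal.ofReal (f z ^ 2) ∂m := by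
    rw [ENNReal.tsum_comm]
    refine le_trans (le_of_eq ?_) h2
    congr 1; ext i; congr 1; ext j
    have : W.Linked A (j : X) (i : X) ↔ W.Linked A (i : X) (j : X) := ⟨Linked.symm, Linked.symm⟩
    simp only [hL, this]
  calc _ = ∑' i : W.I, ∑' j : W.I, (if W.Linked A i j then
      ENNReal.ofReal ((W.avg f i - W.avg f j) ^ 2) else 0) *
        (m (ball (i : X) (W.τ i)) * (ENNReal.ofReal (φ (W.τ i)))⁻¹) := by
        simp_rw [ENNReal.tsum_mul_right]
        congr 1
    _ ≤ ∑' i : W.I, ∑' j : W.I, (c₁ * (∫⁻ z in W.E i ∩ V, ∫⁻ w in W.E j ∩ V, F z w ∂m ∂m) +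
        c₂ * (L i j * P i + L i j * P j)) :=
        ENNReal.tsum_le_tsum fun i => ENNReal.tsum_le_tsum fun j => hterm i j
    _ = c₁ * (∑' i : W.I, ∑' j : W.I, ∫⁻ z in W.E i ∩ V, ∫⁻ w in W.E j ∩ V, F z w ∂m ∂m) +
        c₂ * ((∑' i : W.I, ∑' j : W.I, L i j * P i) + ∑' i : W.I, ∑' j : W.I, L i j * P j) := by
        simp_rw [ENNReal.tsum_add, ENNReal.tsum_mul_left, ENNReal.tsum_add]
    _ ≤ c₁ * (M * M * ∫⁻ z in V, ∫⁻ w in V, F z w ∂m ∂m) +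
        c₂ * (M * M * (∫⁻ z in V, ENNReal.ofReal (f z ^ 2) ∂m) +
          M * M * ∫⁻ z in V, ENNReal.ofReal (f z ^ 2) ∂m) := by gcongr
    _ = _ := by ring

end WhitneySystem

end

/-! ### Energy of the extension against the energy on the set -/

section

variable {X : Type*} [MetricSpace X] [MeasurableSpace X]

namespace WhitneySystem

variable {m : Measure X} {J : X → X → ℝ≥0∞} {φ : ℝ → ℝ} {D : Set X} {s : ℝ} {M : ℝ≥0}
  (W : WhitneySystem m J φ D s M)

/-- The part of the energy of the extension that comes from the increments of the partition of
unity, in terms of the energies of the cut-off functions. -/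
theorem lintegral_tsum_linkedOsc_le [SFinite m] (hJm : Measurable fun p : X × X => J p.1 p.2)
    (A : Set X) (f : X → ℝ) :
    Measurable (fun x => ∫⁻ y, (M * ∑' i : W.I, W.linkedOsc A f i *
      ENNReal.ofReal ((W.ϕ i x - W.ϕ i y) ^ 2)) * J x y ∂m) ∧
    ∫⁻ x, ∫⁻ y, (M * ∑' i : W.I, W.linkedOsc A f i *
      ENNReal.ofReal ((W.ϕ i x - W.ϕ i y) ^ 2)) * J x y ∂m ∂m ≤
      M * M * ∑' i : W.I, W.linkedOsc A f i *
        (m (ball (i : X) (W.τ i)) * (ENNReal.ofReal (φ (W.τ i)))⁻¹) := by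
  have := W.countable.to_subtype
  have hϕ : ∀ i : W.I, Measurable (W.ϕ i) := fun i => (W.cutoff i i.2).measurable
  have hin : ∀ x, ∫⁻ y, (M * ∑' i : W.I, W.linkedOsc A f i *
      ENNReal.ofReal ((W.ϕ i x - W.ϕ i y) ^ 2)) * J x y ∂m =
      ∑' i : W.I, M * W.linkedOsc A f i *
        ∫⁻ y, ENNReal.ofReal ((W.ϕ i x - W.ϕ i y) ^ 2) * J x y ∂m := by
    intro x
    have h1 : ∀ i : W.I, Measurable fun y => ENNReal.ofReal ((W.ϕ i x - W.ϕ i y) ^ 2) * J x y :=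
      fun i => by
        have := hϕ i
        exact Measurable.mul (by fun_prop) hJm.of_uncurry_left
    simp_rw [← lintegral_const_mul _ (h1 _)]
    rw [← lintegral_tsum fun i => ((h1 i).const_mul _).aemeasurable]
    refine lintegral_congr fun y => ?_
    rw [mul_assoc, ← ENNReal.tsum_mul_right, ← ENNReal.tsum_mul_left]
    congr 1; ext i; ring
  have hm : ∀ i : W.I, Measurable fun x =>
      ∫⁻ y, ENNReal.ofReal ((W.ϕ i x - W.ϕ i y) ^ 2) * J x y ∂m := fun i =>
    measurable_carreDuChamp hJm (hϕ i)
  simp_rw [hin]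
  refine ⟨Measurable.tsum fun i => (hm i).const_mul _, ?_⟩
  rw [lintegral_tsum fun i => ((hm i).const_mul _).aemeasurable, ← ENNReal.tsum_mul_left]
  refine ENNReal.tsum_le_tsum fun i => ?_
  rw [lintegral_const_mul _ (hm i)]
  calc _ ≤ M * W.linkedOsc A f i *
        (M * (m (ball (i : X) (W.τ i)) * (ENNReal.ofReal (φ (W.τ i)))⁻¹)) := by
        gcongr; exact W.energy_le i i.2
    _ = _ := by ring

end WhitneySystem

/-- The extension operator is bounded, locally in space, for the `L²` norm and for the energy of
jumps of length less than `s / 4`, up to an `L²` term of the order of `1 / φ(s)`.  Jumps which are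
short compared with the distance to `D` are treated by the increments of the partition of unity.
For the other ones, each of the two end points outside `D` is replaced by points of reflected sets,
which changes the jump kernel by a bounded factor only. -/
theorem exists_energy_ext_le [BorelSpace X] [SecondCountableTopology X]
    [LocallyCompactSpace X] {m : Measure X} [m.IsOpenPosMeasure] [IsFiniteMeasureOnCompacts m]
    [SFinite m] {J : X → X → ℝ≥0∞}
    (hJm : Measurable fun p : X × X => J p.1 p.2) (hJs : ∀ x y, J x y = J y x)
    {φ : ℝ → ℝ} (hφ : IsScaleFunction φ) (h : VolumeDoubling m) (hJ : JumpKernelBounds m J φ)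
    {D : Set X} (hDo : IsOpen D) (hDne : D.Nonempty) (hnull : m (closure D \ D) = 0) (M : ℝ≥0) :
    ∃ C : ℝ≥0, ∀ s : ℝ, 0 < s → ∀ W : WhitneySystem m J φ D s M, ∀ f : X → ℝ, Measurable f →
      ∫⁻ z in D, ENNReal.ofReal (f z ^ 2) ∂m < ∞ → ∀ A V : Set X, MeasurableSet A →
      MeasurableSet V → V ⊆ D → (∀ x ∈ A, ∀ z ∈ D, dist x z ≤ 400 * s → z ∈ V) →
      ∫⁻ x in A, ENNReal.ofReal (W.ext f x ^ 2) ∂m ≤ C * ∫⁻ z in V, ENNReal.ofReal (f z ^ 2) ∂m ∧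
      ∫⁻ x in A, ∫⁻ y in A ∩ ball x (s / 4),
          ENNReal.ofReal ((W.ext f x - W.ext f y) ^ 2) * J x y ∂m ∂m ≤
        C * (∫⁻ z in V, ∫⁻ w in V, ENNReal.ofReal ((f z - f w) ^ 2) * J z w ∂m ∂m +
          (ENNReal.ofReal (φ s))⁻¹ * ∫⁻ z in V, ENNReal.ofReal (f z ^ 2) ∂m) := by
  obtain ⟨Cv, hCv⟩ := h.exists_ball_le 1000
  obtain ⟨Cφ, hCφ⟩ := hφ.exists_inv_le 1000
  obtain ⟨CJ, hCJ⟩ := hJ.exists_inv_le hφ h 1000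
  obtain ⟨K, hK⟩ := hJ.exists_le hφ h 36
  have hCv' : ∀ (x : X) (r : ℝ), 0 < r → m (ball x (12 * r)) ≤ Cv * m (ball x r) := fun x r hr =>
    hCv x x r _ hr (by simp; positivity) (by linarith)
  set CK : ℝ≥0 := 1 + K * Cv * M * M with hCK
  set C₁ : ℝ≥0 := 1 + 1 * Cv * M * M with hC₁
  set c₁ : ℝ≥0 := Cv * M * M * CJ * (M * M)
  set c₂ : ℝ≥0 := (Cv * M * Cφ + M * Cφ) * (2 * M * M)
  refine ⟨C₁ + M * M * (c₁ + c₂) + CK * CK,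
    fun s hs W f hf hf2 A V hA hV hVD hAV => ⟨?_, ?_⟩⟩
  · have := W.lintegral_ext_sub_sq_mul_le h hs hDo hDne hnull hCv' hf hf2 (V := V) hA (t := 0)
      (k := fun _ => 1) measurable_const (K := 1) (fun _ _ => Or.inl rfl) hAV
      (fun x _ z _ _ => by simp)
    simp only [sub_zero, mul_one] at this
    refine this.trans ?_
    gcongr
    rw [hC₁]
    push_cast
    rw [add_assoc]
    exact le_self_add
  have he : Measurable (W.ext f) := W.measurable_ext hDo.measurableSet hf
  set Q := ∫⁻ z in V, ∫⁻ w in V, ENNReal.ofReal ((f z - f w) ^ 2) * J z w ∂m ∂m with hQ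
  set P := ∫⁻ z in V, ENNReal.ofReal (f z ^ 2) ∂m with hP
  set G : X → ℝ≥0∞ := fun x => ∫⁻ y, (M * ∑' i : W.I, W.linkedOsc A f i *
      ENNReal.ofReal ((W.ϕ i x - W.ϕ i y) ^ 2)) * J x y ∂m with hG
  obtain ⟨hGm, hGle⟩ := W.lintegral_tsum_linkedOsc_le hJm A f
  set S : Set X := {x | infDist x D ≤ s} with hS
  have hSm : MeasurableSet S := measurableSet_le (by fun_prop) measurable_const
  set H : X → ℝ≥0∞ := fun x => ∫⁻ z in V, ENNReal.ofReal ((f z - W.ext f x) ^ 2) * J x z ∂m with hH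
  have hHm' : Measurable fun p : X × X => ENNReal.ofReal ((f p.2 - W.ext f p.1) ^ 2) * J p.1 p.2 :=
    Measurable.mul (by fun_prop) hJm
  have hHm : Measurable H := hHm'.lintegral_prod_right' (ν := m.restrict V)
  have hpt : ∀ᵐ x ∂m, x ∈ A → ∫⁻ y in A ∩ ball x (s / 4),
      ENNReal.ofReal ((W.ext f x - W.ext f y) ^ 2) * J x y ∂m ≤
        G x + S.indicator (fun x => CK * H x) x := by
    filter_upwards [W.exists_mem] with x hx hxA
    have hdm : Measurable fun y => dist x y := by fun_prop
    -- `N` holds the jumps that are short compared with the distance to `D`; a jump from `x` to `B`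
    -- is longer, and its end point is integrated out first, by reflection.
    set N : Set X := {y | 4 * dist x y < infDist x D} with hN
    set B : Set X := (A ∩ ball x (s / 4)) ∩ {y | infDist x D ≤ 4 * dist x y} with hB
    have hNm : MeasurableSet N := measurableSet_lt (hdm.const_mul 4) measurable_const
    have hBm : MeasurableSet B := (hA.inter measurableSet_ball).inter
      (measurableSet_le measurable_const (hdm.const_mul 4))
    have hsub : A ∩ ball x (s / 4) ⊆ N ∪ B := fun y hy => by
      rcases lt_or_ge (4 * dist x y) (infDist x D) with h1 | h1
      · exact Or.inl h1
      · exact Or.inr ⟨hy, h1⟩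
    refine (lintegral_mono_set hsub).trans ((lintegral_union_le _ _ _).trans (add_le_add ?_ ?_))
    · refine le_trans ?_ (setLIntegral_le_lintegral N _)
      refine lintegral_mono_ae ((ae_restrict_iff' hNm).2 ?_)
      filter_upwards [W.exists_mem] with y hy hyN
      gcongr
      exact W.ext_sub_ext_sq_le_linkedOsc hs f hxA hyN hx hy
    · rcases B.eq_empty_or_nonempty with h0 | ⟨y₀, hy₀⟩
      · simp [h0]
      have hxS : x ∈ S := by
        have h1 : dist y₀ x < s / 4 := hy₀.1.2
        have h2 : infDist x D ≤ 4 * dist x y₀ := hy₀.2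
        rw [dist_comm] at h1
        change infDist x D ≤ s
        linarith
      rw [indicator_of_mem hxS]
      have hB' : ∀ y ∈ B, infDist y D ≤ 5 * dist x y ∧ dist x y < s / 4 := fun y hy => by
        have h1 : dist y x < s / 4 := hy.1.2
        have h2 : infDist x D ≤ 4 * dist x y := hy.2
        have h3 := infDist_le_infDist_add_dist (s := D) (x := y) (y := x)
        rw [dist_comm] at h1 h3
        exact ⟨by linarith, h1⟩
      have key := W.lintegral_ext_sub_sq_mul_le h hs hDo hDne hnull hCv' hf hf2 (A := B) (V := V)
        hBm (t := W.ext f x) (k := fun y => J x y) hJm.of_uncurry_left (K := K)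
        (fun y hy => Or.inr (by have := hB' y hy; linarith))
        (fun y hy => hAV y hy.1.1)
        (fun y hy z hz hyz => by
          rcases eq_or_ne (f z) (W.ext f x) with heq | hne
          · simp [heq]
          have hxz : x ≠ z := by
            rintro rfl
            exact hne (W.ext_of_mem hz).symm
          have h1 := (hB' y hy).1
          have hxy : x ≠ y := by
            rintro rfl
            rw [dist_self, mul_zero] at h1
            have : dist x z ≤ 0 := by linarith
            exact hxz (dist_le_zero.1 this)
          have h2 := dist_triangle x y z
          calc _ ≤ ENNReal.ofReal ((f z - W.ext f x) ^ 2) * (K * J x z) := by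
                gcongr
                exact hK x y x z hxy hxz (by linarith) (by simp)
            _ = _ := by ring)
      refine le_trans (le_of_eq (lintegral_congr fun y => ?_)) (key.trans_eq ?_)
      · rw [← neg_sub, neg_sq]
      · rw [hCK]; push_cast; rfl
  -- The other end point `x` is now replaced by points of reflected sets, for fixed `z ∈ V`.
  have hfar : ∫⁻ x in A, S.indicator (fun x => CK * H x) x ∂m ≤ CK * CK * Q := by
    rw [lintegral_indicator hSm, Measure.restrict_restrict hSm, lintegral_const_mul _ hHm, hH]
    simp only
    rw [lintegral_lintegral_swap hHm'.aemeasurable, mul_assoc]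
    refine mul_le_mul_right ?_ _
    rw [← lintegral_const_mul' _ _ ENNReal.coe_ne_top]
    refine setLIntegral_mono' hV fun z hz => ?_
    have key := W.lintegral_ext_sub_sq_mul_le h hs hDo hDne hnull hCv' hf hf2 (A := S ∩ A) (V := V)
        (hSm.inter hA) (t := f z) (k := fun x => J x z) hJm.of_uncurry_right (K := K)
        (fun x hx => Or.inr (by have : infDist x D ≤ s := hx.1; linarith))
        (fun x hx => hAV x hx.2)
        (fun x hx w hw hxw => by
          rcases eq_or_ne w z with rfl | hne
          · simp
          have h1 : infDist x D ≤ dist x z := infDist_le_dist_of_mem (hVD hz)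
          have hxz : x ≠ z := by
            rintro rfl
            rw [dist_self] at h1
            have : dist x w ≤ 0 := by linarith
            exact hne (dist_le_zero.1 this).symm
          have h2 := dist_triangle_left w z x
          calc _ ≤ ENNReal.ofReal ((f w - f z) ^ 2) * (K * J w z) := by
                gcongr
                refine hK x z w z hxz hne ?_ ?_
                · linarith [dist_nonneg (x := x) (y := z)]
                · rw [dist_comm]; linarith [dist_nonneg (x := x) (y := z)]
            _ = _ := by ring)
    refine le_trans (le_of_eq (lintegral_congr fun x => ?_)) (key.trans_eq ?_)
    · rw [← neg_sub, neg_sq]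
    · rw [hCK]
      push_cast
      congr 1
      refine lintegral_congr fun w => ?_
      rw [← neg_sub, neg_sq, hJs]
  calc _ ≤ ∫⁻ x in A, (G x + S.indicator (fun x => CK * H x) x) ∂m :=
        lintegral_mono_ae ((ae_restrict_iff' hA).2 hpt)
    _ = ∫⁻ x in A, G x ∂m + ∫⁻ x in A, S.indicator (fun x => CK * H x) x ∂m :=
        lintegral_add_left hGm _
    _ ≤ M * M * (c₁ * Q + c₂ * ((ENNReal.ofReal (φ s))⁻¹ * P)) + CK * CK * Q := by
        refine add_le_add ?_ hfar
        refine (setLIntegral_le_lintegral A _).trans (hGle.trans ?_)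
        refine mul_le_mul_right ?_ _
        refine (W.tsum_linkedOsc_le hJm h hφ hs hCv hCφ hCJ hf hf2 hAV).trans_eq ?_
        simp only [c₁, c₂]
        push_cast
        ring
    _ ≤ M * M * ((c₁ + c₂) * Q + (c₁ + c₂) * ((ENNReal.ofReal (φ s))⁻¹ * P)) +
        CK * CK * (Q + (ENNReal.ofReal (φ s))⁻¹ * P) := by
        gcongr
        · exact le_self_add
        · exact le_add_self
        · exact le_self_add
    _ = (M * M * (c₁ + c₂) + CK * CK) * (Q + (ENNReal.ofReal (φ s))⁻¹ * P) := by ring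
    _ ≤ _ := by
        gcongr
        push_cast
        rw [add_assoc]
        exact le_add_self

end

/-! ### Long jumps and finiteness of the energy -/

section

variable {X : Type*} [MetricSpace X] [MeasurableSpace X]

/-- The energy of the jumps of length at least `t` between points of `B` is controlled by the
`L²` norm on `B`. -/
theorem lintegral_long_jumps_le [BorelSpace X] [SecondCountableTopology X] {m : Measure X}
    [SFinite m] {J : X → X → ℝ≥0∞} (hJm : Measurable fun p : X × X => J p.1 p.2)
    (hJs : ∀ x y, J x y = J y x) {t : ℝ} {b : ℝ≥0∞}
    (hb : ∀ x : X, ∫⁻ y in {y | t ≤ dist x y}, J x y ∂m ≤ b)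
    {u : X → ℝ} (hu : Measurable u) (B : Set X) :
    ∫⁻ x in B, ∫⁻ y in B, {p : X × X | t ≤ dist p.1 p.2}.indicator
        (fun p => ENNReal.ofReal ((u p.1 - u p.2) ^ 2) * J p.1 p.2) (x, y) ∂m ∂m ≤
      4 * b * ∫⁻ x in B, ENNReal.ofReal (u x ^ 2) ∂m := by
  have hSm : MeasurableSet {p : X × X | t ≤ dist p.1 p.2} :=
    measurableSet_le measurable_const (by fun_prop)
  set L : X → X → ℝ≥0∞ := fun x y => {p : X × X | t ≤ dist p.1 p.2}.indicator
    (fun p => J p.1 p.2) (x, y) with hL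
  have hLm : Measurable fun p : X × X => L p.1 p.2 := hJm.indicator hSm
  have hLs : ∀ x y, L x y = L y x := fun x y => by
    simp only [hL, indicator_apply, mem_ofPred_eq, dist_comm x y, hJs x y]
  have hLb : ∀ x, ∫⁻ y in B, L x y ∂m ≤ b := fun x => by
    refine (setLIntegral_le_lintegral _ _).trans (le_trans (le_of_eq ?_) (hb x))
    have hdm : Measurable fun y => dist x y := by fun_prop
    rw [← lintegral_indicator (measurableSet_le measurable_const hdm)]
    rfl
  set v : X → ℝ≥0∞ := fun x => ENNReal.ofReal (u x ^ 2) with hv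
  have hvm : Measurable v := by fun_prop
  have hpt : ∀ x y, {p : X × X | t ≤ dist p.1 p.2}.indicator
        (fun p => ENNReal.ofReal ((u p.1 - u p.2) ^ 2) * J p.1 p.2) (x, y) ≤
      2 * (v x * L x y) + 2 * (v y * L x y) := fun x y => by
    by_cases hxy : (x, y) ∈ {p : X × X | t ≤ dist p.1 p.2}
    · simp only [hL, indicator_of_mem hxy]
      rw [← mul_assoc, ← mul_assoc, ← add_mul]
      gcongr
      rw [hv, ← ENNReal.ofReal_ofNat 2, ← ENNReal.ofReal_mul (by norm_num),
        ← ENNReal.ofReal_mul (by norm_num), ← ENNReal.ofReal_add (by positivity) (by positivity)]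
      apply ENNReal.ofReal_le_ofReal
      nlinarith [sq_nonneg (u x + u y)]
    · rw [indicator_of_notMem hxy]; exact zero_le
  have hm1 : Measurable fun p : X × X => v p.1 * L p.1 p.2 := (hvm.comp measurable_fst).mul hLm
  have hm2 : Measurable fun p : X × X => v p.2 * L p.1 p.2 := (hvm.comp measurable_snd).mul hLm
  have h1 : ∫⁻ x in B, ∫⁻ y in B, v x * L x y ∂m ∂m ≤ b * ∫⁻ x in B, v x ∂m := by
    rw [← lintegral_const_mul _ hvm]
    refine lintegral_mono fun x => ?_
    rw [lintegral_const_mul _ hLm.of_uncurry_left, mul_comm]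
    gcongr
    exact hLb x
  have h2 : ∫⁻ x in B, ∫⁻ y in B, v y * L x y ∂m ∂m ≤ b * ∫⁻ x in B, v x ∂m := by
    rw [lintegral_lintegral_swap hm2.aemeasurable]
    refine le_trans (le_of_eq ?_) h1
    simp_rw [hLs]
  calc _ ≤ ∫⁻ x in B, ∫⁻ y in B, (2 * (v x * L x y) + 2 * (v y * L x y)) ∂m ∂m :=
        lintegral_mono fun x => lintegral_mono fun y => hpt x y
    _ = 2 * (∫⁻ x in B, ∫⁻ y in B, v x * L x y ∂m ∂m) +
        2 * ∫⁻ x in B, ∫⁻ y in B, v y * L x y ∂m ∂m := by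
        have e1 : ∀ x, ∫⁻ y in B, (2 * (v x * L x y) + 2 * (v y * L x y)) ∂m =
            2 * (∫⁻ y in B, v x * L x y ∂m) + 2 * ∫⁻ y in B, v y * L x y ∂m := fun x => by
          have hx : Measurable (L x) := hLm.of_uncurry_left
          have hvx : Measurable fun y => v y * L x y := hvm.mul hx
          rw [lintegral_add_left ((hx.const_mul _).const_mul 2),
            lintegral_const_mul _ (hx.const_mul _), lintegral_const_mul _ hvx]
        have hm3 : Measurable fun x => ∫⁻ y in B, v x * L x y ∂m :=
          hm1.lintegral_prod_right' (ν := m.restrict B)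
        have hm4 : Measurable fun x => ∫⁻ y in B, v y * L x y ∂m :=
          hm2.lintegral_prod_right' (ν := m.restrict B)
        simp_rw [e1]
        rw [lintegral_add_left (hm3.const_mul 2), lintegral_const_mul _ hm3,
          lintegral_const_mul _ hm4]
    _ ≤ 2 * (b * ∫⁻ x in B, v x ∂m) + 2 * (b * ∫⁻ x in B, v x ∂m) := by gcongr
    _ = _ := by ring

/-- Splitting the energy of a function between `U` and `U'` into the contributions of short and of
long jumps. -/
theorem lintegral_energy_le_short_add_long [BorelSpace X] [SecondCountableTopology X]
    {m : Measure X} [SFinite m] {J : X → X → ℝ≥0∞}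
    (hJm : Measurable fun p : X × X => J p.1 p.2)
    (hJs : ∀ x y, J x y = J y x) {t : ℝ} {b : ℝ≥0∞}
    (hb : ∀ x : X, ∫⁻ y in {y | t ≤ dist x y}, J x y ∂m ≤ b)
    {u : X → ℝ} (hu : Measurable u) {U U' A B : Set X} (hUA : U ⊆ A) (hUB : U ⊆ B)
    (hU'B : U' ⊆ B) (hU : MeasurableSet U)
    (hnear : ∀ x ∈ U, ∀ y ∈ U', dist y x < t → y ∈ A) :
    ∫⁻ x in U, ∫⁻ y in U', ENNReal.ofReal ((u x - u y) ^ 2) * J x y ∂m ∂m ≤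
      ∫⁻ x in A, ∫⁻ y in A ∩ ball x t, ENNReal.ofReal ((u x - u y) ^ 2) * J x y ∂m ∂m +
        4 * b * ∫⁻ x in B, ENNReal.ofReal (u x ^ 2) ∂m := by
  have hSm : MeasurableSet {p : X × X | t ≤ dist p.1 p.2} :=
    measurableSet_le measurable_const (by fun_prop)
  set F : X × X → ℝ≥0∞ := fun p => {p : X × X | t ≤ dist p.1 p.2}.indicator
        (fun p => ENNReal.ofReal ((u p.1 - u p.2) ^ 2) * J p.1 p.2) p with hF
  have hFm : Measurable F := Measurable.indicator (Measurable.mul (by fun_prop) hJm) hSm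
  have hFm' : Measurable fun x => ∫⁻ y in B, F (x, y) ∂m :=
    hFm.lintegral_prod_right' (ν := m.restrict B)
  refine le_trans ?_ (add_le_add le_rfl (lintegral_long_jumps_le hJm hJs hb hu B))
  calc _ ≤ ∫⁻ x in U, ((∫⁻ y in A ∩ ball x t, ENNReal.ofReal ((u x - u y) ^ 2) * J x y ∂m) +
        ∫⁻ y in B, F (x, y) ∂m) ∂m := by
        refine setLIntegral_mono' hU fun x hx => ?_
        have hdm : Measurable fun y => dist x y := by fun_prop
        have hsub : U' ⊆ (A ∩ ball x t) ∪ ({y | t ≤ dist x y} ∩ U') := fun y hy => by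
          rcases lt_or_ge (dist y x) t with h | h
          · exact Or.inl ⟨hnear x hx y hy h, h⟩
          · exact Or.inr ⟨by rwa [mem_ofPred_eq, dist_comm], hy⟩
        refine (lintegral_mono_set hsub).trans ((lintegral_union_le _ _ _).trans ?_)
        refine add_le_add le_rfl ?_
        have hTm : MeasurableSet {y | t ≤ dist x y} := measurableSet_le measurable_const hdm
        rw [← Measure.restrict_restrict hTm, ← lintegral_indicator hTm]
        exact lintegral_mono_set hU'B
    _ = ∫⁻ x in U, (∫⁻ y in A ∩ ball x t, ENNReal.ofReal ((u x - u y) ^ 2) * J x y ∂m) ∂m +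
        ∫⁻ x in U, ∫⁻ y in B, F (x, y) ∂m ∂m := lintegral_add_right _ hFm'
    _ ≤ _ := add_le_add (lintegral_mono_set hUA) (lintegral_mono_set hUB)

/-- Membership in the form domain, for a measurable function, in terms of iterated integrals. -/
theorem mem_formDomain_of_lt_top {X : Type*} [MeasurableSpace X] {m : Measure X} [SFinite m]
    {J : X → X → ℝ≥0∞}
    (hJm : Measurable fun p : X × X => J p.1 p.2) {u : X → ℝ} (hu : Measurable u)
    (h2 : ∫⁻ x, ENNReal.ofReal (u x ^ 2) ∂m < ∞)
    (hE : ∫⁻ x, ∫⁻ y, ENNReal.ofReal ((u x - u y) ^ 2) * J x y ∂m ∂m < ∞) :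
    u ∈ formDomain m J := by
  refine ⟨(memLp_two_iff_integrable_sq hu.aestronglyMeasurable).2
    ⟨(hu.pow_const 2).aestronglyMeasurable, ?_⟩, ?_⟩
  · rwa [hasFiniteIntegral_iff_ofReal (ae_of_all _ fun _ => sq_nonneg _)]
  · rwa [lintegral_sq_sub_jumpMeasure hJm hu]

end

/-! ### Restriction of the cut-off functions -/

section

variable {X : Type*} [MetricSpace X] [MeasurableSpace X]

/-- The cut-off Sobolev inequality for the restriction to `D` of the form, expressed by integrals
over `D`.  The cut-off function is the one that `CSJ(φ)` on `X` provides for the extension of `f`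
and for a slightly smaller annulus, so that only values of `f` in the original annulus enter. -/
theorem CSJ.exists_cutoff_restrict [BorelSpace X] [LocallyCompactSpace X]
    [SecondCountableTopology X]
    {m : Measure X} [m.IsOpenPosMeasure] [IsFiniteMeasureOnCompacts m] [SFinite m]
    {J : X → X → ℝ≥0∞} (hJm : Measurable fun p : X × X => J p.1 p.2)
    (hJs : ∀ x y, J x y = J y x)
    {φ : ℝ → ℝ} (hc : CSJ m J φ) (hφ : IsScaleFunction φ) (h : VolumeDoubling m)
    (hJ : JumpKernelBounds m J φ) {D : Set X} (hD : AhlforsRegular m D) (hDo : IsOpen D)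
    (hDne : D.Nonempty) :
    ∃ c : ℝ, 0 < c ∧ c ≤ 1 ∧ ∃ C₁ C₂ : ℝ≥0, ∀ r R : ℝ, 0 < r → r ≤ R →
      ENNReal.ofReal R < ENNReal.ofReal c * ediam D →
      ∀ᵐ x₀ ∂m, ∀ f : X → ℝ, Measurable f → ∫⁻ x in D, ENNReal.ofReal (f x ^ 2) ∂m < ∞ →
        ∫⁻ x in D, ∫⁻ y in D, ENNReal.ofReal ((f x - f y) ^ 2) * J x y ∂m ∂m < ∞ →
        ∃ ϕ ∈ formDomain m J, IsCutoff ϕ (ball x₀ R) (ball x₀ (R + r)) ∧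
          ∫⁻ x in ball x₀ (R + 2 * r) ∩ D, ENNReal.ofReal (f x ^ 2) *
            ∫⁻ y in D, ENNReal.ofReal ((ϕ x - ϕ y) ^ 2) * J x y ∂m ∂m ≤
          C₁ * ∫⁻ x in (ball x₀ (R + r) \ ball x₀ R) ∩ D,
              ∫⁻ y in (ball x₀ (R + r) \ ball x₀ R) ∩ D,
                ENNReal.ofReal ((f x - f y) ^ 2) * J x y ∂m ∂m +
          C₂ * (ENNReal.ofReal (φ r))⁻¹ *
            ∫⁻ x in ball x₀ (R + 2 * r) ∩ D, ENNReal.ofReal (f x ^ 2) ∂m := by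
  obtain ⟨cw, hcw, M, hW⟩ := hD.exists_whitneySystem hJm hJs hc hφ h hJ hDo
  have hnull := hD.measure_closure_diff h hDo
  obtain ⟨Ct, hCt⟩ := hJ.exists_tail_le hφ h
  obtain ⟨Ce, hCe⟩ := exists_energy_ext_le hJm hJs hφ h hJ hDo hDne hnull M
  obtain ⟨cc, C₀, C₁, C₂, hcc0, hcc1, hC₀, hC₀1, hC₁, hC₂, hcsj⟩ := hc
  -- `φ` is compared at `r` with its values at `s / 4 = r / 25600` and at `C₀ r / 2`.
  obtain ⟨Cφ, hCφ⟩ := hφ.exists_inv_le (25600 + 2 / C₀)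
  refine ⟨min (cc / 2) (min cw 1), by positivity, (min_le_right _ _).trans (min_le_right _ _),
    C₁.toNNReal * Ce, C₁.toNNReal * (Ce * Cφ + 4 * (Ct * Cφ) * Ce) +
      C₂.toNNReal * Cφ * Ce + Ct * Cφ, fun r R hr hrR hRD => ?_⟩
  have hC₀2 : 0 < 2 / C₀ := by positivity
  -- The reflection moves points by at most `400 s = r / 16`, which is less than the gap of `r / 8`
  -- between the annuli below.
  set s : ℝ := r / 6400 with hs_def
  have hs : 0 < s := by positivity
  have hsD : ENNReal.ofReal s < ENNReal.ofReal cw * ediam D := by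
    refine (ENNReal.ofReal_le_ofReal (by linarith : s ≤ R)).trans_lt (hRD.trans_le ?_)
    gcongr
    exact (min_le_right _ _).trans (min_le_left _ _)
  obtain ⟨W⟩ := hW s hs hsD
  have hRX : ENNReal.ofReal (R + r / 4) < ENNReal.ofReal cc * ediam (univ : Set X) := by
    have e2 : ENNReal.ofReal cc = 2 * ENNReal.ofReal (cc / 2) := by
      rw [← ENNReal.ofReal_ofNat 2, ← ENNReal.ofReal_mul (by norm_num)]; congr 1; ring
    calc ENNReal.ofReal (R + r / 4) ≤ ENNReal.ofReal (2 * R) :=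
          ENNReal.ofReal_le_ofReal (by linarith)
      _ = 2 * ENNReal.ofReal R := by rw [ENNReal.ofReal_mul (by norm_num), ENNReal.ofReal_ofNat]
      _ < 2 * (ENNReal.ofReal (min (cc / 2) (min cw 1)) * ediam D) :=
          ENNReal.mul_lt_mul_right (by norm_num) (by norm_num) hRD
      _ ≤ 2 * (ENNReal.ofReal (cc / 2) * ediam (univ : Set X)) := by
          gcongr
          · exact min_le_left _ _
          · exact subset_univ _
      _ = _ := by rw [e2, mul_assoc]
  filter_upwards [hcsj (r / 2) (R + r / 4) (by positivity) (by linarith) hRX] with x₀ hx₀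
    f hf hf2 hfE
  -- The bounds for the extension are first used on the whole space, to see that `g ∈ 𝓕`, and then
  -- near the annulus.
  set g := W.ext f with hg
  have hgm : Measurable g := W.measurable_ext hDo.measurableSet hf
  obtain ⟨hg2, hgE⟩ := hCe s hs W f hf hf2 univ D MeasurableSet.univ hDo.measurableSet le_rfl
    (fun _ _ z hz _ => hz)
  have htail : ∀ x : X, ∫⁻ y in {y | s / 4 ≤ dist x y}, J x y ∂m ≤
      Ct * (ENNReal.ofReal (φ (s / 4)))⁻¹ := fun x => hCt x _ (by positivity)
  have hφinv : ∀ t : ℝ, 0 < t → (ENNReal.ofReal (φ t))⁻¹ ≠ ∞ := fun t ht =>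
    ENNReal.inv_ne_top.2 (ENNReal.ofReal_pos.2 (hφ.pos ht)).ne'
  have hgF : g ∈ formDomain m J := by
    simp only [Measure.restrict_univ] at hg2
    have hg2' := hg2.trans_lt (ENNReal.mul_lt_top ENNReal.coe_lt_top hf2)
    refine mem_formDomain_of_lt_top hJm hgm hg2' ?_
    have := lintegral_energy_le_short_add_long hJm hJs htail hgm (U := univ) (U' := univ)
      (A := univ) (B := univ) le_rfl le_rfl le_rfl MeasurableSet.univ (fun _ _ _ _ _ => mem_univ _)
    simp only [Measure.restrict_univ] at this hgE
    refine this.trans_lt (ENNReal.add_lt_top.2 ⟨hgE.trans_lt ?_, ?_⟩)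
    · exact ENNReal.mul_lt_top ENNReal.coe_lt_top (ENNReal.add_lt_top.2
        ⟨hfE, ENNReal.mul_lt_top (hφinv s hs).lt_top hf2⟩)
    · exact ENNReal.mul_lt_top (ENNReal.mul_lt_top (by simp) (ENNReal.mul_lt_top
        ENNReal.coe_lt_top (hφinv _ (by positivity)).lt_top)) hg2'
  obtain ⟨ϕ, hϕF, hϕ, hineq⟩ := hx₀ g hgF
  have hϕm := hϕ.measurable
  set R' : ℝ := R + r / 4 with hR'
  set B' := ball x₀ (R' + (1 + C₀) * (r / 2)) with hB'
  set U' := ball x₀ (R' + r / 2) \ ball x₀ R' with hU'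
  set U'' := B' \ ball x₀ (R' - C₀ * (r / 2)) with hU''
  set U := (ball x₀ (R + r) \ ball x₀ R) ∩ D with hU
  set B := ball x₀ (R + 2 * r) ∩ D with hB
  set Q := ∫⁻ x in U, ∫⁻ y in U, ENNReal.ofReal ((f x - f y) ^ 2) * J x y ∂m ∂m with hQ
  set P := ∫⁻ x in B, ENNReal.ofReal (f x ^ 2) ∂m with hP
  have hUB : U ⊆ B := inter_subset_inter_left _
    (sdiff_subset.trans (ball_subset_ball (by linarith)))
  have hUm : MeasurableSet U := (measurableSet_ball.diff measurableSet_ball).inter hDo.measurableSet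
  have hBm : MeasurableSet B := measurableSet_ball.inter hDo.measurableSet
  have hU'm : MeasurableSet U' := measurableSet_ball.diff measurableSet_ball
  have hU''m : MeasurableSet U'' := measurableSet_ball.diff measurableSet_ball
  have hB'le : R' + (1 + C₀) * (r / 2) ≤ R + 5 / 4 * r := by rw [hR']; nlinarith
  have hgB' : ∫⁻ x in B', ENNReal.ofReal (g x ^ 2) ∂m ≤ Ce * P := by
    refine (hCe s hs W f hf hf2 B' B measurableSet_ball hBm inter_subset_right ?_).1
    intro x hx z hz hxz
    have h1 : dist x x₀ < R' + (1 + C₀) * (r / 2) := hx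
    refine ⟨?_, hz⟩
    have h2 := dist_triangle_left z x₀ x
    rw [mem_ball]
    linarith
  have hgU : ∫⁻ p in U' ×ˢ U'', ENNReal.ofReal ((g p.1 - g p.2) ^ 2) ∂(jumpMeasure m J) ≤
      Ce * (Q + (ENNReal.ofReal (φ s))⁻¹ * P) +
        4 * (Ct * (ENNReal.ofReal (φ (s / 4)))⁻¹) * (Ce * P) := by
    rw [setLIntegral_jumpMeasure hJm (by fun_prop) hU'm hU''m]
    -- The annulus `A` contains the end points of all jumps from `U'` of length less than `s / 4`.
    set A := ball x₀ (R + 7 / 8 * r) \ ball x₀ (R + r / 8) with hA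
    have hU'B' : U' ⊆ B' := sdiff_subset.trans (ball_subset_ball (by nlinarith))
    have h1 := lintegral_energy_le_short_add_long hJm hJs htail hgm (U := U') (U' := U'')
      (A := A) (B := B') (sdiff_subset_sdiff (ball_subset_ball (by linarith))
        (ball_subset_ball (by linarith))) hU'B' sdiff_subset hU'm (by
        intro x hx y _ hyx
        have h1 : dist x x₀ < R' + r / 2 := hx.1
        have h2 : R' ≤ dist x x₀ := by simpa using hx.2
        have h3 := dist_triangle y x x₀
        have h4 := dist_triangle_left x x₀ y
        refine ⟨?_, ?_⟩
        · rw [mem_ball]; linarith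
        · rw [mem_ball, not_lt]; linarith)
    refine h1.trans (add_le_add ?_ (by gcongr))
    refine (hCe s hs W f hf hf2 A U (measurableSet_ball.diff measurableSet_ball) hUm
      inter_subset_right ?_).2.trans ?_
    · intro x hx z hz hxz
      have h1 : dist x x₀ < R + 7 / 8 * r := hx.1
      have h2 : R + r / 8 ≤ dist x x₀ := by simpa using hx.2
      have h3 := dist_triangle_left z x₀ x
      have h4 := dist_triangle x z x₀
      refine ⟨⟨?_, ?_⟩, hz⟩
      · rw [mem_ball]; linarith
      · rw [mem_ball, not_lt]; linarith
    · gcongr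
      exact lintegral_mono_set hUB
  have hin : ∫⁻ x in B ∩ B', ENNReal.ofReal (f x ^ 2) *
      ∫⁻ y in D, ENNReal.ofReal ((ϕ x - ϕ y) ^ 2) * J x y ∂m ∂m ≤
      ∫⁻ x in B', ENNReal.ofReal (g x ^ 2) ∂(energyMeasure m J ϕ) := by
    rw [setLIntegral_energyMeasure hJm hϕm (by fun_prop) measurableSet_ball]
    refine le_trans (setLIntegral_mono' (hBm.inter measurableSet_ball) fun x hx => ?_)
      (lintegral_mono_set inter_subset_right)
    rw [hg, W.ext_of_mem hx.1.2]
    gcongr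
    exact Measure.restrict_le_self
  -- Off `B'` the cut-off function vanishes, and the support is at distance at least `C₀ r / 2`.
  have hout : ∫⁻ x in B \ B', ENNReal.ofReal (f x ^ 2) *
      ∫⁻ y in D, ENNReal.ofReal ((ϕ x - ϕ y) ^ 2) * J x y ∂m ∂m ≤
      (Ct * (ENNReal.ofReal (φ (C₀ * (r / 2))))⁻¹) * P := by
    rw [hP, ← lintegral_const_mul _ (by fun_prop)]
    refine le_trans (setLIntegral_mono' (hBm.diff measurableSet_ball) fun x hx => ?_)
      (lintegral_mono_set sdiff_subset)
    rw [mul_comm]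
    gcongr
    refine le_trans ?_ (hCt x (C₀ * (r / 2)) (by positivity))
    have hdm : Measurable fun y => dist x y := by fun_prop
    have hTm : MeasurableSet {y | C₀ * (r / 2) ≤ dist x y} := measurableSet_le measurable_const hdm
    refine (setLIntegral_le_lintegral _ _).trans ?_
    rw [← lintegral_indicator hTm]
    refine lintegral_mono fun y => ?_
    have hx1 : R' + (1 + C₀) * (r / 2) ≤ dist x x₀ := by simpa [hB'] using hx.2
    have hϕx : ϕ x = 0 := isCutoff_eq_zero_of_le_dist hϕ (by nlinarith)
    by_cases hy : R' + r / 2 ≤ dist y x₀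
    · simp [hϕx, isCutoff_eq_zero_of_le_dist hϕ hy]
    · have h3 := dist_triangle x y x₀
      rw [indicator_of_mem (by rw [mem_ofPred_eq]; linarith)]
      refine mul_le_of_le_one_left zero_le ?_
      rw [ENNReal.ofReal_le_one, hϕx]
      have h0 := hϕ.nonneg y
      have h1 := hϕ.le_one y
      nlinarith
  refine ⟨ϕ, hϕF, ⟨hϕm, hϕ.nonneg, hϕ.le_one, fun x hx => hϕ.eq_one x
    (ball_subset_ball (by linarith) hx), fun x hx => hϕ.eq_zero x fun h =>
    hx (ball_subset_ball (by linarith) h)⟩, ?_⟩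
  have i1 : (ENNReal.ofReal (φ s))⁻¹ ≤ Cφ * (ENNReal.ofReal (φ r))⁻¹ :=
    hCφ r s hs hr (by nlinarith)
  have i2 : (ENNReal.ofReal (φ (s / 4)))⁻¹ ≤ Cφ * (ENNReal.ofReal (φ r))⁻¹ :=
    hCφ r (s / 4) (by positivity) hr (by nlinarith)
  have i3 : (ENNReal.ofReal (φ (r / 2)))⁻¹ ≤ Cφ * (ENNReal.ofReal (φ r))⁻¹ :=
    hCφ r (r / 2) (by positivity) hr (by nlinarith)
  have i4 : (ENNReal.ofReal (φ (C₀ * (r / 2))))⁻¹ ≤ Cφ * (ENNReal.ofReal (φ r))⁻¹ := by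
    refine hCφ r (C₀ * (r / 2)) (by positivity) hr ?_
    have e1 : (25600 + 2 / C₀) * (C₀ * (r / 2)) = 25600 * (C₀ * (r / 2)) + r := by
      field_simp
    rw [e1]
    have : 0 < C₀ * (r / 2) := by positivity
    linarith
  have i5 : ENNReal.ofReal (C₂ / φ (r / 2)) = ENNReal.ofReal C₂ * (ENNReal.ofReal (φ (r / 2)))⁻¹ := by
    rw [ENNReal.ofReal_div_of_pos (hφ.pos (by positivity)), div_eq_mul_inv]
  rw [i5] at hineq
  calc _ = ∫⁻ x in B ∩ B', ENNReal.ofReal (f x ^ 2) *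
          ∫⁻ y in D, ENNReal.ofReal ((ϕ x - ϕ y) ^ 2) * J x y ∂m ∂m +
        ∫⁻ x in B \ B', ENNReal.ofReal (f x ^ 2) *
          ∫⁻ y in D, ENNReal.ofReal ((ϕ x - ϕ y) ^ 2) * J x y ∂m ∂m :=
        (lintegral_inter_add_sdiff _ B measurableSet_ball).symm
    _ ≤ _ := add_le_add (hin.trans hineq) hout
    _ ≤ ENNReal.ofReal C₁ * (Ce * (Q + (Cφ * (ENNReal.ofReal (φ r))⁻¹) * P) +
          4 * (Ct * (Cφ * (ENNReal.ofReal (φ r))⁻¹)) * (Ce * P)) +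
        ENNReal.ofReal C₂ * (Cφ * (ENNReal.ofReal (φ r))⁻¹) * (Ce * P) +
        (Ct * (Cφ * (ENNReal.ofReal (φ r))⁻¹)) * P := by
        gcongr
        exact hgU.trans (by gcongr)
    _ = _ := by
        simp only [ENNReal.ofReal]
        push_cast
        ring

end

/-! ### Transfer to the closure -/

section

section Congr

variable {Y : Type*} [MeasurableSpace Y]

theorem ae_jumpMeasure_of_ae_eq {m : Measure Y} [SFinite m] {J : Y → Y → ℝ≥0∞} {f g : Y → ℝ}
    (h : f =ᵐ[m] g) :
    ∀ᵐ p ∂(jumpMeasure m J), ENNReal.ofReal ((f p.1 - f p.2) ^ 2) =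
      ENNReal.ofReal ((g p.1 - g p.2) ^ 2) := by
  apply (withDensity_absolutelyContinuous (m.prod m) _).ae_le
  filter_upwards [Measure.quasiMeasurePreserving_fst.ae_eq_comp h,
    Measure.quasiMeasurePreserving_snd.ae_eq_comp h] with p h1 h2
  simp only [Function.comp_apply] at h1 h2
  rw [h1, h2]

end Congr

theorem IsCutoff.comp_val {X : Type*} [MetricSpace X] [MeasurableSpace X] {ϕ : X → ℝ}
    {D : Set X} {x₀ : closure D} {r R : ℝ}
    (h : IsCutoff ϕ (ball (x₀ : X) r) (ball (x₀ : X) R)) :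
    IsCutoff (fun x : closure D => ϕ x) (ball x₀ r) (ball x₀ R) where
  measurable := h.measurable.comp measurable_subtype_coe
  nonneg x := h.nonneg x
  le_one x := h.le_one x
  eq_one x hx := h.eq_one x hx
  eq_zero x hx := h.eq_zero x hx

variable {X : Type*} [MetricSpace X] [MeasurableSpace X] [BorelSpace X]

theorem sigmaFinite_reflectedMeasure (m : Measure X) [SigmaFinite m] (D : Set X) :
    SigmaFinite (reflectedMeasure m D) :=
  SigmaFinite.of_map _ measurable_subtype_coe.aemeasurable
    (by rw [map_reflectedMeasure]; infer_instance)

theorem ae_reflectedMeasure {m : Measure X} (D : Set X) {p : X → Prop} (h : ∀ᵐ x ∂m, p x) :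
    ∀ᵐ x : closure D ∂(reflectedMeasure m D), p x := by
  refine ae_of_ae_map measurable_subtype_coe.aemeasurable ?_
  rw [map_reflectedMeasure]
  exact ae_restrict_of_ae h

/-- Integrals over the closure of `D` with respect to `m₀` are integrals over `D`.  No measurability
is needed, the inclusion of the closure being a measurable embedding. -/
theorem setLIntegral_reflectedMeasure (m : Measure X) (D B : Set X)
    (G : X → ℝ≥0∞) :
    ∫⁻ x in Subtype.val ⁻¹' B, G (x : closure D) ∂(reflectedMeasure m D) =
      ∫⁻ x in B, G x ∂(m.restrict D) := by
  have he : MeasurableEmbedding (Subtype.val : closure D → X) :=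
    MeasurableEmbedding.subtype_coe isClosed_closure.measurableSet
  rw [← map_reflectedMeasure m D, he.restrict_map, he.lintegral_map]

theorem lintegral_reflectedMeasure (m : Measure X) (D : Set X) (G : X → ℝ≥0∞) :
    ∫⁻ x, G (x : closure D) ∂(reflectedMeasure m D) = ∫⁻ x in D, G x ∂m := by
  simpa using setLIntegral_reflectedMeasure m D univ G

theorem comp_val_mem_formDomain {m : Measure X} [SigmaFinite m] {J : X → X → ℝ≥0∞}
    (hJm : Measurable fun p : X × X => J p.1 p.2) {D : Set X} (hD : MeasurableSet D) {u : X → ℝ}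
    (hu : u ∈ formDomain m J) (hum : Measurable u) :
    (fun x : closure D => u x) ∈ formDomain (reflectedMeasure m D) (reflectedKernel J D) := by
  refine ⟨?_, ?_⟩
  · have h1 : MemLp u 2 ((reflectedMeasure m D).map Subtype.val) := by
      rw [map_reflectedMeasure]; exact hu.1.restrict D
    exact h1.comp_of_map measurable_subtype_coe.aemeasurable
  · have hp : Measurable (Prod.map (Subtype.val : closure D → X) (Subtype.val : closure D → X)) :=
      measurable_subtype_coe.prodMap measurable_subtype_coe
    have h1 := lintegral_map (μ := jumpMeasure (reflectedMeasure m D) (reflectedKernel J D))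
      (f := fun p : X × X => ENNReal.ofReal ((u p.1 - u p.2) ^ 2)) (by fun_prop) hp
    rw [map_jumpMeasure_reflected m J hJm D hD] at h1
    exact h1.symm.trans_lt ((setLIntegral_le_lintegral _ _).trans_lt hu.2)

/-- The cut-off Sobolev inequality passes from `X` to the closure of `D`; it involves the
functions on the closure only through their restrictions to `D`, which carries `m₀`. -/
theorem CSJ.reflected [LocallyCompactSpace X] [SecondCountableTopology X] {m : Measure X}
    [IsFiniteMeasureOnCompacts m] [m.IsOpenPosMeasure]
    {J : X → X → ℝ≥0∞} {φ : ℝ → ℝ} (h_csj : CSJ m J φ)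
    (hJ_meas : Measurable fun p : X × X => J p.1 p.2)
    (hJ_symm : ∀ x y : X, J x y = J y x) (hφ : IsScaleFunction φ) (h_vd : VolumeDoubling m)
    (hJφ : JumpKernelBounds m J φ) {D : Set X} (hD_open : IsOpen D) (hD : AhlforsRegular m D) :
    CSJ (reflectedMeasure m D) (reflectedKernel J D) φ := by
  have := sigmaFinite_reflectedMeasure m D
  have hDm := hD_open.measurableSet
  have hediam : Metric.ediam (univ : Set (closure D)) = Metric.ediam D := by
    rw [← isometry_subtype_coe.ediam_range, Subtype.range_coe, Metric.ediam_closure]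
  -- For empty `D` no radius satisfies `R < c diam`.
  rcases D.eq_empty_or_nonempty with hDe | hDne
  · refine ⟨1, 1, 1, 1, by norm_num, le_rfl, by norm_num, le_rfl, by norm_num, by norm_num,
      fun r R _ _ hR => ?_⟩
    rw [hediam, hDe] at hR
    simp at hR
  obtain ⟨c, hc0, hc1, C₁, C₂, key⟩ := h_csj.exists_cutoff_restrict hJ_meas hJ_symm hφ h_vd hJφ
    hD hD_open hDne
  refine ⟨c, 1, C₁ + 1, C₂ + 1, hc0, hc1, one_pos, le_rfl, by positivity, by positivity,
    fun r R hr hrR hR => ?_⟩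
  rw [hediam] at hR
  filter_upwards [ae_reflectedMeasure D (key r R hr hrR hR)] with x₀ hx₀ f hf
  have he : MeasurableEmbedding (Subtype.val : closure D → X) :=
    MeasurableEmbedding.subtype_coe isClosed_closure.measurableSet
  set f' := hf.1.1.mk f with hf'
  have hf'm : Measurable f' := hf.1.1.stronglyMeasurable_mk.measurable
  have hff' : f =ᵐ[reflectedMeasure m D] f' := hf.1.1.ae_eq_mk
  -- `CSJ.exists_cutoff_restrict` takes measurable functions on `X`; `F` represents the class of `f`.
  set F : X → ℝ := Function.extend Subtype.val f' 0 with hF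
  have hFm : Measurable F := he.measurable_extend hf'm measurable_const
  have hFf : ∀ x : closure D, F x = f' x := fun x => Subtype.val_injective.extend_apply _ _ _
  have hJr : Measurable fun p : closure D × closure D => reflectedKernel J D p.1 p.2 :=
    hJ_meas.comp (measurable_subtype_coe.prodMap measurable_subtype_coe)
  have hjump : ∀ A B : Set X, MeasurableSet A → MeasurableSet B →
      ∫⁻ p in (Subtype.val ⁻¹' A) ×ˢ (Subtype.val ⁻¹' B), ENNReal.ofReal ((f p.1 - f p.2) ^ 2)
        ∂(jumpMeasure (reflectedMeasure m D) (reflectedKernel J D)) =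
      ∫⁻ x in A ∩ D, ∫⁻ y in B ∩ D, ENNReal.ofReal ((F x - F y) ^ 2) * J x y ∂m ∂m := by
    intro A B hA hB
    rw [lintegral_congr_ae (ae_restrict_of_ae (ae_jumpMeasure_of_ae_eq hff')),
      setLIntegral_jumpMeasure hJr (by fun_prop) (measurable_subtype_coe hA)
        (measurable_subtype_coe hB), ← Measure.restrict_restrict hA, ← Measure.restrict_restrict hB,
      ← setLIntegral_reflectedMeasure m D A
        (fun x => ∫⁻ y in B, ENNReal.ofReal ((F x - F y) ^ 2) * J x y ∂(m.restrict D))]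
    refine lintegral_congr fun x => ?_
    rw [← setLIntegral_reflectedMeasure m D B
      (fun y => ENNReal.ofReal ((F x - F y) ^ 2) * J x y)]
    simp_rw [hFf]
    rfl
  have hsq : ∀ A : Set X, MeasurableSet A →
      ∫⁻ x in Subtype.val ⁻¹' A, ENNReal.ofReal (f x ^ 2) ∂(reflectedMeasure m D) =
      ∫⁻ x in A ∩ D, ENNReal.ofReal (F x ^ 2) ∂m := by
    intro A hA
    rw [← Measure.restrict_restrict hA,
      ← setLIntegral_reflectedMeasure m D A (fun x => ENNReal.ofReal (F x ^ 2))]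
    refine lintegral_congr_ae (ae_restrict_of_ae ?_)
    filter_upwards [hff'] with x hx
    rw [hx, hFf]
  have hF2 : ∫⁻ x in D, ENNReal.ofReal (F x ^ 2) ∂m < ∞ := by
    have h1 := hsq univ MeasurableSet.univ
    rw [preimage_univ, Measure.restrict_univ, univ_inter] at h1
    rw [← h1]
    have h2 := hf.1.integrable_sq.2
    rwa [hasFiniteIntegral_iff_ofReal (ae_of_all _ fun _ => sq_nonneg _)] at h2
  have hFE : ∫⁻ x in D, ∫⁻ y in D, ENNReal.ofReal ((F x - F y) ^ 2) * J x y ∂m ∂m < ∞ := by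
    have h1 := hjump univ univ MeasurableSet.univ MeasurableSet.univ
    simp only [preimage_univ, univ_prod_univ, Measure.restrict_univ, univ_inter] at h1
    rw [← h1]
    exact hf.2
  obtain ⟨ϕ, hϕF, hϕ, hineq⟩ := hx₀ F hFm hF2 hFE
  have hϕm := hϕ.measurable
  refine ⟨fun x => ϕ x, comp_val_mem_formDomain hJ_meas hDm hϕF hϕm, hϕ.comp_val, ?_⟩
  have hball : ∀ ρ : ℝ, Metric.ball x₀ ρ = Subtype.val ⁻¹' Metric.ball (x₀ : X) ρ := fun _ => rfl
  have e0 : R + (1 + 1) * r = R + 2 * r := by ring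
  have hmb : ∀ ρ : ℝ, MeasurableSet (Metric.ball (x₀ : X) ρ) := fun _ => measurableSet_ball
  have hL : ∫⁻ x in Metric.ball x₀ (R + 2 * r), ENNReal.ofReal (f x ^ 2)
      ∂(energyMeasure (reflectedMeasure m D) (reflectedKernel J D) fun x => ϕ x) =
      ∫⁻ x in Metric.ball (x₀ : X) (R + 2 * r) ∩ D, ENNReal.ofReal (F x ^ 2) *
        ∫⁻ y in D, ENNReal.ofReal ((ϕ x - ϕ y) ^ 2) * J x y ∂m ∂m := by
    have h1 : ∀ᵐ x ∂(energyMeasure (reflectedMeasure m D) (reflectedKernel J D) fun x => ϕ x),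
        ENNReal.ofReal (f x ^ 2) = ENNReal.ofReal (f' x ^ 2) := by
      apply (withDensity_absolutelyContinuous _ _).ae_le
      filter_upwards [hff'] with x hx
      rw [hx]
    rw [lintegral_congr_ae (ae_restrict_of_ae h1),
      setLIntegral_energyMeasure (g := fun x => ENNReal.ofReal (f' x ^ 2))
        (u := fun x : closure D => ϕ x) hJr
        (hϕm.comp measurable_subtype_coe) (by fun_prop)
        Metric.isOpen_ball.measurableSet, ← Measure.restrict_restrict (hmb _),
      ← setLIntegral_reflectedMeasure m D _ (fun x => ENNReal.ofReal (F x ^ 2) *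
        ∫⁻ y in D, ENNReal.ofReal ((ϕ x - ϕ y) ^ 2) * J x y ∂m), hball]
    refine lintegral_congr fun x => ?_
    rw [← lintegral_reflectedMeasure m D (fun y => ENNReal.ofReal ((ϕ x - ϕ y) ^ 2) * J x y), hFf]
    rfl
  rw [e0, hL, hball, hball, hball, hball, ← preimage_sdiff, ← preimage_sdiff,
    hjump _ _ ((hmb _).diff (hmb _)) ((hmb _).diff (hmb _)), hsq _ (hmb _)]
  refine hineq.trans (add_le_add ?_ ?_)
  · have h1 : (C₁ : ℝ≥0∞) ≤ ENNReal.ofReal (C₁ + 1) := by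
      rw [← ENNReal.ofReal_coe_nnreal]; exact ENNReal.ofReal_le_ofReal (by linarith)
    refine mul_le_mul' h1 (lintegral_mono fun x => lintegral_mono_set ?_)
    exact inter_subset_inter_left _ (sdiff_subset_sdiff (Metric.ball_subset_ball (by linarith))
      (Metric.ball_subset_ball (by linarith)))
  · have h1 : (C₂ : ℝ≥0∞) * (ENNReal.ofReal (φ r))⁻¹ ≤ ENNReal.ofReal ((C₂ + 1) / φ r) := by
      rw [ENNReal.ofReal_div_of_pos (hφ.pos hr), div_eq_mul_inv]
      gcongr
      rw [← ENNReal.ofReal_coe_nnreal]; exact ENNReal.ofReal_le_ofReal (by linarith)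
    gcongr

end

end MMD

theorem theorem5p3 {X : Type*} [MetricSpace X] [LocallyCompactSpace X] [SeparableSpace X]
    [MeasurableSpace X] [BorelSpace X]
    (m : Measure X) [m.Regular] [m.IsOpenPosMeasure]
    (J : X → X → ℝ≥0∞) (hJ_meas : Measurable fun p : X × X => J p.1 p.2)
    (hJ_symm : ∀ x y : X, J x y = J y x)
    (h_reg : MMD.IsRegularForm m J)
    (φ : ℝ → ℝ) (hφ : MMD.IsScaleFunction φ)
    (h_vd : MMD.VolumeDoubling m)
    (hJφ : MMD.JumpKernelBounds m J φ)
    (h_csj : MMD.CSJ m J φ)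
    (D : Set X) (hD_open : IsOpen D) (hD : MMD.AhlforsRegular m D) :
    MMD.CSJ (MMD.reflectedMeasure m D) (MMD.reflectedKernel J D) φ := by
  have : SecondCountableTopology X := UniformSpace.secondCountable_of_separable X
  exact h_csj.reflected hJ_meas hJ_symm hφ h_vd hJφ hD_open hD
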